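/- **Setting.** Let $T$ be an irreducible stochastic matrix on a finite set $\mathbb X$, $\pi$ its stationary law, $L=T-\mathrm{Id}$, $P_t=e^{tL}$, and let $\mathbf E$ and $\mathrm{Var}$ denote mean and variance under $\pi$. Adjoints are taken in $L^2(\pi)$, so $P_t^\star(x,y)=\pi(y)P_t(y,x)/\pi(x)$. The chain is *weakly reversible* if $T(x,y)>0\Rightarrow T(y,x)>0$. Write $\mathrm{dist}(x,y)=\min\{k\ge 0: T^k(x,y)>0\}$, $\mathrm{diam}=\max_{x,y}\mathrm{dist}(x,y)$, and $d=\max\{1/T(x,y): T(x,y)>0\}$. Let $\Gamma(f,g)=\frac12(L(fg)-fLg-gLf)$ and $\Gamma_2(f,g)=\frac12(L\Gamma(f,g)-\Gamma(f,Lg)-\Gamma(g,Lf))$; the Bakry–Émery curvature is the largest $\rho$ such that $\Gamma_2(f,f)\ge\rho\,\Gamma(f,f)$ for all $f$. For $f\ge0$ let $\mathrm{Ent}(f)=\mathbf E[f\log f]-\mathbf E[f]\log\mathbf E[f]$ and, for a density $f$ with respect to $\pi$, $\mathrm{Varent}(f)=\mathrm{Var}[\log f(Z)]$ where $Z$ has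 law $f\,\mathrm d\pi$. With $\mathscr E(f,g)=\mathbf E[f\cdot(-Lg)]$, let $\gamma$ be the largest constant with $\mathscr E(f,f)\ge\gamma\mathrm{Var}(f)$ for all $f$, and $\alpha$ the largest constant with $\mathscr E(f,\log f)\ge\alpha\,\mathrm{Ent}(f)$ for all $f>0$. Let $\mathrm t_{\mathrm{mix}}(x,\varepsilon)$ be the first $t\ge0$ at which the total-variation distance between $P_t(x,\cdot)$ and $\pi$ is at most $\varepsilon$, $\mathrm t_{\mathrm{mix}}(\varepsilon)=\max_x \mathrm t_{\mathrm{mix}}(x,\varepsilon)$, $\mathrm t_{\mathrm{mix}}=\mathrm t_{\mathrm{mix}}(\frac1{2e})$, $\mathrm w_{\mathrm{mix}}(x,\varepsilon)=\mathrm t_{\mathrm{mix}}(x,\varepsilon)-\mathrm t_{\mathrm{mix}}(x,1-\varepsilon)$ and $\mathrm w_{\mathrm{mix}}(\varepsilon)=\mathrm t_{\mathrm{mix}}(\varepsilon)-\mathrm t_{\mathrm{mix}}(1-\varepsilon)$. Finally $\log_+u=\max\{\log u,0\}$, with $\log_+ 0=0$; terms of the form $t\log_+(\mathrm{diam}/t)$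 are read as $0$ at $t=0$, and a term $\log 0$ in a maximum is omitted. **Theorem (Cutoff for non-negatively curved chains).** Consider a weakly reversible chain with $\rho\ge 0$ and $d\ge 2$ (the latter excludes only the one-point chain and the deterministic swap of two points). 1. *Differential inequality.* For each $x\in\mathbb X$, the density $f_t=P_t(x,\cdot)/\pi$ satisfies, for every $t>0$, that $s\mapsto \mathrm{Ent}(f_s)$ is differentiable at $t$ and $$\mathrm{Varent}(f_t)\le-\psi(t)\,\frac{\mathrm d}{\mathrm dt}\mathrm{Ent}(f_t),\qquad \psi(t)=16\,t\log d+4\,t\log_+\!\left(\frac{\mathrm{diam}}{t}\right)>0.$$ 2. *Width estimates.* For each $\varepsilon\in(0,\frac12)$ there is $c_\varepsilon\in(0,\infty)$, depending only on $\varepsilon$, such that for every such chain and all $x\in\mathbb X$, writing $t_x=\mathrm t_{\mathrm{mix}}(x,\varepsilon)$, $$\mathrm w_{\mathrm{mix}}(x,\varepsilon)\le c_\varepsilon\max\left\{\frac1\gamma,\sqrt{\frac{t_x\log d}{\gamma}},\sqrt{\frac{t_x}{\gamma}\log_+\!\left(\frac{\mathrm{diam}}{t_x}\right)}\right\},\qquad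 \mathrm w_{\mathrm{mix}}(x,\varepsilon)\le\frac{c_\varepsilon}{\alpha}\max\{1,\log\log d,\log(\alpha t_x)\},$$ and from the worst starting point $$\mathrm w_{\mathrm{mix}}(\varepsilon)\le c_\varepsilon\max\left\{\frac1\gamma,\sqrt{\frac{\mathrm t_{\mathrm{mix}}\log d}{\gamma}}\right\},\qquad \mathrm w_{\mathrm{mix}}(\varepsilon)\le\frac{c_\varepsilon}{\alpha}\max\{1,\log\log d,\log(\alpha\,\mathrm t_{\mathrm{mix}})\}.$$ 3. *Cutoff.* Consider a sequence of irreducible weakly reversible chains with $\rho\ge0$ on state spaces $\mathbb X_n$ with $|\mathbb X_n|\to\infty$ (the index $n$ is omitted from all quantities), and write $a\gg b$ for $a/b\to\infty$. For any starting points $x=x_n$, if for some fixed $\varepsilon\in(0,1)$ $$\gamma\,\mathrm t_{\mathrm{mix}}(x,\varepsilon)\gg\max\{\log d,\log(\gamma\,\mathrm{diam})\}\quad\text{or}\quad\alpha\,\mathrm t_{\mathrm{mix}}(x,\varepsilon)\gg\max\{1,\log\log d\},$$ then there is cutoff from $x$: $\mathrm t_{\mathrm{mix}}(x,1-\varepsilon')/\mathrm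 t_{\mathrm{mix}}(x,\varepsilon')\to1$ for every $\varepsilon'\in(0,1)$. If $$\gamma\,\mathrm t_{\mathrm{mix}}\gg\log d\quad\text{or}\quad\alpha\,\mathrm t_{\mathrm{mix}}\gg\max\{1,\log\log d\},$$ then there is worst-case cutoff: $\mathrm t_{\mathrm{mix}}(1-\varepsilon')/\mathrm t_{\mathrm{mix}}(\varepsilon')\to1$ for every $\varepsilon'\in(0,1)$. -/

import Mathlib

open Filter Topology

universe u

/-- An irreducible continuous-time Markov chain on a finite state space `X`: the stochastic
transition matrix `T` together with its stationary law `π` (which is unique, by irreducibility). -/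
structure FiniteMarkovChain (X : Type u) [Fintype X] [DecidableEq X] where
  T : Matrix X X ℝ
  π : X → ℝ
  T_nonneg : ∀ x y, 0 ≤ T x y
  T_row_sum : ∀ x, ∑ y, T x y = 1
  irreducible : ∀ x y, ∃ k : ℕ, 0 < (T ^ k) x y
  π_nonneg : ∀ x, 0 ≤ π x
  π_sum : ∑ x, π x = 1
  stationary : ∀ y, ∑ x, π x * T x y = π y

namespace FiniteMarkovChain

noncomputable section

variable {X : Type u} [Fintype X] [DecidableEq X] (C : FiniteMarkovChain X)

/-- The infinitesimal generator `L = T - Id`. -/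
def L : Matrix X X ℝ := C.T - 1

/-- The semi-group `P_t = exp (t L)`. -/
def P (t : ℝ) : Matrix X X ℝ := NormedSpace.exp (t • C.L)

/-- The adjoint in `L²(π)` of a matrix: `A⋆(x,y) = π(y) A(y,x) / π(x)`. -/
def adjoint (A : Matrix X X ℝ) : Matrix X X ℝ :=
  Matrix.of fun x y => C.π y * A y x / C.π x

/-- The stationary mean `𝐄[f]`. -/
def mean (f : X → ℝ) : ℝ := ∑ x, C.π x * f x

/-- The variance under the stationary law. -/
def variance (f : X → ℝ) : ℝ := C.mean (fun x => f x ^ 2) - C.mean f ^ 2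

/-- The entropy `Ent(f) = 𝐄[f log f] - 𝐄[f] log 𝐄[f]` (with `0 log 0 = 0`). -/
def ent (f : X → ℝ) : ℝ :=
  C.mean (fun x => f x * Real.log (f x)) - C.mean f * Real.log (C.mean f)

/-- The varentropy of a density `f`: the variance of `log f(Z)` where `Z` has law `f dπ`. -/
def varent (f : X → ℝ) : ℝ :=
  C.mean (fun x => f x * Real.log (f x) ^ 2) - C.mean (fun x => f x * Real.log (f x)) ^ 2

/-- The Dirichlet form `ℰ(f,g) = ⟨f, -L g⟩` in `L²(π)`. -/
def dirichletForm (f g : X → ℝ) : ℝ := C.mean (fun x => f x * (-(C.L.mulVec g) x))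

/-- The Poincaré constant `γ`: the largest constant in `ℰ(f,f) ≥ γ Var(f)`. -/
def poincareConst : ℝ :=
  sSup {γ : ℝ | 0 ≤ γ ∧ ∀ f : X → ℝ, γ * C.variance f ≤ C.dirichletForm f f}

/-- The modified log-Sobolev constant `α`: the largest constant in
`ℰ(f, log f) ≥ α Ent(f)`, for positive `f`. -/
def mlsConst : ℝ :=
  sSup {α : ℝ | 0 ≤ α ∧ ∀ f : X → ℝ, (∀ x, 0 < f x) →
    α * C.ent f ≤ C.dirichletForm f (fun x => Real.log (f x))}

/-- The carré du champ operator. -/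
def carre (f g : X → ℝ) (x : X) : ℝ :=
  (1 / 2) * (C.L.mulVec (f * g) x - f x * C.L.mulVec g x - g x * C.L.mulVec f x)

/-- The iterated carré du champ operator. -/
def carre₂ (f g : X → ℝ) (x : X) : ℝ :=
  (1 / 2) * (C.L.mulVec (C.carre f g) x - C.carre f (C.L.mulVec g) x
    - C.carre g (C.L.mulVec f) x)

/-- The Bakry–Émery criterion `CD(ρ,∞)`. -/
def CD (ρ : ℝ) : Prop := ∀ (f : X → ℝ) (x : X), ρ * C.carre f f x ≤ C.carre₂ f f x

/-- The Bakry–Émery curvature: the largest `ρ` for which `CD(ρ,∞)` holds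
(an extended real: `⊥` if there is none, `⊤` if all are admissible). -/
def curvature : EReal := sSup ((fun r : ℝ => (r : EReal)) '' {ρ : ℝ | C.CD ρ})

/-- Weak reversibility: the edge set `{(x,y) : T(x,y) > 0}` is symmetric. -/
def WeaklyReversible : Prop := ∀ x y, 0 < C.T x y → 0 < C.T y x

/-- The hop-count distance. -/
def hopDist (x y : X) : ℕ := sInf {k : ℕ | 0 < (C.T ^ k) x y}

/-- The diameter for the hop-count distance. -/
def diam : ℕ := Finset.univ.sup fun p : X × X => C.hopDist p.1 p.2

/-- The sparsity parameter `d`: the maximum of `1 / T(x,y)` over the edges `T(x,y) > 0`. -/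
def sparsity : ℝ := ⨆ p : {p : X × X // 0 < C.T p.1 p.2}, 1 / C.T p.1.1 p.1.2

/-- The Dirac density `f^x = 1_x / π(x)`. -/
def dirac (x : X) : X → ℝ := Pi.single x (1 / C.π x)

/-- The density `f_t = P_t⋆ f` at time `t` of the chain with initial density `f`. -/
def density (f : X → ℝ) (t : ℝ) : X → ℝ := (C.adjoint (C.P t)).mulVec f

/-- Total-variation distance to `π` of the law with density `f`. -/
def tv (f : X → ℝ) : ℝ := (1 / 2) * C.mean (fun x => |f x - 1|)

/-- The worst-case distance to equilibrium at time `t`. -/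
def worstTV (t : ℝ) : ℝ := ⨆ x : X, C.tv (C.density (C.dirac x) t)

/-- The mixing time from the initial density `f`. -/
def tmixFrom (f : X → ℝ) (ε : ℝ) : ℝ := sInf {t : ℝ | 0 ≤ t ∧ C.tv (C.density f t) ≤ ε}

/-- The worst-case mixing time with precision `ε`. -/
def tmix (ε : ℝ) : ℝ := sInf {t : ℝ | 0 ≤ t ∧ C.worstTV t ≤ ε}

/-- The worst-case mixing time with the default precision `1/(2e)`. -/
def tmixDefault : ℝ := C.tmix (1 / (2 * Real.exp 1))

/-- The width of the mixing window from the initial density `f`. -/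
def wmixFrom (f : X → ℝ) (ε : ℝ) : ℝ := C.tmixFrom f ε - C.tmixFrom f (1 - ε)

/-- The width of the worst-case mixing window. -/
def wmix (ε : ℝ) : ℝ := C.tmix ε - C.tmix (1 - ε)

/-- The information-theoretic differential inequality with rate `ψ : (0,∞) → (0,∞)`,
from the initial density `f`: for all `t > 0`,
`Varent(f_t) ≤ -ψ(t) d/dt Ent(f_t)` (the derivative being required to exist). -/
def SatisfiesIDI (f : X → ℝ) (ψ : ℝ → ℝ) : Prop :=
  ∀ t : ℝ, 0 < t → 0 < ψ t ∧
    DifferentiableAt ℝ (fun s => C.ent (C.density f s)) t ∧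
    C.varent (C.density f t) ≤ -ψ t * deriv (fun s => C.ent (C.density f s)) t

end

end FiniteMarkovChain

/-- `a ≫ b`: the ratio `a n / b n` tends to `+∞`. -/
def MuchGreater (a b : ℕ → ℝ) : Prop := Tendsto (fun n => a n / b n) atTop atTop

/-- Cutoff for a sequence `t n ε` of mixing times with precision `ε`. -/
def HasCutoff (t : ℕ → ℝ → ℝ) : Prop :=
  ∀ ε : ℝ, 0 < ε → ε < 1 → Tendsto (fun n => t n (1 - ε) / t n ε) atTop (𝓝 1)

/-!
# Cutoff for non-negatively curved Markov chains

Let `f_t` be the density at time `t` of the law of the chain started from a state.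

*Differential inequality.* Non-negative curvature gives the sub-commutation
`Γ (P_t g) ≤ P_t (Γ g)`, hence the local Poincaré inequality
`P_t (g ^ 2) - (P_t g) ^ 2 ≤ 2 t P_t (Γ g)` (`local_poincare`). Applied to `g = log f_t`, it bounds
the varentropy of `f_t` by `2 t` times the Fisher information `𝐄[f_t Γ (log f_t)]`. The latter is
compared with the entropy dissipation `ℰ(f_t, log f_t)` term by term, through
`v ^ 2 / 2 ≤ (1 + K) (exp v - 1 - v)` for `v ≥ -K`, where `v` is an increment of `log f_t` along an
edge (`mean_mul_carre_log_le`). A regularity estimate for the heat kernel along edges, which rests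
on a Chernoff bound for the number of jumps (`P_le_mul_P_of_edge`), allows one to take for `K` a
combination of `log d` and `log₊ (diam / t)`. This is `satisfiesIDI_dirac`.

*Width.* Between the times at which the total-variation distance is `1 - ε` and `ε`, a
density with a large entropy `E` has varentropy at least of order `E ^ 2` (`ent_sq_le_varent`). The
differential inequality then reads `E ^ 2 ≲ - ψ E'`, so that `E` drops to order `Ψ / s` within a
time `s`, whatever its initial value (`ent_density_le_of_tmixFrom_lt`), with `Ψ` a bound on `ψ`.
From there, the chain mixes in a time of order `(1 + E) / γ` (`tv_density_le_of_ent`), or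
`(1 + log₊ E) / α` (`ent_density_le`, `tv_sq_le_ent`). Optimizing over `s` gives the width estimates. For
the one based on the modified log-Sobolev constant, the dependence on the diameter disappears
because of the bound `log (α diam) ≤ 22 log d`, which follows from Herbst's concentration argument
(`log_mlsConst_mul_diam_le`). In the worst case it disappears because mixing takes at least a time
of the order of the diameter (`diam_mul_le`), and worst-case mixing times for different precisions
are comparable by submultiplicativity (`tmix_le_mul_tmixDefault`).

*Cutoff.* Under the product conditions, the width is negligible compared with the mixing time at all
small enough precisions, which suffices by monotonicity (`hasCutoff_of_window`).
-/

namespace FiniteMarkovChain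

section

variable {X : Type u} [Fintype X] [DecidableEq X] (C : FiniteMarkovChain X)

/-! ### The stationary law and the generator -/

lemma pow_nonneg (k : ℕ) (x y : X) : 0 ≤ (C.T ^ k) x y := by
  induction k generalizing x y with
  | zero => rw [pow_zero, Matrix.one_apply]; split_ifs <;> norm_num
  | succ k ih =>
    rw [pow_succ, Matrix.mul_apply]
    exact Finset.sum_nonneg fun z _ => mul_nonneg (ih x z) (C.T_nonneg z y)

lemma pow_row_sum (k : ℕ) (x : X) : ∑ y, (C.T ^ k) x y = 1 := by
  induction k generalizing x with
  | zero => simp [Matrix.one_apply]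
  | succ k ih =>
    simp only [pow_succ, Matrix.mul_apply]
    rw [Finset.sum_comm]
    simp only [← Finset.mul_sum, C.T_row_sum, mul_one, ih]

lemma pow_le_one (k : ℕ) (x y : X) : (C.T ^ k) x y ≤ 1 := by
  rw [← C.pow_row_sum k x]
  exact Finset.single_le_sum (f := fun z => (C.T ^ k) x z)
    (fun z _ => C.pow_nonneg k x z) (Finset.mem_univ y)

lemma stationary_pow (k : ℕ) (y : X) : ∑ x, C.π x * (C.T ^ k) x y = C.π y := by
  induction k generalizing y with
  | zero => simp [Matrix.one_apply]
  | succ k ih =>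
    simp only [pow_succ, Matrix.mul_apply, Finset.mul_sum]
    rw [Finset.sum_comm]
    simp only [← mul_assoc, ← Finset.sum_mul, ih]
    exact C.stationary y

lemma pi_pos (x : X) : 0 < C.π x := by
  obtain ⟨z, hz⟩ : ∃ z, 0 < C.π z := by
    by_contra! h
    have := Finset.sum_nonpos fun z (_ : z ∈ Finset.univ) => h z
    rw [C.π_sum] at this
    linarith
  obtain ⟨k, hk⟩ := C.irreducible z x
  rw [← C.stationary_pow k x]
  exact Finset.sum_pos' (fun w _ => mul_nonneg (C.π_nonneg w) (C.pow_nonneg k w x))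
    ⟨z, Finset.mem_univ z, mul_pos hz hk⟩

lemma nonempty (C : FiniteMarkovChain X) : Nonempty X := by
  by_contra h
  rw [not_nonempty_iff] at h
  have := C.π_sum
  simp at this

lemma L_mulVec (g : X → ℝ) (x : X) : C.L.mulVec g x = ∑ y, C.T x y * (g y - g x) := by
  rw [L, Matrix.sub_mulVec, Matrix.one_mulVec, Pi.sub_apply]
  simp only [Matrix.mulVec, dotProduct, mul_sub, Finset.sum_sub_distrib, ← Finset.sum_mul,
    C.T_row_sum, one_mul]

lemma L_row_sum (x : X) : ∑ y, C.L x y = 0 := by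
  simp [L, Matrix.sub_apply, Finset.sum_sub_distrib, C.T_row_sum, Matrix.one_apply]

lemma pi_L (y : X) : ∑ x, C.π x * C.L x y = 0 := by
  simp [L, Matrix.sub_apply, mul_sub, Finset.sum_sub_distrib, C.stationary, Matrix.one_apply]

/-! ### The semigroup -/

lemma P_zero : C.P 0 = 1 := by simp [P]

lemma P_add (s t : ℝ) : C.P (s + t) = C.P s * C.P t := by
  rw [P, add_smul]
  exact Matrix.exp_add_of_commute _ _ (((Commute.refl C.L).smul_left s).smul_right t)

lemma hasDerivAt_P (x y : X) (t : ℝ) :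
    HasDerivAt (fun s => C.P s x y) ((C.P t * C.L) x y) t := by
  let _ : NormedRing (Matrix X X ℝ) := Matrix.linftyOpNormedRing
  let _ : NormedAlgebra ℝ (Matrix X X ℝ) := Matrix.linftyOpNormedAlgebra
  have h : HasDerivAt C.P (C.P t * C.L) t := hasDerivAt_exp_smul_const C.L t
  exact hasDerivAt_pi.1 (hasDerivAt_pi.1 h x) y

lemma hasDerivAt_P_left (x y : X) (t : ℝ) :
    HasDerivAt (fun s => C.P s x y) ((C.L * C.P t) x y) t := by
  let _ : NormedRing (Matrix X X ℝ) := Matrix.linftyOpNormedRing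
  let _ : NormedAlgebra ℝ (Matrix X X ℝ) := Matrix.linftyOpNormedAlgebra
  have h : HasDerivAt C.P (C.L * C.P t) t := hasDerivAt_exp_smul_const' C.L t
  exact hasDerivAt_pi.1 (hasDerivAt_pi.1 h x) y

lemma P_eq (t : ℝ) : C.P t = Real.exp (-t) • NormedSpace.exp (t • C.T) := by
  have h1 : t • C.L = Matrix.diagonal (fun _ : X => -t) + t • C.T := by
    rw [L, smul_sub, sub_eq_neg_add, ← Matrix.smul_one_eq_diagonal, neg_smul]
  have h2 : Commute (Matrix.diagonal (fun _ : X => -t)) (t • C.T) := by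
    rw [← Matrix.smul_one_eq_diagonal]
    exact (Commute.one_left _).smul_left _
  have h3 : NormedSpace.exp (fun _ : X => -t) = fun _ => Real.exp (-t) := by
    ext x
    rw [NormedSpace.exp, Real.exp_eq_exp_ℝ]
    rw [← NormedSpace.exp, Pi.coe_exp]
  rw [P, h1, Matrix.exp_add_of_commute _ _ h2, Matrix.exp_diagonal, h3,
    ← Matrix.smul_one_eq_diagonal, smul_mul_assoc, one_mul]

lemma hasSum_exp_smul_T (t : ℝ) (x y : X) :
    HasSum (fun k : ℕ => t ^ k / k.factorial * (C.T ^ k) x y)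
      (NormedSpace.exp (t • C.T) x y) := by
  let _ : NormedRing (Matrix X X ℝ) := Matrix.linftyOpNormedRing
  let _ : NormedAlgebra ℝ (Matrix X X ℝ) := Matrix.linftyOpNormedAlgebra
  have h := NormedSpace.exp_series_hasSum_exp' (𝕂 := ℝ) (t • C.T)
  have h2 := Pi.hasSum.1 (Pi.hasSum.1 h x) y
  have h3 : (fun k : ℕ => t ^ k / k.factorial * (C.T ^ k) x y)
      = fun k : ℕ => ((k.factorial : ℝ)⁻¹ • (t • C.T) ^ k) x y := by
    ext k
    rw [smul_pow, smul_smul, Matrix.smul_apply, smul_eq_mul, div_eq_inv_mul]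
  rw [h3]
  exact h2

lemma hasSum_P (t : ℝ) (x y : X) :
    HasSum (fun k : ℕ => Real.exp (-t) * (t ^ k / k.factorial * (C.T ^ k) x y)) (C.P t x y) := by
  rw [P_eq]
  exact (C.hasSum_exp_smul_T t x y).mul_left _

lemma exp_smul_T_le (t : ℝ) (ht : 0 ≤ t) (x y : X) :
    NormedSpace.exp (t • C.T) x y ≤ Real.exp t := by
  have h := NormedSpace.expSeries_div_hasSum_exp t
  rw [← Real.exp_eq_exp_ℝ] at h
  refine hasSum_le (fun k => ?_) (C.hasSum_exp_smul_T t x y) h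
  exact mul_le_of_le_one_right (by positivity) (C.pow_le_one k x y)

lemma P_nonneg {t : ℝ} (ht : 0 ≤ t) (x y : X) : 0 ≤ C.P t x y :=
  (C.hasSum_P t x y).nonneg fun k =>
    mul_nonneg (Real.exp_nonneg _) (mul_nonneg (by positivity) (C.pow_nonneg k x y))

lemma le_P {t : ℝ} (ht : 0 ≤ t) (k : ℕ) (x y : X) :
    Real.exp (-t) * (t ^ k / k.factorial * (C.T ^ k) x y) ≤ C.P t x y :=
  le_hasSum (C.hasSum_P t x y) k fun k _ =>
    mul_nonneg (Real.exp_nonneg _) (mul_nonneg (by positivity) (C.pow_nonneg k x y))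

lemma P_pos {t : ℝ} (ht : 0 < t) (x y : X) : 0 < C.P t x y := by
  obtain ⟨k, hk⟩ := C.irreducible x y
  exact lt_of_lt_of_le (by positivity) (C.le_P ht.le k x y)

lemma P_row_sum (t : ℝ) (x : X) : ∑ y, C.P t x y = 1 := by
  have hd : ∀ s, HasDerivAt (fun s => ∑ y, C.P s x y) 0 s := fun s => by
    have h := HasDerivAt.fun_sum (u := Finset.univ) fun y _ => C.hasDerivAt_P x y s
    refine h.congr_deriv ?_
    simp only [Matrix.mul_apply]
    rw [Finset.sum_comm]
    simp only [← Finset.mul_sum, C.L_row_sum, mul_zero, Finset.sum_const_zero]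
  have h := is_const_of_deriv_eq_zero (fun s => (hd s).differentiableAt) (fun s => (hd s).deriv) t 0
  rw [h, P_zero]
  simp [Matrix.one_apply]

lemma pi_P (t : ℝ) (y : X) : ∑ x, C.π x * C.P t x y = C.π y := by
  have hd : ∀ s, HasDerivAt (fun s => ∑ x, C.π x * C.P s x y) 0 s := fun s => by
    have h := HasDerivAt.fun_sum (u := Finset.univ)
      fun x _ => (C.hasDerivAt_P_left x y s).const_mul (C.π x)
    refine h.congr_deriv ?_
    simp only [Matrix.mul_apply, Finset.mul_sum]
    rw [Finset.sum_comm]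
    simp only [← mul_assoc, ← Finset.sum_mul, C.pi_L, zero_mul, Finset.sum_const_zero]
  have h := is_const_of_deriv_eq_zero (fun s => (hd s).differentiableAt) (fun s => (hd s).deriv) t 0
  rw [h, P_zero]
  simp [Matrix.one_apply]

lemma hasDerivAt_P_mulVec (g : X → ℝ) (x : X) (t : ℝ) :
    HasDerivAt (fun s => (C.P s).mulVec g x) (C.L.mulVec ((C.P t).mulVec g) x) t := by
  have h := HasDerivAt.fun_sum (u := Finset.univ)
    fun y _ => (C.hasDerivAt_P_left x y t).mul_const (g y)
  rw [Matrix.mulVec_mulVec]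
  exact h

/-! ### Curvature and the local Poincaré inequality -/

lemma carre_eq (f g : X → ℝ) (x : X) :
    C.carre f g x = (1 / 2) * ∑ y, C.T x y * ((f y - f x) * (g y - g x)) := by
  simp only [carre, L_mulVec, Finset.mul_sum, ← Finset.sum_sub_distrib, Pi.mul_apply]
  exact Finset.sum_congr rfl fun y _ => by ring

lemma carre_self_nonneg (f : X → ℝ) (x : X) : 0 ≤ C.carre f f x := by
  rw [carre_eq]
  exact mul_nonneg (by norm_num)
    (Finset.sum_nonneg fun y _ => mul_nonneg (C.T_nonneg x y) (mul_self_nonneg _))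

/-- The set of admissible curvature bounds is closed, so that the supremum is attained as soon as
it is finite. -/
lemma cd_zero_of_curvature_nonneg (h : 0 ≤ C.curvature) : C.CD 0 := by
  intro f x
  rw [zero_mul]
  refine le_of_forall_pos_le_add fun ε hε => ?_
  set δ : ℝ := ε / (C.carre f f x + 1) with hδ
  have hΓ := C.carre_self_nonneg f x
  have hδ0 : 0 < δ := by positivity
  have h1 : ((-δ : ℝ) : EReal) < C.curvature :=
    lt_of_lt_of_le (by exact_mod_cast neg_lt_zero.2 hδ0) h
  obtain ⟨_, ⟨ρ, hρ, rfl⟩, hlt⟩ := lt_sSup_iff.1 h1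
  have hlt' : -δ < ρ := EReal.coe_lt_coe_iff.1 hlt
  have h2 := hρ f x
  have h3 : -δ * C.carre f f x ≤ ρ * C.carre f f x := mul_le_mul_of_nonneg_right hlt'.le hΓ
  have h4 : δ * C.carre f f x ≤ ε := by
    rw [hδ, div_mul_eq_mul_div, div_le_iff₀ (by positivity)]
    nlinarith
  linarith

lemma mulVec_P_mono {t : ℝ} (ht : 0 ≤ t) {f g : X → ℝ} (h : ∀ y, f y ≤ g y) (x : X) :
    (C.P t).mulVec f x ≤ (C.P t).mulVec g x :=
  Finset.sum_le_sum fun y _ => mul_le_mul_of_nonneg_left (h y) (C.P_nonneg ht x y)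

/-- The product rule for `s ↦ P_s q_s`, where the function `q_s` itself depends on time. -/
lemma hasDerivAt_P_mulVec_path {q : ℝ → X → ℝ} {q' : X → ℝ} {s : ℝ}
    (hq : ∀ y, HasDerivAt (fun r => q r y) (q' y) s) (x : X) :
    HasDerivAt (fun r => (C.P r).mulVec (q r) x)
      ((C.P s).mulVec (fun y => C.L.mulVec (q s) y + q' y) x) s := by
  have h := HasDerivAt.fun_sum (u := Finset.univ)
    fun y _ => (C.hasDerivAt_P x y s).mul (hq y)
  refine h.congr_deriv ?_
  rw [Finset.sum_add_distrib]
  have h1 : ∑ y, (C.P s * C.L) x y * q s y = (C.P s).mulVec (C.L.mulVec (q s)) x := by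
    rw [Matrix.mulVec_mulVec]; rfl
  rw [h1]
  simp only [Matrix.mulVec, dotProduct, mul_add, Finset.sum_add_distrib]

lemma hasDerivAt_P_mulVec_reverse (g : X → ℝ) (t s : ℝ) (y : X) :
    HasDerivAt (fun r => (C.P (t - r)).mulVec g y)
      (-C.L.mulVec ((C.P (t - s)).mulVec g) y) s := by
  have h := (C.hasDerivAt_P_mulVec g y (t - s)).comp s ((hasDerivAt_id s).const_sub t)
  refine h.congr_deriv ?_
  ring

/-- Under non-negative curvature, `s ↦ P_s Γ(P_{t-s} g)` is non-decreasing, its derivative being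
`2 P_s Γ₂(P_{t-s} g)`. -/
lemma monotoneOn_P_carre (hCD : C.CD 0) (g : X → ℝ) (t : ℝ) (x : X) :
    MonotoneOn (fun s => (C.P s).mulVec
      (C.carre ((C.P (t - s)).mulVec g) ((C.P (t - s)).mulVec g)) x) (Set.Icc 0 t) := by
  have hd : ∀ s, HasDerivAt (fun s => (C.P s).mulVec
      (C.carre ((C.P (t - s)).mulVec g) ((C.P (t - s)).mulVec g)) x)
      ((C.P s).mulVec (fun y => 2 * C.carre₂ ((C.P (t - s)).mulVec g)
        ((C.P (t - s)).mulVec g) y) x) s := by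
    intro s
    set h := (C.P (t - s)).mulVec g with hh
    have hq : ∀ y, HasDerivAt
        (fun r => C.carre ((C.P (t - r)).mulVec g) ((C.P (t - r)).mulVec g) y)
        (-2 * C.carre h (C.L.mulVec h) y) s := by
      intro y
      simp only [carre_eq]
      have h1 : ∀ z, HasDerivAt
          (fun r => (C.P (t - r)).mulVec g z - (C.P (t - r)).mulVec g y)
          (-C.L.mulVec h z - -C.L.mulVec h y) s := fun z =>
        (C.hasDerivAt_P_mulVec_reverse g t s z).sub (C.hasDerivAt_P_mulVec_reverse g t s y)
      have h2 := (HasDerivAt.fun_sum (u := Finset.univ)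
        fun z _ => ((h1 z).mul (h1 z)).const_mul (C.T y z)).const_mul (1 / 2 : ℝ)
      refine h2.congr_deriv ?_
      simp only [Finset.mul_sum]
      exact Finset.sum_congr rfl fun z _ => by rw [← hh]; ring
    refine (C.hasDerivAt_P_mulVec_path hq x).congr_deriv ?_
    congr 1
    ext y
    simp only [← hh, carre₂]
    ring
  refine monotoneOn_of_deriv_nonneg (convex_Icc 0 t)
    (fun s _ => (hd s).continuousAt.continuousWithinAt)
    (fun s _ => (hd s).differentiableAt.differentiableWithinAt) fun s hs => ?_
  rw [interior_Icc] at hs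
  rw [(hd s).deriv]
  refine Finset.sum_nonneg fun y _ => mul_nonneg (C.P_nonneg hs.1.le x y) ?_
  have := hCD ((C.P (t - s)).mulVec g) y
  linarith

/-- The local Poincaré inequality of Bakry and Émery. -/
lemma local_poincare (hCD : C.CD 0) (g : X → ℝ) {t : ℝ} (ht : 0 ≤ t) (x : X) :
    (C.P t).mulVec (fun y => g y ^ 2) x - (C.P t).mulVec g x ^ 2
      ≤ 2 * t * (C.P t).mulVec (C.carre g g) x := by
  have hmono := C.monotoneOn_P_carre hCD g t x
  have hd : ∀ s, HasDerivAt
      (fun s => (C.P s).mulVec (fun y => (C.P (t - s)).mulVec g y ^ 2) x)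
      (2 * (C.P s).mulVec
        (C.carre ((C.P (t - s)).mulVec g) ((C.P (t - s)).mulVec g)) x) s := by
    intro s
    set h := (C.P (t - s)).mulVec g with hh
    have hq : ∀ y, HasDerivAt (fun r => (C.P (t - r)).mulVec g y ^ 2)
        (-2 * h y * C.L.mulVec h y) s := by
      intro y
      refine ((C.hasDerivAt_P_mulVec_reverse g t s y).pow 2).congr_deriv ?_
      rw [← hh]
      push_cast
      ring
    refine (C.hasDerivAt_P_mulVec_path hq x).congr_deriv ?_
    rw [← smul_eq_mul, ← Pi.smul_apply, ← Matrix.mulVec_smul]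
    congr 1
    ext y
    have hsq : (fun y => (C.P (t - s)).mulVec g y ^ 2) = h * h := by
      ext z; rw [← hh, Pi.mul_apply, sq]
    rw [hsq, Pi.smul_apply, smul_eq_mul, carre]
    ring
  have hbound := Convex.image_sub_le_mul_sub_of_deriv_le (convex_Icc 0 t)
    (fun s _ => (hd s).continuousAt.continuousWithinAt)
    (fun s _ => (hd s).differentiableAt.differentiableWithinAt)
    (C := 2 * (C.P t).mulVec (C.carre g g) x) (fun s hs => by
      rw [interior_Icc] at hs
      rw [(hd s).deriv]
      have := hmono (Set.Ioo_subset_Icc_self hs) (Set.right_mem_Icc.2 ht) hs.2.le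
      simp only [sub_self, P_zero, Matrix.one_mulVec] at this
      linarith) 0 (Set.left_mem_Icc.2 ht) t (Set.right_mem_Icc.2 ht) ht
  simp only [sub_self, sub_zero, P_zero, Matrix.one_mulVec] at hbound
  linarith

/-! ### Means and adjoints -/

lemma mean_mono {f g : X → ℝ} (h : ∀ x, f x ≤ g x) : C.mean f ≤ C.mean g :=
  Finset.sum_le_sum fun x _ => mul_le_mul_of_nonneg_left (h x) (C.π_nonneg x)

lemma mean_nonneg {f : X → ℝ} (h : ∀ x, 0 ≤ f x) : 0 ≤ C.mean f :=
  Finset.sum_nonneg fun x _ => mul_nonneg (C.π_nonneg x) (h x)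

lemma mean_add (f g : X → ℝ) : C.mean (fun x => f x + g x) = C.mean f + C.mean g := by
  simp only [mean, mul_add, Finset.sum_add_distrib]

lemma mean_sub (f g : X → ℝ) : C.mean (fun x => f x - g x) = C.mean f - C.mean g := by
  simp only [mean, mul_sub, Finset.sum_sub_distrib]

lemma mean_const_mul (c : ℝ) (f : X → ℝ) : C.mean (fun x => c * f x) = c * C.mean f := by
  simp only [mean, Finset.mul_sum]
  exact Finset.sum_congr rfl fun x _ => by ring

lemma mean_const (c : ℝ) : C.mean (fun _ => c) = c := by
  rw [mean, ← Finset.sum_mul, C.π_sum, one_mul]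

lemma pi_mul_le_mean {f : X → ℝ} (h : ∀ x, 0 ≤ f x) (x : X) : C.π x * f x ≤ C.mean f :=
  Finset.single_le_sum (f := fun x => C.π x * f x)
    (fun y _ => mul_nonneg (C.π_nonneg y) (h y)) (Finset.mem_univ x)

/-- Cauchy–Schwarz in `L²(π)`. -/
lemma mean_mul_sq_le (f g : X → ℝ) :
    C.mean (fun x => f x * g x) ^ 2 ≤ C.mean (fun x => f x ^ 2) * C.mean (fun x => g x ^ 2) := by
  have h := Finset.sum_mul_sq_le_sq_mul_sq Finset.univ
    (fun x => √(C.π x) * f x) (fun x => √(C.π x) * g x)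
  have e : ∀ x, √(C.π x) * √(C.π x) = C.π x := fun x => Real.mul_self_sqrt (C.π_nonneg x)
  have e1 : C.mean (fun x => f x * g x) = ∑ x, √(C.π x) * f x * (√(C.π x) * g x) :=
    Finset.sum_congr rfl fun x _ => by linear_combination -(f x * g x) * e x
  have e2 : ∀ q : X → ℝ, C.mean (fun x => q x ^ 2) = ∑ x, (√(C.π x) * q x) ^ 2 := fun q =>
    Finset.sum_congr rfl fun x _ => by linear_combination -(q x ^ 2) * e x
  rw [e1, e2, e2]
  exact h

lemma variance_eq (f : X → ℝ) : C.variance f = C.mean (fun x => (f x - C.mean f) ^ 2) := by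
  have h : ∀ x, (f x - C.mean f) ^ 2
      = f x ^ 2 - (2 * C.mean f) * f x + C.mean f ^ 2 := fun x => by ring
  simp only [h, mean_add, mean_sub, mean_const_mul, mean_const, variance]
  ring

lemma variance_nonneg (f : X → ℝ) : 0 ≤ C.variance f := by
  rw [variance_eq]
  exact C.mean_nonneg fun x => sq_nonneg _

lemma mean_adjoint_mulVec_mul (A : Matrix X X ℝ) (f g : X → ℝ) :
    C.mean (fun y => (C.adjoint A).mulVec f y * g y) = C.mean (fun x => f x * A.mulVec g x) := by
  simp only [mean, Matrix.mulVec, dotProduct, adjoint, Matrix.of_apply, Finset.mul_sum,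
    Finset.sum_mul]
  rw [Finset.sum_comm]
  refine Finset.sum_congr rfl fun x _ => Finset.sum_congr rfl fun y _ => ?_
  have := (C.pi_pos y).ne'
  field_simp

lemma adjoint_mul (A B : Matrix X X ℝ) : C.adjoint (A * B) = C.adjoint B * C.adjoint A := by
  ext x y
  simp only [adjoint, Matrix.of_apply, Matrix.mul_apply, Finset.mul_sum, Finset.sum_div]
  refine Finset.sum_congr rfl fun z _ => ?_
  have := (C.pi_pos z).ne'
  field_simp

/-! ### Evolution of densities -/

lemma density_zero (f : X → ℝ) : C.density f 0 = f := by
  have h : C.adjoint 1 = 1 := by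
    ext x y
    rw [adjoint, Matrix.of_apply, Matrix.one_apply, Matrix.one_apply]
    rcases eq_or_ne x y with rfl | hxy
    · simp [(C.pi_pos x).ne']
    · simp [hxy, hxy.symm]
  rw [density, P_zero, h, Matrix.one_mulVec]

lemma density_add (f : X → ℝ) (s t : ℝ) :
    C.density f (s + t) = C.density (C.density f s) t := by
  rw [density, P_add, adjoint_mul, ← Matrix.mulVec_mulVec]
  rfl

lemma density_apply (f : X → ℝ) (t : ℝ) (y : X) :
    C.density f t y = ∑ x, C.π x * C.P t x y / C.π y * f x := rfl

lemma density_dirac (x : X) (t : ℝ) (y : X) :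
    C.density (C.dirac x) t y = C.P t x y / C.π y := by
  rw [density_apply, Finset.sum_eq_single x]
  · have := (C.pi_pos x).ne'
    rw [dirac, Pi.single_eq_same]
    field_simp
  · intro z _ hz
    rw [dirac, Pi.single_eq_of_ne hz, mul_zero]
  · simp

lemma mean_density_mul (f g : X → ℝ) (t : ℝ) :
    C.mean (fun y => C.density f t y * g y) = C.mean (fun x => f x * (C.P t).mulVec g x) :=
  C.mean_adjoint_mulVec_mul _ f g

lemma mean_density (f : X → ℝ) (t : ℝ) : C.mean (C.density f t) = C.mean f := by
  have h := C.mean_density_mul f (fun _ => 1) t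
  simpa [Matrix.mulVec, dotProduct, C.P_row_sum] using h

lemma density_nonneg {f : X → ℝ} (hf : ∀ x, 0 ≤ f x) {t : ℝ} (ht : 0 ≤ t) (y : X) :
    0 ≤ C.density f t y :=
  Finset.sum_nonneg fun x _ => mul_nonneg
    (div_nonneg (mul_nonneg (C.π_nonneg x) (C.P_nonneg ht x y)) (C.π_nonneg y)) (hf x)

lemma density_pos {f : X → ℝ} (hf : ∀ x, 0 ≤ f x) (hm : C.mean f = 1) {t : ℝ} (ht : 0 < t)
    (y : X) : 0 < C.density f t y := by
  obtain ⟨x, hx⟩ : ∃ x, 0 < f x := by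
    by_contra! h
    have := C.mean_mono h
    rw [hm, mean_const] at this
    linarith
  have h1 : ∀ z, 0 < C.π z * C.P t z y / C.π y := fun z =>
    div_pos (mul_pos (C.pi_pos z) (C.P_pos ht z y)) (C.pi_pos y)
  exact Finset.sum_pos' (fun z _ => mul_nonneg (h1 z).le (hf z))
    ⟨x, Finset.mem_univ x, mul_pos (h1 x) hx⟩

lemma density_sub (f g : X → ℝ) (t : ℝ) (y : X) :
    C.density (fun x => f x - g x) t y = C.density f t y - C.density g t y := by
  simp only [density_apply, mul_sub, Finset.sum_sub_distrib]

lemma density_add_fun (f g : X → ℝ) (t : ℝ) (y : X) :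
    C.density (fun x => f x + g x) t y = C.density f t y + C.density g t y := by
  simp only [density_apply, mul_add, Finset.sum_add_distrib]

lemma density_const (c : ℝ) (t : ℝ) (y : X) : C.density (fun _ => c) t y = c := by
  rw [density_apply, ← Finset.sum_mul, ← Finset.sum_div, C.pi_P, div_self (C.pi_pos y).ne',
    one_mul]

lemma hasDerivAt_density (f : X → ℝ) (t : ℝ) (y : X) :
    HasDerivAt (fun s => C.density f s y) ((C.adjoint C.L).mulVec (C.density f t) y) t := by
  have h := HasDerivAt.fun_sum (u := Finset.univ) fun x _ =>
    (((C.hasDerivAt_P x y t).const_mul (C.π x)).div_const (C.π y)).mul_const (f x)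
  refine h.congr_deriv ?_
  rw [density, Matrix.mulVec_mulVec, ← adjoint_mul]
  rfl

lemma continuous_density (f : X → ℝ) (y : X) : Continuous fun s => C.density f s y :=
  continuous_iff_continuousAt.2 fun t => (C.hasDerivAt_density f t y).continuousAt

lemma continuous_mean {q : ℝ → X → ℝ} (hq : ∀ y, Continuous fun s => q s y) :
    Continuous fun s => C.mean (q s) :=
  continuous_finsetSum _ fun y _ => continuous_const.mul (hq y)

lemma hasDerivAt_mean {q : ℝ → X → ℝ} {q' : X → ℝ} {t : ℝ}
    (hq : ∀ y, HasDerivAt (fun s => q s y) (q' y) t) :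
    HasDerivAt (fun s => C.mean (q s)) (C.mean q') t :=
  HasDerivAt.fun_sum (u := Finset.univ) fun y _ => (hq y).const_mul (C.π y)

lemma continuous_tv (f : X → ℝ) : Continuous fun s => C.tv (C.density f s) :=
  continuous_const.mul
    (C.continuous_mean fun y => ((C.continuous_density f y).sub continuous_const).abs)

lemma continuous_ent (f : X → ℝ) : Continuous fun s => C.ent (C.density f s) := by
  have h : (fun s => C.ent (C.density f s)) = fun s =>
      C.mean (fun x => C.density f s x * Real.log (C.density f s x))
        - C.mean f * Real.log (C.mean f) := by
    ext s; rw [ent, mean_density]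
  rw [h]
  exact (C.continuous_mean fun y =>
    Real.continuous_mul_log.comp (C.continuous_density f y)).sub continuous_const

lemma mean_abs_density_le (f : X → ℝ) {t : ℝ} (ht : 0 ≤ t) :
    C.mean (fun y => |C.density f t y|) ≤ C.mean (fun x => |f x|) := by
  rw [← C.mean_density (fun x => |f x|) t]
  refine C.mean_mono fun y => ?_
  refine (Finset.abs_sum_le_sum_abs _ _).trans (le_of_eq ?_)
  refine Finset.sum_congr rfl fun x _ => ?_
  show |C.π x * C.P t x y / C.π y * f x| = C.π x * C.P t x y / C.π y * |f x|
  rw [abs_mul, abs_of_nonneg (div_nonneg (mul_nonneg (C.π_nonneg x) (C.P_nonneg ht x y))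
    (C.π_nonneg y))]

lemma tv_nonneg (f : X → ℝ) : 0 ≤ C.tv f :=
  mul_nonneg (by norm_num) (C.mean_nonneg fun _ => abs_nonneg _)

lemma tv_density_le (f : X → ℝ) {t : ℝ} (ht : 0 ≤ t) : C.tv (C.density f t) ≤ C.tv f := by
  have h := C.mean_abs_density_le (fun x => f x - 1) ht
  simp only [density_sub, density_const] at h
  exact mul_le_mul_of_nonneg_left h (by norm_num)

lemma tv_density_antitone (f : X → ℝ) {s t : ℝ} (hst : s ≤ t) :
    C.tv (C.density f t) ≤ C.tv (C.density f s) := by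
  have h := C.tv_density_le (C.density f s) (sub_nonneg.2 hst)
  rwa [← density_add, add_sub_cancel] at h

/-! ### Variance and entropy along the semigroup -/

lemma dirichletForm_eq (f g : X → ℝ) :
    C.dirichletForm f g = ∑ x, ∑ y, C.π x * C.T x y * (f x * (g x - g y)) := by
  simp only [dirichletForm, mean, L_mulVec, ← Finset.sum_neg_distrib, Finset.mul_sum]
  exact Finset.sum_congr rfl fun x _ => Finset.sum_congr rfl fun y _ => by ring

lemma sum_pi_T_left (h : X → ℝ) : ∑ x, ∑ y, C.π x * C.T x y * h x = C.mean h := by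
  simp only [← Finset.sum_mul, ← Finset.mul_sum, C.T_row_sum, mul_one, mean]

lemma sum_pi_T_right (h : X → ℝ) : ∑ x, ∑ y, C.π x * C.T x y * h y = C.mean h := by
  rw [Finset.sum_comm]
  simp only [← Finset.sum_mul, C.stationary, mean]

/-- By stationarity, the increments of an arbitrary function `h` may be added to the integrand of
the Dirichlet form. With `h = f` and `g = log f`, every term becomes non-negative. -/
lemma dirichletForm_eq_add_sub (f g h : X → ℝ) :
    C.dirichletForm f g
      = ∑ x, ∑ y, C.π x * C.T x y * (f x * (g x - g y) + h y - h x) := by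
  simp only [mul_add, mul_sub (C.π _ * C.T _ _), Finset.sum_add_distrib, Finset.sum_sub_distrib]
  rw [C.dirichletForm_eq, C.sum_pi_T_left h, C.sum_pi_T_right h, add_sub_cancel_right]

/-- The Dirichlet form only sees the symmetric part of the generator on the diagonal. -/
lemma dirichletForm_self_eq (f : X → ℝ) :
    C.dirichletForm f f = (1 / 2) * ∑ x, ∑ y, C.π x * C.T x y * (f x - f y) ^ 2 := by
  have h : ∀ x y, C.π x * C.T x y * (f x - f y) ^ 2
      = 2 * (C.π x * C.T x y * (f x * (f x - f y)))
        + (C.π x * C.T x y * f y ^ 2 - C.π x * C.T x y * f x ^ 2) := fun x y => by ring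
  simp only [h, Finset.sum_add_distrib, Finset.sum_sub_distrib]
  rw [C.dirichletForm_eq, C.sum_pi_T_right (fun x => f x ^ 2), C.sum_pi_T_left (fun x => f x ^ 2),
    sub_self, add_zero]
  simp only [Finset.mul_sum]
  exact Finset.sum_congr rfl fun x _ => Finset.sum_congr rfl fun y _ => by ring

lemma dirichletForm_self_nonneg (f : X → ℝ) : 0 ≤ C.dirichletForm f f := by
  rw [dirichletForm_self_eq]
  exact mul_nonneg (by norm_num) (Finset.sum_nonneg fun x _ => Finset.sum_nonneg fun y _ =>
    mul_nonneg (mul_nonneg (C.π_nonneg x) (C.T_nonneg x y)) (sq_nonneg _))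

/-- A Poincaré inequality makes the variance of densities decay exponentially. Reversibility plays
no role, as a generator and its adjoint have the same Dirichlet form on the diagonal. -/
lemma variance_density_le {γ : ℝ} (hγ : ∀ f : X → ℝ, γ * C.variance f ≤ C.dirichletForm f f)
    (f : X → ℝ) {t : ℝ} (ht : 0 ≤ t) :
    C.variance (C.density f t) ≤ Real.exp (-2 * γ * t) * C.variance f := by
  have hd : ∀ s, HasDerivAt (fun s => Real.exp (2 * γ * s) * C.variance (C.density f s))
      (Real.exp (2 * γ * s) * (2 * (γ * C.variance (C.density f s)
        - C.dirichletForm (C.density f s) (C.density f s)))) s := by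
    intro s
    have h1 : HasDerivAt (fun s => C.variance (C.density f s))
        (-2 * C.dirichletForm (C.density f s) (C.density f s)) s := by
      have h2 := (C.hasDerivAt_mean fun y => (C.hasDerivAt_density f s y).pow 2).sub_const
        (C.mean f ^ 2)
      have h3 : (fun s => C.variance (C.density f s))
          = fun s => C.mean (fun y => C.density f s y ^ 2) - C.mean f ^ 2 := by
        ext r; rw [variance, mean_density]
      rw [h3]
      refine h2.congr_deriv ?_
      have h4 := C.mean_adjoint_mulVec_mul C.L (C.density f s) (C.density f s)
      have h5 : C.dirichletForm (C.density f s) (C.density f s)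
          = -C.mean (fun x => C.density f s x * C.L.mulVec (C.density f s) x) := by
        simp only [dirichletForm, mean, mul_neg, Finset.sum_neg_distrib]
      rw [h5, ← h4, neg_mul_neg, ← mean_const_mul]
      congr 1
      ext y
      push_cast
      ring
    have h2 : HasDerivAt (fun s => Real.exp (2 * γ * s)) (Real.exp (2 * γ * s) * (2 * γ)) s := by
      simpa using ((hasDerivAt_id s).const_mul (2 * γ)).exp
    refine (h2.mul h1).congr_deriv ?_
    ring
  have hanti : Antitone (fun s => Real.exp (2 * γ * s) * C.variance (C.density f s)) :=
    antitone_of_deriv_nonpos (fun s => (hd s).differentiableAt) fun s => by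
      rw [(hd s).deriv]
      refine mul_nonpos_of_nonneg_of_nonpos (Real.exp_nonneg _) ?_
      have := hγ (C.density f s)
      linarith
  have h := hanti ht
  simp only [mul_zero, Real.exp_zero, one_mul, density_zero] at h
  rw [show -2 * γ * t = -(2 * γ * t) by ring, Real.exp_neg, inv_mul_eq_div,
    le_div_iff₀ (Real.exp_pos _), mul_comm]
  exact h

/-- De Bruijn's identity: entropy is dissipated at the rate given by the Dirichlet form. -/
lemma hasDerivAt_ent {f : X → ℝ} (hf : ∀ x, 0 ≤ f x) (hm : C.mean f = 1) {t : ℝ} (ht : 0 < t) :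
    HasDerivAt (fun s => C.ent (C.density f s))
      (-C.dirichletForm (C.density f t) (fun x => Real.log (C.density f t x))) t := by
  have h1 : (fun s => C.ent (C.density f s)) = fun s =>
      C.mean (fun x => C.density f s x * Real.log (C.density f s x)) := by
    ext s; rw [ent, mean_density, hm, Real.log_one, mul_zero, sub_zero]
  have hpos := C.density_pos hf hm ht
  rw [h1]
  have h2 : ∀ y, HasDerivAt (fun s => C.density f s y * Real.log (C.density f s y))
      ((C.adjoint C.L).mulVec (C.density f t) y * (Real.log (C.density f t y) + 1)) t := by
    intro y
    have h3 := (C.hasDerivAt_density f t y).mul ((C.hasDerivAt_density f t y).log (hpos y).ne')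
    refine h3.congr_deriv ?_
    have := (hpos y).ne'
    field_simp
  refine (C.hasDerivAt_mean h2).congr_deriv ?_
  rw [C.mean_adjoint_mulVec_mul C.L (C.density f t)
    (fun y => Real.log (C.density f t y) + 1)]
  simp only [dirichletForm, mean, mul_neg, Finset.sum_neg_distrib, neg_neg, L_mulVec]
  exact Finset.sum_congr rfl fun x _ => by simp only [add_sub_add_right_eq_sub]

/-! ### Comparison of entropy with total variation and with the variance -/

lemma sq_sqrt_sub_one_le {u : ℝ} (hu : 0 ≤ u) : (√u - 1) ^ 2 ≤ u * Real.log u - u + 1 := by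
  rcases hu.eq_or_lt with rfl | hu
  · simp
  · have hs : 0 < √u := Real.sqrt_pos.2 hu
    have h1 : √u ^ 2 = u := Real.sq_sqrt hu.le
    have h2 := Real.one_sub_inv_le_log_of_pos hs
    have h3 : Real.log u = 2 * Real.log √u := by
      rw [Real.log_sqrt hu.le]; ring
    have h4 : √u ^ 2 * (1 - (√u)⁻¹) = √u ^ 2 - √u := by
      field_simp
    have h5 := mul_le_mul_of_nonneg_left h2 (sq_nonneg √u)
    have h6 : (√u - 1) ^ 2 = u - 2 * √u + 1 := by
      rw [sub_sq, h1]; ring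
    rw [h4, h1] at h5
    rw [h3, h6]
    linarith

/-- A weak form of Pinsker's inequality, obtained through the Hellinger distance. -/
lemma tv_sq_le_ent {f : X → ℝ} (hf : ∀ x, 0 ≤ f x) (hm : C.mean f = 1) :
    C.tv f ^ 2 ≤ C.ent f := by
  have h1 : C.mean (fun x => (√(f x) - 1) ^ 2) ≤ C.ent f := by
    refine (C.mean_mono fun x => sq_sqrt_sub_one_le (hf x)).trans (le_of_eq ?_)
    rw [mean_add, mean_sub, mean_const, ent, hm, Real.log_one]
    ring
  have h2 : C.mean (fun x => (√(f x) + 1) ^ 2) ≤ 4 := by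
    have h3 : ∀ x, (√(f x) + 1) ^ 2 ≤ 2 * f x + 2 := fun x => by
      nlinarith [Real.sq_sqrt (hf x), sq_nonneg (√(f x) - 1)]
    refine (C.mean_mono h3).trans (le_of_eq ?_)
    rw [mean_add, mean_const_mul, mean_const, hm]
    norm_num
  have h4 : ∀ x, |f x - 1| = |√(f x) - 1| * (√(f x) + 1) := fun x => by
    rw [← abs_of_nonneg (by positivity : 0 ≤ √(f x) + 1), ← abs_mul]
    congr 1
    linarith [Real.sq_sqrt (hf x), sq (√(f x))]
  have h5 := C.mean_mul_sq_le (fun x => |√(f x) - 1|) (fun x => √(f x) + 1)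
  simp only [sq_abs, ← h4] at h5
  have h6 : 0 ≤ C.mean (fun x => (√(f x) - 1) ^ 2) := C.mean_nonneg fun x => sq_nonneg _
  rw [tv]
  nlinarith

lemma mean_sq_sub (f : X → ℝ) (a : ℝ) :
    C.mean (fun x => (f x - a) ^ 2) = C.variance f + (C.mean f - a) ^ 2 := by
  have h : ∀ x, (f x - a) ^ 2 = f x ^ 2 - (2 * a) * f x + a ^ 2 := fun x => by ring
  simp only [h, mean_add, mean_sub, mean_const_mul, mean_const, variance]
  ring

lemma variance_le_mean_sq_sub (f : X → ℝ) (a : ℝ) :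
    C.variance f ≤ C.mean (fun x => (f x - a) ^ 2) := by
  rw [mean_sq_sub]
  linarith [sq_nonneg (C.mean f - a)]

lemma mean_pos {f : X → ℝ} (hf : ∀ x, 0 < f x) : 0 < C.mean f := by
  have := C.nonempty
  exact Finset.sum_pos (fun x _ => mul_pos (C.pi_pos x) (hf x)) Finset.univ_nonempty

lemma mean_mul_ent_le_variance {f : X → ℝ} (hf : ∀ x, 0 < f x) :
    C.mean f * C.ent f ≤ C.variance f := by
  have hm := C.mean_pos hf
  set m := C.mean f with hmdef
  have h1 : ∀ x, m * (f x * Real.log (f x)) ≤ f x ^ 2 - m * f x + (m * Real.log m) * f x := by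
    intro x
    have h2 := Real.log_le_sub_one_of_pos (div_pos (hf x) hm)
    rw [Real.log_div (hf x).ne' hm.ne'] at h2
    have h3 := mul_le_mul_of_nonneg_left h2 (mul_pos hm (hf x)).le
    have h4 : m * f x * (f x / m - 1) = f x ^ 2 - m * f x := by field_simp
    linarith
  have h5 := C.mean_mono h1
  simp only [mean_add, mean_sub, mean_const_mul, ← hmdef] at h5
  rw [ent, variance, ← hmdef]
  linarith

/-! ### Positivity of the Poincaré and modified log-Sobolev constants -/

lemma pow_succ_pos_iff (k : ℕ) (x y : X) :
    0 < (C.T ^ (k + 1)) x y ↔ ∃ z, 0 < (C.T ^ k) x z ∧ 0 < C.T z y := by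
  rw [pow_succ, Matrix.mul_apply]
  constructor
  · intro h
    obtain ⟨z, _, hz⟩ := Finset.exists_lt_of_sum_lt
      (s := Finset.univ) (f := fun _ : X => (0 : ℝ)) (by simpa using h)
    exact ⟨z, (pos_and_pos_or_neg_and_neg_of_mul_pos hz).elim id fun h =>
      absurd h.1 (not_lt.2 (C.pow_nonneg k x z))⟩
  · rintro ⟨z, h1, h2⟩
    exact Finset.sum_pos' (fun w _ => mul_nonneg (C.pow_nonneg k x w) (C.T_nonneg w y))
      ⟨z, Finset.mem_univ z, mul_pos h1 h2⟩

lemma sq_sub_le_dirichletForm_of_edge (f : X → ℝ) (x y : X) :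
    C.π x * C.T x y / 2 * (f x - f y) ^ 2 ≤ C.dirichletForm f f := by
  have h0 : ∀ x y, 0 ≤ C.π x * C.T x y * (f x - f y) ^ 2 := fun x y =>
    mul_nonneg (mul_nonneg (C.π_nonneg x) (C.T_nonneg x y)) (sq_nonneg _)
  have h1 : C.π x * C.T x y * (f x - f y) ^ 2 ≤ ∑ y, C.π x * C.T x y * (f x - f y) ^ 2 :=
    Finset.single_le_sum (f := fun y => C.π x * C.T x y * (f x - f y) ^ 2)
      (fun y _ => h0 x y) (Finset.mem_univ y)
  have h2 : ∑ y, C.π x * C.T x y * (f x - f y) ^ 2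
      ≤ ∑ x, ∑ y, C.π x * C.T x y * (f x - f y) ^ 2 :=
    Finset.single_le_sum (f := fun x => ∑ y, C.π x * C.T x y * (f x - f y) ^ 2)
      (fun x _ => Finset.sum_nonneg fun y _ => h0 x y) (Finset.mem_univ x)
  rw [dirichletForm_self_eq]
  linarith

/-- Increments along a path are controlled by the Dirichlet form, by irreducibility. -/
lemma exists_sq_sub_le_dirichletForm :
    ∃ c : ℝ, 0 < c ∧ ∀ (f : X → ℝ) (x y : X), c * (f x - f y) ^ 2 ≤ C.dirichletForm f f := by
  have key : ∀ (k : ℕ) (x y : X), 0 < (C.T ^ k) x y →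
      ∃ c : ℝ, 0 < c ∧ ∀ f : X → ℝ, c * (f x - f y) ^ 2 ≤ C.dirichletForm f f := by
    intro k
    induction k with
    | zero =>
      intro x y h
      have hxy : x = y := by
        by_contra hne
        simp [Matrix.one_apply_ne hne] at h
      refine ⟨1, one_pos, fun f => ?_⟩
      rw [hxy]
      simpa using C.dirichletForm_self_nonneg f
    | succ k ih =>
      intro x y h
      obtain ⟨z, h1, h2⟩ := (C.pow_succ_pos_iff k x y).1 h
      obtain ⟨c, hc, hf⟩ := ih x z h1
      set e := C.π z * C.T z y / 2 with he
      have he0 : 0 < e := half_pos (mul_pos (C.pi_pos z) h2)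
      refine ⟨min c e / 4, by positivity, fun f => ?_⟩
      have h3 := hf f
      have h4 := C.sq_sub_le_dirichletForm_of_edge f z y
      rw [← he] at h4
      have h5 : min c e * (f x - f z) ^ 2 ≤ c * (f x - f z) ^ 2 :=
        mul_le_mul_of_nonneg_right (min_le_left _ _) (sq_nonneg _)
      have h6 : min c e * (f z - f y) ^ 2 ≤ e * (f z - f y) ^ 2 :=
        mul_le_mul_of_nonneg_right (min_le_right _ _) (sq_nonneg _)
      have h7 : (f x - f y) ^ 2 ≤ 2 * (f x - f z) ^ 2 + 2 * (f z - f y) ^ 2 := by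
        nlinarith [sq_nonneg ((f x - f z) - (f z - f y))]
      have h8 := mul_le_mul_of_nonneg_left h7 (lt_min hc he0).le
      linarith
  have key2 : ∀ p : X × X,
      ∃ c : ℝ, 0 < c ∧ ∀ f : X → ℝ, c * (f p.1 - f p.2) ^ 2 ≤ C.dirichletForm f f := fun p =>
    let ⟨k, hk⟩ := C.irreducible p.1 p.2
    key k p.1 p.2 hk
  choose c hc hf using key2
  have := C.nonempty
  obtain ⟨p, hp⟩ := Finite.exists_min c
  exact ⟨c p, hc p, fun f x y => (mul_le_mul_of_nonneg_right (hp (x, y)) (sq_nonneg _)).trans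
    (hf (x, y) f)⟩

lemma two_mul_dirichletForm_sqrt_le {f : X → ℝ} (hf : ∀ x, 0 < f x) :
    2 * C.dirichletForm (fun x => √(f x)) (fun x => √(f x))
      ≤ C.dirichletForm f (fun x => Real.log (f x)) := by
  rw [C.dirichletForm_eq_add_sub f _ f, dirichletForm_self_eq, ← mul_assoc, mul_one_div_cancel two_ne_zero, one_mul]
  refine Finset.sum_le_sum fun x _ => Finset.sum_le_sum fun y _ =>
    mul_le_mul_of_nonneg_left ?_ (mul_nonneg (C.π_nonneg x) (C.T_nonneg x y))
  have hx : 0 < √(f x) := Real.sqrt_pos.2 (hf x)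
  have hy : 0 < √(f y) := Real.sqrt_pos.2 (hf y)
  have ex := Real.sq_sqrt (hf x).le
  have ey := Real.sq_sqrt (hf y).le
  have h1 := Real.one_sub_inv_le_log_of_pos (div_pos hx hy)
  rw [Real.log_div hx.ne' hy.ne', inv_div, Real.log_sqrt (hf x).le, Real.log_sqrt (hf y).le] at h1
  have h2 := mul_le_mul_of_nonneg_left h1 (sq_nonneg √(f x))
  have h3 : √(f x) ^ 2 * (1 - √(f y) / √(f x)) = √(f x) ^ 2 - √(f x) * √(f y) := by
    field_simp
  rw [h3, ex] at h2
  nlinarith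

lemma exists_pi_lower_bound : ∃ p : ℝ, 0 < p ∧ ∀ x, p ≤ C.π x := by
  have := C.nonempty
  obtain ⟨z, hz⟩ := Finite.exists_min C.π
  exact ⟨C.π z, C.pi_pos z, hz⟩

lemma exists_pos_poincare :
    ∃ γ : ℝ, 0 < γ ∧ ∀ f : X → ℝ, γ * C.variance f ≤ C.dirichletForm f f := by
  obtain ⟨c, hc, h⟩ := C.exists_sq_sub_le_dirichletForm
  obtain ⟨z⟩ := C.nonempty
  refine ⟨c, hc, fun f => (mul_le_mul_of_nonneg_left
    (C.variance_le_mean_sq_sub f (f z)) hc.le).trans ?_⟩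
  rw [← mean_const_mul, ← C.mean_const (C.dirichletForm f f)]
  exact C.mean_mono fun x => h f x z

lemma exists_pos_mls : ∃ α : ℝ, 0 < α ∧ ∀ f : X → ℝ, (∀ x, 0 < f x) →
    α * C.ent f ≤ C.dirichletForm f (fun x => Real.log (f x)) := by
  obtain ⟨c, hc, h⟩ := C.exists_sq_sub_le_dirichletForm
  obtain ⟨p, hp, hpi⟩ := C.exists_pi_lower_bound
  obtain ⟨z⟩ := C.nonempty
  refine ⟨p * c / 2, by positivity, fun f hf => ?_⟩
  set g : X → ℝ := fun x => √(f x) with hg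
  have hm := C.mean_pos hf
  have hb : ∀ x, p * f x ≤ C.mean f := fun x =>
    (mul_le_mul_of_nonneg_right (hpi x) (hf x).le).trans
      (C.pi_mul_le_mean (fun x => (hf x).le) x)
  have h1 : ∀ x, p * c * (f x - f z) ^ 2 ≤ 4 * C.mean f * C.dirichletForm g g := by
    intro x
    have ex : g x ^ 2 = f x := Real.sq_sqrt (hf x).le
    have ez : g z ^ 2 = f z := Real.sq_sqrt (hf z).le
    have e1 : (f x - f z) ^ 2 = (g x - g z) ^ 2 * (g x + g z) ^ 2 := by
      rw [← ex, ← ez]; ring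
    have e2 : p * (g x + g z) ^ 2 ≤ 4 * C.mean f := by
      have : (g x + g z) ^ 2 ≤ 2 * f x + 2 * f z := by
        rw [← ex, ← ez]; nlinarith [sq_nonneg (g x - g z)]
      nlinarith [hb x, hb z]
    calc p * c * (f x - f z) ^ 2
        = (p * (g x + g z) ^ 2) * (c * (g x - g z) ^ 2) := by rw [e1]; ring
      _ ≤ (4 * C.mean f) * C.dirichletForm g g := by
        gcongr
        exact h g x z
  have h2 : p * c * C.variance f ≤ 4 * C.mean f * C.dirichletForm g g := by
    refine (mul_le_mul_of_nonneg_left (C.variance_le_mean_sq_sub f (f z)) (by positivity)).trans ?_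
    rw [← mean_const_mul, ← C.mean_const (4 * C.mean f * C.dirichletForm g g)]
    exact C.mean_mono h1
  have h3 := mul_le_mul_of_nonneg_left (C.mean_mul_ent_le_variance hf) (mul_pos hp hc).le
  have h4 : C.mean f * (p * c / 2 * C.ent f) ≤ C.mean f * (2 * C.dirichletForm g g) := by
    linarith
  exact (le_of_mul_le_mul_left h4 hm).trans (C.two_mul_dirichletForm_sqrt_le hf)

lemma pi_lt_one [Nontrivial X] (x : X) : C.π x < 1 := by
  obtain ⟨y, hy⟩ := exists_ne x
  rw [← C.π_sum]
  exact Finset.single_lt_sum hy (Finset.mem_univ x) (Finset.mem_univ y) (C.pi_pos y)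
    fun z _ _ => C.π_nonneg z

lemma mean_single (x : X) (a : ℝ) : C.mean (Pi.single x a) = C.π x * a := by
  rw [mean, Finset.sum_eq_single x]
  · rw [Pi.single_eq_same]
  · intro y _ hy
    rw [Pi.single_eq_of_ne hy, mul_zero]
  · simp

lemma bddAbove_poincare [Nontrivial X] :
    BddAbove {γ : ℝ | 0 ≤ γ ∧ ∀ f : X → ℝ, γ * C.variance f ≤ C.dirichletForm f f} := by
  obtain ⟨x⟩ := C.nonempty
  set f : X → ℝ := Pi.single x 1 with hf
  have hv : 0 < C.variance f := by
    have h1 : (fun y => f y ^ 2) = Pi.single x 1 := by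
      ext y
      rcases eq_or_ne y x with rfl | h
      · simp [hf]
      · simp [hf, Pi.single_eq_of_ne h]
    rw [variance, h1, hf, mean_single, mul_one]
    nlinarith [C.pi_pos x, C.pi_lt_one x]
  exact ⟨C.dirichletForm f f / C.variance f, fun γ hγ => (le_div_iff₀ hv).2 (hγ.2 f)⟩

lemma bddAbove_mls [Nontrivial X] :
    BddAbove {α : ℝ | 0 ≤ α ∧ ∀ f : X → ℝ, (∀ x, 0 < f x) →
      α * C.ent f ≤ C.dirichletForm f (fun x => Real.log (f x))} := by
  obtain ⟨x⟩ := C.nonempty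
  have hx := C.pi_lt_one x
  set f : X → ℝ := fun y => (1 - C.π x / 2) + (Pi.single x (1 / 2) : X → ℝ) y with hf
  have hs : (0 : X → ℝ) ≤ Pi.single x (1 / 2) := Pi.single_nonneg.2 (by norm_num)
  have hpos : ∀ y, 0 < f y := fun y => by
    have := hs y
    simp only [Pi.zero_apply] at this
    simp only [hf]
    linarith
  have hm : C.mean f = 1 := by
    rw [hf, mean_add, mean_const, mean_single]
    ring
  have htv : 0 < C.tv f := by
    have h1 := C.pi_mul_le_mean (f := fun y => |f y - 1|) (fun y => abs_nonneg _) x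
    have h2 : 0 < |f x - 1| := by
      rw [abs_pos]
      simp only [hf, Pi.single_eq_same]
      linarith
    have h3 := mul_pos (C.pi_pos x) h2
    rw [tv]
    linarith
  have he : 0 < C.ent f := (by positivity : 0 < C.tv f ^ 2).trans_le
    (C.tv_sq_le_ent (fun y => (hpos y).le) hm)
  exact ⟨C.dirichletForm f (fun x => Real.log (f x)) / C.ent f,
    fun α hα => (le_div_iff₀ he).2 (hα.2 f hpos)⟩

lemma poincareConst_pos [Nontrivial X] : 0 < C.poincareConst := by
  obtain ⟨γ, hγ, h⟩ := C.exists_pos_poincare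
  exact hγ.trans_le (le_csSup C.bddAbove_poincare ⟨hγ.le, h⟩)

lemma poincare (f : X → ℝ) : C.poincareConst * C.variance f ≤ C.dirichletForm f f := by
  obtain ⟨γ, hγ, h⟩ := C.exists_pos_poincare
  rcases (C.variance_nonneg f).eq_or_lt with hv | hv
  · rw [← hv, mul_zero]
    exact C.dirichletForm_self_nonneg f
  · rw [← le_div_iff₀ hv]
    exact csSup_le ⟨γ, hγ.le, h⟩ fun δ hδ => (le_div_iff₀ hv).2 (hδ.2 f)

lemma mlsConst_pos [Nontrivial X] : 0 < C.mlsConst := by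
  obtain ⟨α, hα, h⟩ := C.exists_pos_mls
  exact hα.trans_le (le_csSup C.bddAbove_mls ⟨hα.le, h⟩)

lemma mls {f : X → ℝ} (hf : ∀ x, 0 < f x) :
    C.mlsConst * C.ent f ≤ C.dirichletForm f (fun x => Real.log (f x)) := by
  obtain ⟨α, hα, h⟩ := C.exists_pos_mls
  rcases le_or_gt (C.ent f) 0 with hv | hv
  · have h1 : 0 ≤ C.mlsConst := Real.sSup_nonneg fun δ hδ => hδ.1
    have h2 := C.two_mul_dirichletForm_sqrt_le hf
    have h3 := C.dirichletForm_self_nonneg (fun x => √(f x))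
    have h4 := mul_nonpos_of_nonneg_of_nonpos h1 hv
    linarith
  · rw [← le_div_iff₀ hv]
    exact csSup_le ⟨α, hα.le, h⟩ fun δ hδ => (le_div_iff₀ hv).2 (hδ.2 f hf)

/-! ### Sparsity and the hop-count distance -/

lemma one_div_le_sparsity {x y : X} (h : 0 < C.T x y) : 1 / C.T x y ≤ C.sparsity :=
  le_ciSup (f := fun p : {p : X × X // 0 < C.T p.1 p.2} => 1 / C.T p.1.1 p.1.2)
    (Set.finite_range _).bddAbove ⟨(x, y), h⟩

lemma one_le_sparsity_mul {x y : X} (h : 0 < C.T x y) : 1 ≤ C.sparsity * C.T x y :=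
  (div_le_iff₀ h).1 (C.one_div_le_sparsity h)

lemma sparsity_nonneg : 0 ≤ C.sparsity :=
  Real.iSup_nonneg fun p => (one_div_pos.2 p.2).le

lemma one_le_sparsity_pow_mul {k : ℕ} {x y : X} (h : 0 < (C.T ^ k) x y) :
    1 ≤ C.sparsity ^ k * (C.T ^ k) x y := by
  induction k generalizing y with
  | zero =>
    rcases eq_or_ne x y with rfl | hxy
    · simp
    · simp [Matrix.one_apply_ne hxy] at h
  | succ k ih =>
    obtain ⟨z, h1, h2⟩ := (C.pow_succ_pos_iff k x y).1 h
    have h3 : (C.T ^ k) x z * C.T z y ≤ (C.T ^ (k + 1)) x y := by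
      rw [pow_succ, Matrix.mul_apply]
      exact Finset.single_le_sum (f := fun z => (C.T ^ k) x z * C.T z y)
        (fun w _ => mul_nonneg (C.pow_nonneg k x w) (C.T_nonneg w y)) (Finset.mem_univ z)
    have h4 := ih h1
    have h5 := C.one_le_sparsity_mul h2
    calc (1 : ℝ) ≤ (C.sparsity ^ k * (C.T ^ k) x z) * (C.sparsity * C.T z y) := by
          nlinarith
      _ = C.sparsity ^ (k + 1) * ((C.T ^ k) x z * C.T z y) := by ring
      _ ≤ _ := mul_le_mul_of_nonneg_left h3 (_root_.pow_nonneg C.sparsity_nonneg _)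

lemma pow_hopDist_pos (x y : X) : 0 < (C.T ^ C.hopDist x y) x y :=
  Nat.sInf_mem (s := {k : ℕ | 0 < (C.T ^ k) x y}) (C.irreducible x y)

lemma hopDist_le_of_pos {k : ℕ} {x y : X} (h : 0 < (C.T ^ k) x y) : C.hopDist x y ≤ k :=
  Nat.sInf_le h

lemma hopDist_self (x : X) : C.hopDist x x = 0 :=
  Nat.le_zero.1 (C.hopDist_le_of_pos (by simp))

lemma hopDist_le_diam (x y : X) : C.hopDist x y ≤ C.diam :=
  Finset.le_sup (f := fun p : X × X => C.hopDist p.1 p.2) (Finset.mem_univ (x, y))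

lemma exists_hopDist_eq_diam : ∃ x y, C.hopDist x y = C.diam := by
  have := C.nonempty
  obtain ⟨p, _, hp⟩ := Finset.exists_mem_eq_sup (Finset.univ : Finset (X × X))
    Finset.univ_nonempty fun p => C.hopDist p.1 p.2
  exact ⟨p.1, p.2, hp.symm⟩

lemma hopDist_le_succ {x y z : X} (h : 0 < C.T y z) : C.hopDist x z ≤ C.hopDist x y + 1 :=
  C.hopDist_le_of_pos ((C.pow_succ_pos_iff _ x z).2 ⟨y, C.pow_hopDist_pos x y, h⟩)

lemma nontrivial_of_two_le_sparsity (h : 2 ≤ C.sparsity) : Nontrivial X := by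
  by_contra hX
  rw [not_nontrivial_iff_subsingleton] at hX
  obtain ⟨x⟩ := C.nonempty
  have h1 : ∀ y z, C.T y z = 1 := fun y z => by
    rw [← C.T_row_sum y, Fintype.sum_subsingleton _ z]
  have : Nonempty {p : X × X // 0 < C.T p.1 p.2} := ⟨⟨(x, x), by simp [h1]⟩⟩
  have h2 : C.sparsity ≤ 1 := ciSup_le fun p => by simp [h1]
  linarith

lemma one_le_diam [Nontrivial X] : 1 ≤ C.diam := by
  obtain ⟨x, y, hxy⟩ := exists_pair_ne X
  refine le_trans ?_ (C.hopDist_le_diam x y)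
  rw [Nat.one_le_iff_ne_zero]
  intro h
  have := C.pow_hopDist_pos x y
  rw [h, pow_zero, Matrix.one_apply_ne hxy] at this
  exact lt_irrefl _ this

/-- A lower bound on the heat kernel, from a shortest path. -/
lemma exp_mul_pow_div_factorial_le (t : ℝ) (ht : 0 ≤ t) (hd : 0 < C.sparsity) (x y : X) :
    Real.exp (-t) * (t ^ C.hopDist x y / (C.hopDist x y).factorial / C.sparsity ^ C.hopDist x y)
      ≤ C.P t x y := by
  refine le_trans ?_ (C.le_P ht (C.hopDist x y) x y)
  refine mul_le_mul_of_nonneg_left ?_ (Real.exp_nonneg _)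
  rw [div_eq_mul_inv _ (C.sparsity ^ _)]
  refine mul_le_mul_of_nonneg_left ?_ (by positivity)
  rw [inv_le_iff_one_le_mul₀ (by positivity), mul_comm]
  exact C.one_le_sparsity_pow_mul (C.pow_hopDist_pos x y)

/-! ### Regularity of the heat kernel along edges -/

/-- Along an edge `x → y`, one more jump leads from `x` to `y`. Conditionally on being at `x` at
time `t`, the number of jumps is therefore what controls the ratio of the two heat kernels; a
Chernoff bound with parameter `e u d` shows that it is at most `4 u d t` with conditional
probability at least one half. -/
lemma P_le_mul_P_of_edge [Nontrivial X] (hd : 2 ≤ C.sparsity) {t : ℝ} (ht : 0 < t) (o : X)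
    {x y : X} (hxy : 0 < C.T x y) :
    C.P t o x ≤ 8 * C.sparsity ^ 2 * max 1 (C.diam / t) * C.P t o y := by
  set d := C.sparsity with hddef
  set u : ℝ := max 1 (C.diam / t) with hu
  have hd0 : 0 < d := by linarith
  have hu1 : 1 ≤ u := le_max_left _ _
  have hu0 : 0 < u := by linarith
  have hut : (C.diam : ℝ) ≤ u * t := (div_le_iff₀ ht).1 (le_max_right _ _)
  have hD : (1 : ℝ) ≤ C.diam := by exact_mod_cast C.one_le_diam
  obtain ⟨θ, hθ⟩ : ∃ θ, θ = Real.exp 1 * (u * d) := ⟨_, rfl⟩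
  have he2 : 2 ≤ Real.exp 1 := by linarith [Real.add_one_le_exp 1]
  have hud : 2 ≤ u * d := by nlinarith
  have hθ1 : 1 ≤ θ := by rw [hθ]; nlinarith
  have hθ0 : 0 < θ := by linarith
  set M : ℕ := ⌈θ * t⌉₊ + 1 with hM
  have hM1 : θ * t + 1 ≤ M := by
    rw [hM]; push_cast; linarith [Nat.le_ceil (θ * t)]
  have hM2 : (M : ℝ) ≤ θ * t + 2 := by
    rw [hM]; push_cast; linarith [Nat.ceil_lt_add_one (by positivity : 0 ≤ θ * t)]
  have hM0 : (0 : ℝ) < M := by positivity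
  have hM4 : (M : ℝ) ≤ 4 * (u * d) * t := by
    have h1 : Real.exp 1 ≤ 3 := by linarith [Real.exp_one_lt_d9]
    have h2 : 2 ≤ u * d * t := by nlinarith
    have h3 : θ * t ≤ 3 * (u * d) * t := by
      rw [hθ]
      exact mul_le_mul_of_nonneg_right
        (mul_le_mul_of_nonneg_right h1 (by positivity)) ht.le
    linarith
  set m := C.hopDist o x with hm
  have hmD : (m : ℝ) ≤ C.diam := by exact_mod_cast C.hopDist_le_diam o x
  have hmM : m ≤ M := by
    have : (m : ℝ) ≤ M := by
      have : u * t ≤ θ * t := by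
        refine mul_le_mul_of_nonneg_right ?_ ht.le
        rw [hθ]; nlinarith
      linarith
    exact_mod_cast this
  -- the Chernoff bound, against the contribution of a shortest path
  have htail : Real.exp (-t) * Real.exp (θ * t) / θ ^ M ≤ C.P t o x / 2 := by
    have h1 := C.exp_mul_pow_div_factorial_le t ht.le hd0 o x
    rw [← hm, ← hddef] at h1
    have hfac : (m.factorial : ℝ) ≤ (u * t) ^ m := by
      calc (m.factorial : ℝ) ≤ (m : ℝ) ^ m := by exact_mod_cast Nat.factorial_le_pow m
        _ ≤ (u * t) ^ m := pow_le_pow_left₀ (by positivity) (hmD.trans hut) m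
    have h2 : Real.exp (θ * t + 1) * (u * d) ^ m ≤ θ ^ M := by
      have e1 : θ ^ M = Real.exp M * (u * d) ^ M := by
        rw [hθ, mul_pow (Real.exp 1), ← Real.exp_nat_mul, mul_one]
      rw [e1]
      gcongr
      linarith
    have h3 : Real.exp (θ * t) / θ ^ M ≤ 1 / (2 * (u * d) ^ m) := by
      rw [div_le_div_iff₀ (by positivity) (by positivity)]
      rw [Real.exp_add] at h2
      have h4 : Real.exp (θ * t) * 2 ≤ Real.exp (θ * t) * Real.exp 1 :=
        mul_le_mul_of_nonneg_left he2 (Real.exp_nonneg _)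
      calc Real.exp (θ * t) * (2 * (u * d) ^ m)
          = Real.exp (θ * t) * 2 * (u * d) ^ m := by ring
        _ ≤ Real.exp (θ * t) * Real.exp 1 * (u * d) ^ m :=
            mul_le_mul_of_nonneg_right h4 (by positivity)
        _ ≤ 1 * θ ^ M := by linarith
    have h5 : 1 / (u * d) ^ m ≤ t ^ m / m.factorial / d ^ m := by
      rw [div_div, div_le_div_iff₀ (by positivity) (by positivity), mul_pow, one_mul]
      rw [mul_pow] at hfac
      nlinarith [pow_pos hd0 m]
    have h6 := mul_le_mul_of_nonneg_left h3 (Real.exp_nonneg (-t))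
    have h7 := mul_le_mul_of_nonneg_left h5 (Real.exp_nonneg (-t))
    have h8 : Real.exp (-t) * (1 / (2 * (u * d) ^ m))
        = Real.exp (-t) * (1 / (u * d) ^ m) / 2 := by
      field_simp
    rw [mul_div_assoc]
    linarith
  -- comparison of the two series, term by term
  have hw := C.hasSum_P t o x
  have hv := (C.hasSum_exp_smul_T (θ * t) o x).mul_left (Real.exp (-t))
  have hq := (hasSum_nat_add_iff' 1).2 (C.hasSum_P t o y)
  have hterm : ∀ k : ℕ,
      t * (Real.exp (-t) * (t ^ k / k.factorial * (C.T ^ k) o x)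
        - Real.exp (-t) * ((θ * t) ^ k / k.factorial * (C.T ^ k) o x) / θ ^ M)
      ≤ d * M * (Real.exp (-t) * (t ^ (k + 1) / (k + 1).factorial * (C.T ^ (k + 1)) o y)) := by
    intro k
    have hTk := C.pow_nonneg k o x
    rcases lt_or_ge k M with hk | hk
    · have h1 : (C.T ^ k) o x ≤ d * (C.T ^ (k + 1)) o y := by
        have h2 : (C.T ^ k) o x * C.T x y ≤ (C.T ^ (k + 1)) o y := by
          rw [pow_succ, Matrix.mul_apply]
          exact Finset.single_le_sum (f := fun z => (C.T ^ k) o z * C.T z y)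
            (fun w _ => mul_nonneg (C.pow_nonneg k o w) (C.T_nonneg w y)) (Finset.mem_univ x)
        have h3 := C.one_le_sparsity_mul hxy
        rw [← hddef] at h3
        nlinarith
      have h4 : (k + 1 : ℝ) ≤ M := by exact_mod_cast hk
      have h5 : t ^ (k + 1) / ((k + 1).factorial : ℝ) * (k + 1) = t * (t ^ k / k.factorial) := by
        rw [Nat.factorial_succ]
        push_cast
        field_simp
        ring
      have h6 : 0 ≤ Real.exp (-t) * ((θ * t) ^ k / k.factorial * (C.T ^ k) o x) / θ ^ M := by
        positivity
      have h7 : t * (t ^ k / k.factorial) ≤ t ^ (k + 1) / ((k + 1).factorial : ℝ) * M := by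
        rw [← h5]
        exact mul_le_mul_of_nonneg_left h4 (by positivity)
      have h8 : t * (t ^ k / k.factorial) * (C.T ^ k) o x
          ≤ t ^ (k + 1) / ((k + 1).factorial : ℝ) * M * (d * (C.T ^ (k + 1)) o y) :=
        mul_le_mul h7 h1 hTk (by positivity)
      have h9 := mul_le_mul_of_nonneg_left h8 (Real.exp_nonneg (-t))
      have h10 := mul_nonneg ht.le h6
      linarith
    · have h1 : θ ^ M ≤ θ ^ k := pow_le_pow_right₀ hθ1 hk
      have h2 : Real.exp (-t) * (t ^ k / k.factorial * (C.T ^ k) o x)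
          ≤ Real.exp (-t) * ((θ * t) ^ k / k.factorial * (C.T ^ k) o x) / θ ^ M := by
        rw [le_div_iff₀ (by positivity), mul_pow θ t k]
        calc _ ≤ Real.exp (-t) * (t ^ k / k.factorial * (C.T ^ k) o x) * θ ^ k :=
              mul_le_mul_of_nonneg_left h1 (by positivity)
          _ = _ := by ring
      have h3 := C.pow_nonneg (k + 1) o y
      have h4 : 0 ≤ d * M * (Real.exp (-t)
          * (t ^ (k + 1) / (k + 1).factorial * (C.T ^ (k + 1)) o y)) := by positivity
      have h5 := mul_le_mul_of_nonneg_left h2 ht.le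
      linarith
  have hsum := hasSum_le hterm ((hw.sub (hv.div_const (θ ^ M))).mul_left t) (hq.mul_left (d * M))
  have hfirst : 0 ≤ ∑ i ∈ Finset.range 1,
      Real.exp (-t) * (t ^ i / i.factorial * (C.T ^ i) o y) :=
    Finset.sum_nonneg fun i _ => mul_nonneg (Real.exp_nonneg _)
      (mul_nonneg (by positivity) (C.pow_nonneg i o y))
  have hR : Real.exp (-t) * NormedSpace.exp ((θ * t) • C.T) o x / θ ^ M ≤ C.P t o x / 2 := by
    refine le_trans ?_ htail
    gcongr
    exact C.exp_smul_T_le (θ * t) (by positivity) o x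
  have hQ := C.P_nonneg ht.le o y
  have h1 : t * (C.P t o x / 2) ≤ d * M * C.P t o y := by
    calc t * (C.P t o x / 2)
        ≤ t * (C.P t o x - Real.exp (-t) * NormedSpace.exp ((θ * t) • C.T) o x / θ ^ M) :=
          mul_le_mul_of_nonneg_left (by linarith) ht.le
      _ ≤ _ := hsum
      _ ≤ d * M * C.P t o y := mul_le_mul_of_nonneg_left (by linarith) (by positivity)
  have h2 : d * M * C.P t o y ≤ d * (4 * (u * d) * t) * C.P t o y :=
    mul_le_mul_of_nonneg_right (mul_le_mul_of_nonneg_left hM4 hd0.le) hQ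
  have h3 : t * (C.P t o x) ≤ t * (8 * d ^ 2 * u * C.P t o y) := by linarith
  exact le_of_mul_le_mul_left h3 ht

lemma pi_le_sparsity_mul_pi {x y : X} (h : 0 < C.T y x) : C.π y ≤ C.sparsity * C.π x := by
  have h1 : C.π y * C.T y x ≤ C.π x := by
    rw [← C.stationary x]
    exact Finset.single_le_sum (f := fun z => C.π z * C.T z x)
      (fun z _ => mul_nonneg (C.π_nonneg z) (C.T_nonneg z x)) (Finset.mem_univ y)
  have h2 := C.one_le_sparsity_mul h
  nlinarith [C.pi_pos y, C.sparsity_nonneg]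

lemma density_dirac_le_of_edge (hW : C.WeaklyReversible) (hd : 2 ≤ C.sparsity) {t : ℝ}
    (ht : 0 < t) (o : X) {x y : X} (hxy : 0 < C.T x y) :
    C.density (C.dirac o) t x
      ≤ 8 * C.sparsity ^ 3 * max 1 (C.diam / t) * C.density (C.dirac o) t y := by
  have := C.nontrivial_of_two_le_sparsity hd
  have h1 := C.P_le_mul_P_of_edge hd ht o hxy
  have h2 := C.pi_le_sparsity_mul_pi (hW x y hxy)
  have h3 := C.P_nonneg ht.le o y
  have hx := C.pi_pos x
  have hy := C.pi_pos y
  have hu : (0 : ℝ) < max 1 (C.diam / t) := lt_of_lt_of_le one_pos (le_max_left _ _)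
  rw [density_dirac, density_dirac, mul_div_assoc', div_le_div_iff₀ hx hy]
  calc C.P t o x * C.π y
      ≤ (8 * C.sparsity ^ 2 * max 1 (C.diam / t) * C.P t o y) * (C.sparsity * C.π x) :=
        mul_le_mul h1 h2 hy.le (by positivity)
    _ = _ := by ring

/-! ### The differential inequality -/

lemma one_sub_sq_div_two_le {w : ℝ} (hw : 0 ≤ w) :
    1 - w ^ 2 / 2 ≤ (1 + w) * Real.exp (-w) := by
  have hd : ∀ s : ℝ, HasDerivAt (fun s => (1 + s) * Real.exp (-s) + s ^ 2 / 2)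
      (s * (1 - Real.exp (-s))) s := by
    intro s
    have h1 := (((hasDerivAt_id s).const_add 1).mul (hasDerivAt_id s).neg.exp).add
      (((hasDerivAt_id s).pow 2).div_const 2)
    refine h1.congr_deriv ?_
    simp
    ring
  have hmono : MonotoneOn (fun s : ℝ => (1 + s) * Real.exp (-s) + s ^ 2 / 2) (Set.Ici 0) := by
    refine monotoneOn_of_deriv_nonneg (convex_Ici 0)
      (fun s _ => (hd s).continuousAt.continuousWithinAt)
      (fun s _ => (hd s).differentiableAt.differentiableWithinAt) fun s hs => ?_
    rw [interior_Ici] at hs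
    rw [(hd s).deriv]
    have : Real.exp (-s) ≤ 1 := Real.exp_le_one_iff.2 (neg_nonpos.2 (le_of_lt hs))
    exact mul_nonneg (le_of_lt hs) (by linarith)
  have h := hmono Set.self_mem_Ici hw hw
  simp only [add_zero, neg_zero, Real.exp_zero, mul_one] at h
  linarith

/-- A quantitative comparison of `v ↦ v² / 2` with its exponential counterpart, when `v` is not
too negative. -/
lemma sq_div_two_le_exp {K v : ℝ} (hK : 0 ≤ K) (hv : -K ≤ v) :
    v ^ 2 / 2 ≤ (1 + K) * (Real.exp v - 1 - v) := by
  have h0 : 0 ≤ Real.exp v - 1 - v := by linarith [Real.add_one_le_exp v]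
  rcases le_total 0 v with h | h
  · have := Real.quadratic_le_exp_of_nonneg h
    nlinarith
  · have h1 := one_sub_sq_div_two_le (neg_nonneg.2 h)
    rw [neg_neg] at h1
    nlinarith

lemma mean_dirac_mul (x : X) (h : X → ℝ) : C.mean (fun y => C.dirac x y * h y) = h x := by
  rw [mean, Finset.sum_eq_single x]
  · have := (C.pi_pos x).ne'
    rw [dirac, Pi.single_eq_same]
    field_simp
  · intro z _ hz
    rw [dirac, Pi.single_eq_of_ne hz, zero_mul, mul_zero]
  · simp

lemma dirac_nonneg (x y : X) : 0 ≤ C.dirac x y := by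
  rcases eq_or_ne y x with rfl | h
  · rw [dirac, Pi.single_eq_same]
    exact (one_div_pos.2 (C.pi_pos y)).le
  · rw [dirac, Pi.single_eq_of_ne h]

lemma mean_dirac (x : X) : C.mean (C.dirac x) = 1 := by
  have := C.mean_dirac_mul x fun _ => 1
  simpa using this

/-- A bound on the ratios of a density along edges bounds its Fisher information by its entropy
dissipation. -/
lemma mean_mul_carre_log_le {f : X → ℝ} (hf : ∀ x, 0 < f x) {K : ℝ} (hK : 0 ≤ K)
    (hr : ∀ x y, 0 < C.T x y → f x ≤ Real.exp K * f y) :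
    C.mean (fun x => f x * C.carre (fun y => Real.log (f y)) (fun y => Real.log (f y)) x)
      ≤ (1 + K) * C.dirichletForm f (fun y => Real.log (f y)) := by
  rw [C.dirichletForm_eq_add_sub f _ f]
  simp only [mean, carre_eq, Finset.mul_sum]
  refine Finset.sum_le_sum fun x _ => Finset.sum_le_sum fun y _ => ?_
  rcases (C.T_nonneg x y).eq_or_lt with hT | hT
  · rw [← hT]; simp
  · set v := Real.log (f y) - Real.log (f x) with hv
    have hvK : -K ≤ v := by
      have h1 := Real.log_le_log (hf x) (hr x y hT)
      rw [Real.log_mul (Real.exp_pos K).ne' (hf y).ne', Real.log_exp] at h1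
      linarith
    have h1 := sq_div_two_le_exp hK hvK
    have h2 : f x * Real.exp v = f y := by
      rw [hv, Real.exp_sub, Real.exp_log (hf y), Real.exp_log (hf x)]
      field_simp [(hf x).ne']
    have h3 := mul_le_mul_of_nonneg_left h1
      (mul_pos (mul_pos (C.pi_pos x) hT) (hf x)).le
    calc C.π x * (f x * (1 / 2 * (C.T x y * (v * v))))
        = C.π x * C.T x y * f x * (v ^ 2 / 2) := by ring
      _ ≤ _ := h3
      _ = (1 + K) * (C.π x * C.T x y * (f x * Real.exp v - f x - f x * v)) := by ring
      _ = _ := by rw [h2, hv]; ring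

lemma varent_density_dirac_le (hCD : C.CD 0) (x : X) {t : ℝ} (ht : 0 < t) {K : ℝ} (hK : 0 ≤ K)
    (hr : ∀ y z, 0 < C.T y z →
      C.density (C.dirac x) t y ≤ Real.exp K * C.density (C.dirac x) t z) :
    C.varent (C.density (C.dirac x) t) ≤ t * (2 + 2 * K) *
      C.dirichletForm (C.density (C.dirac x) t)
        (fun y => Real.log (C.density (C.dirac x) t y)) := by
  set f := C.density (C.dirac x) t with hf
  set g : X → ℝ := fun y => Real.log (f y) with hg
  have hpos : ∀ y, 0 < f y := C.density_pos (C.dirac_nonneg x) (C.mean_dirac x) ht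
  have hmean : ∀ h : X → ℝ, C.mean (fun y => f y * h y) = (C.P t).mulVec h x := fun h => by
    rw [hf, mean_density_mul, mean_dirac_mul]
  have h1 := C.local_poincare hCD g ht.le x
  rw [← hmean, ← hmean, ← hmean] at h1
  have h2 := mul_le_mul_of_nonneg_left (C.mean_mul_carre_log_le hpos hK hr)
    (by positivity : 0 ≤ 2 * t)
  rw [varent]
  refine (h1.trans h2).trans (le_of_eq ?_)
  ring

lemma satisfiesIDI_dirac (hW : C.WeaklyReversible) (hρ : 0 ≤ C.curvature) (hd : 2 ≤ C.sparsity)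
    (x : X) : C.SatisfiesIDI (C.dirac x) (fun t =>
      16 * t * Real.log C.sparsity + 4 * t * Real.posLog (C.diam / t)) := by
  intro t ht
  have hl2 : Real.log 2 ≤ Real.log C.sparsity := Real.log_le_log two_pos hd
  have hln2 := Real.log_two_gt_d9
  have hpl := Real.posLog_nonneg (x := C.diam / t)
  have hd0 : 0 < C.sparsity := by linarith
  set u : ℝ := max 1 (C.diam / t) with hu
  have hu0 : 0 < u := lt_of_lt_of_le one_pos (le_max_left _ _)
  have hlogu : Real.posLog (C.diam / t) = Real.log u :=
    Real.posLog_eq_log_max_one (by positivity)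
  have hder := C.hasDerivAt_ent (C.dirac_nonneg x) (C.mean_dirac x) ht
  refine ⟨?_, hder.differentiableAt, ?_⟩
  · have h1 : 0 < t * Real.log C.sparsity := mul_pos ht (by linarith)
    have h2 : 0 ≤ t * Real.posLog (C.diam / t) := mul_nonneg ht.le hpl
    show 0 < 16 * t * Real.log C.sparsity + 4 * t * Real.posLog (C.diam / t)
    linarith
  rw [hder.deriv, neg_mul_neg]
  set K : ℝ := Real.log (8 * C.sparsity ^ 3 * u) with hK
  have hexpK : Real.exp K = 8 * C.sparsity ^ 3 * u := Real.exp_log (by positivity)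
  have hKeq : K = 3 * Real.log 2 + 3 * Real.log C.sparsity + Real.log u := by
    rw [hK, Real.log_mul (by positivity) hu0.ne', Real.log_mul (by norm_num) (by positivity),
      Real.log_pow, show (8 : ℝ) = 2 ^ 3 by norm_num, Real.log_pow]
    push_cast
    ring
  rw [hlogu] at hpl
  have hK0 : 0 ≤ K := by linarith
  have h1 := C.varent_density_dirac_le (C.cd_zero_of_curvature_nonneg hρ) x ht hK0
    fun y z hyz => by
      rw [hexpK]
      exact C.density_dirac_le_of_edge hW hd ht x hyz
  refine h1.trans (mul_le_mul_of_nonneg_right ?_ ?_)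
  · show t * (2 + 2 * K) ≤ 16 * t * Real.log C.sparsity + 4 * t * Real.posLog (C.diam / t)
    rw [hlogu]
    have : 2 + 2 * K ≤ 16 * Real.log C.sparsity + 4 * Real.log u := by linarith
    nlinarith
  · have hpos := C.density_pos (C.dirac_nonneg x) (C.mean_dirac x) ht
    have h2 := C.two_mul_dirichletForm_sqrt_le hpos
    have h3 := C.dirichletForm_self_nonneg (fun y => √(C.density (C.dirac x) t y))
    linarith

/-! ### Varentropy, entropy and total variation -/

/-- A density which is far from equilibrium in total variation but has a large entropy must have a
large varentropy: otherwise Chebyshev's inequality would concentrate its mass on a set of very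
small stationary probability. -/
lemma ent_sq_le_varent {f : X → ℝ} (hf : ∀ x, 0 ≤ f x) (hm : C.mean f = 1) {ε : ℝ} (hε : 0 < ε)
    (htv : C.tv f ≤ 1 - ε) (hE0 : 0 < C.ent f) (hE : 2 * Real.log (2 / ε) ≤ C.ent f) :
    ε / 8 * C.ent f ^ 2 ≤ C.varent f := by
  have hEeq : C.mean (fun x => f x * Real.log (f x)) = C.ent f := by
    rw [ent, hm, Real.log_one, mul_zero, sub_zero]
  set E := C.ent f with hEdef
  have hV : C.mean (fun x => f x * (Real.log (f x) - E) ^ 2) = C.varent f := by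
    have h : ∀ x, f x * (Real.log (f x) - E) ^ 2
        = f x * Real.log (f x) ^ 2 - (2 * E) * (f x * Real.log (f x)) + E ^ 2 * f x :=
      fun x => by ring
    simp only [h, mean_add, mean_sub, mean_const_mul, varent, hEeq, hm]
    ring
  have hpt : ∀ x, f x + 1 - |f x - 1| ≤
      2 * (4 / E ^ 2 * (f x * (Real.log (f x) - E) ^ 2) + Real.exp (-(E / 2)) * f x) := by
    intro x
    have h0 : 0 ≤ 4 / E ^ 2 * (f x * (Real.log (f x) - E) ^ 2) :=
      mul_nonneg (by positivity) (mul_nonneg (hf x) (sq_nonneg _))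
    have h1 : 0 ≤ Real.exp (-(E / 2)) * f x := mul_nonneg (Real.exp_nonneg _) (hf x)
    rcases le_or_gt (Real.exp (E / 2)) (f x) with h | h
    · have h2 : 1 ≤ Real.exp (-(E / 2)) * f x := by
        rw [Real.exp_neg, inv_mul_eq_div, one_le_div (Real.exp_pos _)]
        exact h
      linarith [le_abs_self (f x - 1)]
    · have h3 : f x ≤ 4 / E ^ 2 * (f x * (Real.log (f x) - E) ^ 2) := by
        rcases (hf x).eq_or_lt with h4 | h4
        · rw [← h4]; simp
        · have h5 : Real.log (f x) < E / 2 := (Real.log_lt_iff_lt_exp h4).2 h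
          have h6 : E ^ 2 ≤ 4 * (Real.log (f x) - E) ^ 2 := by nlinarith
          rw [div_mul_eq_mul_div, le_div_iff₀ (by positivity)]
          nlinarith
      linarith [neg_abs_le (f x - 1)]
  have hmean := C.mean_mono hpt
  rw [mean_sub, mean_add, mean_const, mean_const_mul, mean_add, mean_const_mul, mean_const_mul,
    hm, hV, mul_one] at hmean
  have htv' : C.mean (fun x => |f x - 1|) ≤ 2 * (1 - ε) := by
    rw [tv] at htv
    linarith
  have hexp : Real.exp (-(E / 2)) ≤ ε / 2 := by
    have h1 : -(E / 2) ≤ Real.log (ε / 2) := by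
      rw [← inv_div 2 ε, Real.log_inv]
      linarith
    calc Real.exp (-(E / 2)) ≤ Real.exp (Real.log (ε / 2)) := Real.exp_le_exp.2 h1
      _ = ε / 2 := Real.exp_log (by positivity)
  have h1 : ε / 2 ≤ 4 / E ^ 2 * C.varent f := by linarith
  rw [div_mul_eq_mul_div, le_div_iff₀ (by positivity)] at h1
  linarith

lemma mean_abs_le_sqrt (f : X → ℝ) : C.mean (fun x => |f x|) ≤ √(C.mean (fun x => f x ^ 2)) := by
  have h := C.mean_mul_sq_le (fun x => |f x|) (fun _ => 1)
  simp only [mul_one, sq_abs, one_pow, mean_const] at h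
  exact Real.le_sqrt_of_sq_le h

/-- From an initial density of moderate entropy, mixing takes a time of order the relaxation time:
truncating the density at a level exponential in its entropy costs little mass and makes
it bounded. -/
lemma tv_density_le_of_ent {γ : ℝ}
    (hγ : ∀ f : X → ℝ, γ * C.variance f ≤ C.dirichletForm f f) {f : X → ℝ} (hf : ∀ x, 0 ≤ f x)
    (hm : C.mean f = 1) (hE : 0 ≤ C.ent f) {ε : ℝ} (hε : 0 < ε) {t : ℝ} (ht : 0 ≤ t)
    (hγt : (C.ent f + 1) / ε + Real.log (1 / ε) ≤ γ * t) :
    C.tv (C.density f t) ≤ ε := by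
  set l : ℝ := 2 * (C.ent f + 1) / ε with hl
  have hl0 : 0 < l := by positivity
  set h : X → ℝ := fun x => if Real.exp l < f x then f x else 0 with hh
  set g : X → ℝ := fun x => f x - h x with hg
  have hh0 : ∀ x, 0 ≤ h x := fun x => by
    simp only [hh]; split_ifs
    · exact hf x
    · exact le_rfl
  have hg0 : ∀ x, 0 ≤ g x := fun x => by
    simp only [hg, hh]; split_ifs
    · simp
    · simpa using hf x
  have hgM : ∀ x, g x ≤ Real.exp l := fun x => by
    simp only [hg, hh]; split_ifs with h1
    · simpa using Real.exp_nonneg l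
    · simpa using not_lt.1 h1
  have hhm : C.mean h ≤ ε / 2 := by
    have h1 : ∀ x, l * h x ≤ f x * Real.log (f x) + 1 := by
      intro x
      have h2 : 0 ≤ f x * Real.log (f x) + 1 := by
        have := sq_sqrt_sub_one_le (hf x)
        linarith [sq_nonneg (√(f x) - 1), hf x]
      simp only [hh]
      split_ifs with h3
      · have h4 : l < Real.log (f x) :=
          (Real.lt_log_iff_exp_lt ((Real.exp_pos l).trans h3)).2 h3
        nlinarith [hf x]
      · simpa using h2
    have h2 := C.mean_mono h1
    have h3 : C.mean (fun x => f x * Real.log (f x)) = C.ent f := by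
      rw [ent, hm, Real.log_one, mul_zero, sub_zero]
    rw [mean_const_mul, mean_add, mean_const, h3] at h2
    have h4 : l * (ε / 2) = C.ent f + 1 := by
      rw [hl]; field_simp
    exact le_of_mul_le_mul_left (h2.trans h4.ge) hl0
  have hsum : ∀ x, f x = g x + h x := fun x => by simp only [hg]; ring
  have hmgh : C.mean g + C.mean h = 1 := by
    rw [← hm, ← mean_add]
    congr 1
    ext x
    exact (hsum x).symm
  have hh1 : 0 ≤ C.mean h := C.mean_nonneg hh0
  -- the large part has a small total mass
  have hlarge : C.mean (fun y => |C.density h t y - C.mean h|) ≤ ε := by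
    have h1 : ∀ y, |C.density h t y - C.mean h| ≤ C.density h t y + C.mean h := fun y => by
      have := C.density_nonneg hh0 ht y
      rw [abs_le]
      constructor <;> linarith
    refine (C.mean_mono h1).trans ?_
    rw [mean_add, mean_const, mean_density]
    linarith
  -- the bounded part equilibrates at the rate given by the spectral gap
  have hsmall : C.mean (fun y => |C.density g t y - C.mean g|) ≤ ε := by
    refine (C.mean_abs_le_sqrt _).trans (Real.sqrt_le_iff.2 ⟨hε.le, ?_⟩)
    have h1 : C.variance g ≤ Real.exp l := by
      have h2 : ∀ x, g x ^ 2 ≤ Real.exp l * g x := fun x => by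
        rw [sq]; exact mul_le_mul_of_nonneg_right (hgM x) (hg0 x)
      have h3 := C.mean_mono h2
      rw [mean_const_mul] at h3
      have h4 := Real.exp_pos l
      rw [variance]
      nlinarith [sq_nonneg (C.mean g)]
    have h2 := C.variance_density_le hγ g ht
    rw [variance_eq, mean_density] at h2
    refine h2.trans ?_
    have h3 : Real.exp (-2 * γ * t) * C.variance g ≤ Real.exp (-2 * γ * t) * Real.exp l :=
      mul_le_mul_of_nonneg_left h1 (Real.exp_nonneg _)
    refine h3.trans ?_
    rw [← Real.exp_add, ← Real.le_log_iff_exp_le (by positivity), Real.log_pow]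
    rw [one_div, Real.log_inv] at hγt
    have h4 : l = 2 * ((C.ent f + 1) / ε) := by rw [hl]; ring
    push_cast
    rw [h4]
    linarith
  have hfinal : C.mean (fun y => |C.density f t y - 1|) ≤ ε + ε := by
    refine le_trans ?_ (add_le_add hsmall hlarge)
    rw [← mean_add]
    refine C.mean_mono fun y => ?_
    have h1 : C.density f t y = C.density g t y + C.density h t y := by
      rw [← density_add_fun]
      congr 1
      ext x
      exact hsum x
    rw [h1, ← hmgh]
    have := abs_add_le (C.density g t y - C.mean g) (C.density h t y - C.mean h)
    rwa [show C.density g t y - C.mean g + (C.density h t y - C.mean h)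
      = C.density g t y + C.density h t y - (C.mean g + C.mean h) by ring] at this
  rw [tv]
  linarith

lemma ent_density_le {f : X → ℝ} (hf : ∀ x, 0 ≤ f x) (hm : C.mean f = 1) {s t : ℝ} (hs : 0 ≤ s)
    (hst : s ≤ t) :
    C.ent (C.density f t) ≤ Real.exp (-C.mlsConst * (t - s)) * C.ent (C.density f s) := by
  have hd : ∀ r, 0 < r →
      HasDerivAt (fun r => Real.exp (C.mlsConst * r) * C.ent (C.density f r))
      (Real.exp (C.mlsConst * r) * (C.mlsConst * C.ent (C.density f r)
        - C.dirichletForm (C.density f r) (fun y => Real.log (C.density f r y)))) r := by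
    intro r hr
    have h2 : HasDerivAt (fun r => Real.exp (C.mlsConst * r))
        (Real.exp (C.mlsConst * r) * C.mlsConst) r := by
      simpa using ((hasDerivAt_id r).const_mul C.mlsConst).exp
    refine (h2.mul (C.hasDerivAt_ent hf hm hr)).congr_deriv ?_
    ring
  have hc : Continuous (fun r => Real.exp (C.mlsConst * r) * C.ent (C.density f r)) :=
    (Real.continuous_exp.comp (continuous_const.mul continuous_id)).mul (C.continuous_ent f)
  have hanti : AntitoneOn (fun r => Real.exp (C.mlsConst * r) * C.ent (C.density f r))
      (Set.Ici 0) := by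
    refine antitoneOn_of_deriv_nonpos (convex_Ici 0) hc.continuousOn (fun r hr => ?_)
      fun r hr => ?_
    · rw [interior_Ici] at hr
      exact (hd r hr).differentiableAt.differentiableWithinAt
    · rw [interior_Ici] at hr
      rw [(hd r hr).deriv]
      refine mul_nonpos_of_nonneg_of_nonpos (Real.exp_nonneg _) ?_
      have := C.mls (C.density_pos hf hm hr)
      linarith
  have h := hanti hs (hs.trans hst) hst
  have h1 : Real.exp (-C.mlsConst * (t - s)) = Real.exp (C.mlsConst * s)
      / Real.exp (C.mlsConst * t) := by
    rw [← Real.exp_sub]; congr 1; ring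
  rw [h1, div_mul_eq_mul_div, le_div_iff₀ (Real.exp_pos _), mul_comm]
  exact h

/-- The differential inequality `E² ≲ -ψ E'` makes `1 / E` grow at least linearly. -/
lemma le_of_deriv_le_neg_sq {E : ℝ → ℝ} {a s c e₀ : ℝ} (has : a < s) (hc : 0 < c) (he : 0 < e₀)
    (hcont : Continuous E) (hdiff : ∀ r ∈ Set.Ioo a s, DifferentiableAt ℝ E r)
    (hnonpos : ∀ r ∈ Set.Ioo a s, deriv E r ≤ 0)
    (hder : ∀ r ∈ Set.Ioo a s, e₀ ≤ E r → c * E r ^ 2 ≤ -deriv E r) :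
    E s ≤ max e₀ (1 / (c * (s - a))) := by
  by_contra! hlt
  have h1 : e₀ < E s := (le_max_left _ _).trans_lt hlt
  have h2 : 1 / (c * (s - a)) < E s := (le_max_right _ _).trans_lt hlt
  have hanti : AntitoneOn E (Set.Icc a s) := by
    refine antitoneOn_of_deriv_nonpos (convex_Icc a s) hcont.continuousOn ?_ ?_
    · rw [interior_Icc]; exact fun r hr => (hdiff r hr).differentiableWithinAt
    · rw [interior_Icc]; exact hnonpos
  have hE : ∀ r ∈ Set.Icc a s, e₀ < E r := fun r hr =>
    h1.trans_le (hanti hr (Set.right_mem_Icc.2 has.le) hr.2)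
  have hEpos : ∀ r ∈ Set.Icc a s, 0 < E r := fun r hr => he.trans (hE r hr)
  have hmono : MonotoneOn (fun r => (E r)⁻¹ - c * r) (Set.Icc a s) := by
    refine monotoneOn_of_deriv_nonneg (convex_Icc a s) ?_ ?_ ?_
    · exact (hcont.continuousOn.inv₀ fun r hr => (hEpos r hr).ne').sub
        (continuous_const.mul continuous_id).continuousOn
    · rw [interior_Icc]
      exact fun r hr => (((hdiff r hr).inv (hEpos r (Set.Ioo_subset_Icc_self hr)).ne').sub
        (differentiableAt_id.const_mul c)).differentiableWithinAt
    · rw [interior_Icc]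
      intro r hr
      have hr' := Set.Ioo_subset_Icc_self hr
      have h3 : HasDerivAt (fun r => (E r)⁻¹ - c * r) (-deriv E r / E r ^ 2 - c * 1) r :=
        ((hdiff r hr).hasDerivAt.inv (hEpos r hr').ne').sub ((hasDerivAt_id r).const_mul c)
      rw [h3.deriv, mul_one, sub_nonneg, le_div_iff₀ (by have := hEpos r hr'; positivity)]
      exact hder r hr (hE r hr').le
  have h3 := hmono (Set.left_mem_Icc.2 has.le) (Set.right_mem_Icc.2 has.le) has.le
  have h4 : 0 < (E a)⁻¹ := inv_pos.2 (hEpos a (Set.left_mem_Icc.2 has.le))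
  have h5 := hEpos s (Set.right_mem_Icc.2 has.le)
  have h6 : c * (s - a) < (E s)⁻¹ := by
    simp only at h3
    linarith
  have h7 : 0 < c * (s - a) := mul_pos hc (sub_pos.2 has)
  rw [div_lt_iff₀ h7] at h2
  rw [lt_inv_comm₀ h7 h5, inv_eq_one_div, lt_div_iff₀ h7] at h6
  linarith

/-! ### Concentration, and a bound on the diameter -/

lemma exp_sub_one_sub_le {v l : ℝ} (h : |v| ≤ l) :
    Real.exp v - 1 - v ≤ l ^ 2 * Real.exp l := by
  have hl : 0 ≤ l := (abs_nonneg v).trans h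
  have h1 : Real.exp v - 1 ≤ v * Real.exp v := by
    have h2 := Real.add_one_le_exp (-v)
    rw [Real.exp_neg] at h2
    have h3 := mul_le_mul_of_nonneg_right h2 (Real.exp_nonneg v)
    rw [inv_mul_cancel₀ (Real.exp_pos v).ne'] at h3
    linarith
  have h4 := Real.add_one_le_exp v
  have h5 : Real.exp v ≤ Real.exp l := Real.exp_le_exp.2 ((le_abs_self v).trans h)
  have h6 : v ^ 2 ≤ l ^ 2 := sq_le_sq' (by linarith [neg_abs_le v]) ((le_abs_self v).trans h)
  have h7 : 1 ≤ Real.exp l := Real.one_le_exp hl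
  rcases le_total 0 v with hv | hv
  · calc Real.exp v - 1 - v ≤ v ^ 2 * Real.exp v := by nlinarith
      _ ≤ l ^ 2 * Real.exp l := mul_le_mul h6 h5 (Real.exp_nonneg _) (sq_nonneg _)
  · have h8 : Real.exp v ≤ 1 := Real.exp_le_one_iff.2 hv
    calc Real.exp v - 1 - v ≤ v ^ 2 * 1 := by nlinarith
      _ ≤ l ^ 2 * Real.exp l := mul_le_mul h6 h7 zero_le_one (sq_nonneg _)

/-- Herbst's argument: the modified log-Sobolev inequality controls the exponential moments of
functions with increments at most one along edges. -/
lemma log_mean_exp_le [Nontrivial X] {g : X → ℝ} (hg : ∀ x y, 0 < C.T x y → |g y - g x| ≤ 1)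
    {l : ℝ} (hl : 0 < l) :
    Real.log (C.mean fun x => Real.exp (l * g x))
      ≤ l * C.mean g + l ^ 2 * Real.exp l / C.mlsConst := by
  have hα := C.mlsConst_pos
  set α := C.mlsConst with hαdef
  set Z : ℝ → ℝ := fun s => C.mean fun x => Real.exp (s * g x) with hZ
  set Z' : ℝ → ℝ := fun s => C.mean fun x => Real.exp (s * g x) * g x with hZ'
  have hZpos : ∀ s, 0 < Z s := fun s => C.mean_pos fun x => Real.exp_pos _
  have hdZ : ∀ s, HasDerivAt Z (Z' s) s := fun s => by
    refine C.hasDerivAt_mean fun x => ?_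
    simpa using ((hasDerivAt_id s).mul_const (g x)).exp
  have hdH : ∀ s, HasDerivAt (fun s => Real.log (Z s)) (Z' s / Z s) s := fun s =>
    (hdZ s).log (hZpos s).ne'
  have hkey : ∀ s, 0 < s → s ≤ l →
      s * Z' s - Z s * Real.log (Z s) ≤ s ^ 2 * Real.exp l / α * Z s := by
    intro s hs hsl
    have h1 := C.mls (f := fun x => Real.exp (s * g x)) fun x => Real.exp_pos _
    simp only [Real.log_exp] at h1
    have h2 : C.ent (fun x => Real.exp (s * g x)) = s * Z' s - Z s * Real.log (Z s) := by
      have h3 : ∀ x, Real.exp (s * g x) * (s * g x) = s * (Real.exp (s * g x) * g x) :=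
        fun x => by ring
      simp only [ent, Real.log_exp, h3, mean_const_mul, hZ, hZ']
    have h3 : C.dirichletForm (fun x => Real.exp (s * g x)) (fun x => s * g x)
        = ∑ x, ∑ y, C.π x * C.T x y * (Real.exp (s * g x) * (s * g x - s * g y)
          + Real.exp (s * g y) - Real.exp (s * g x)) :=
      C.dirichletForm_eq_add_sub _ _ fun x => Real.exp (s * g x)
    have h4 : C.dirichletForm (fun x => Real.exp (s * g x)) (fun x => s * g x)
        ≤ s ^ 2 * Real.exp l * Z s := by
      have h5 : s ^ 2 * Real.exp l * Z s
          = C.mean (fun x => s ^ 2 * Real.exp l * Real.exp (s * g x)) := by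
        rw [mean_const_mul]
      rw [h3, h5, ← C.sum_pi_T_left]
      refine Finset.sum_le_sum fun x _ => Finset.sum_le_sum fun y _ => ?_
      rcases (C.T_nonneg x y).eq_or_lt with hT | hT
      · rw [← hT]; simp
      refine mul_le_mul_of_nonneg_left ?_ (mul_pos (C.pi_pos x) hT).le
      have h6 : |s * (g y - g x)| ≤ s := by
        rw [abs_mul, abs_of_pos hs]
        exact mul_le_of_le_one_right hs.le (hg x y hT)
      have h7 := exp_sub_one_sub_le h6
      have h8 : s ^ 2 * Real.exp s ≤ s ^ 2 * Real.exp l :=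
        mul_le_mul_of_nonneg_left (Real.exp_le_exp.2 hsl) (sq_nonneg s)
      have h9 : Real.exp (s * g y) = Real.exp (s * g x) * Real.exp (s * (g y - g x)) := by
        rw [← Real.exp_add]; congr 1; ring
      have h10 := mul_le_mul_of_nonneg_left (h7.trans h8) (Real.exp_nonneg (s * g x))
      rw [h9]
      linarith
    rw [h2] at h1
    rw [div_mul_eq_mul_div, le_div_iff₀ hα]
    linarith
  have hanti : AntitoneOn (fun s => Real.log (Z s) / s - Real.exp l / α * s) (Set.Ioc 0 l) := by
    have hd : ∀ s, 0 < s → HasDerivAt (fun s => Real.log (Z s) / s - Real.exp l / α * s)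
        ((Z' s / Z s * s - Real.log (Z s) * 1) / s ^ 2 - Real.exp l / α * 1) s := fun s hs =>
      ((hdH s).div (hasDerivAt_id s) hs.ne').sub ((hasDerivAt_id s).const_mul _)
    refine antitoneOn_of_deriv_nonpos (convex_Ioc 0 l)
      (fun s hs => (hd s hs.1).continuousAt.continuousWithinAt) (fun s hs => ?_) fun s hs => ?_
    · rw [interior_Ioc] at hs
      exact (hd s hs.1).differentiableAt.differentiableWithinAt
    · rw [interior_Ioc] at hs
      rw [(hd s hs.1).deriv, sub_nonpos, mul_one, mul_one, div_le_iff₀ (pow_pos hs.1 2)]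
      have h1 := hkey s hs.1 hs.2.le
      have h2 := hZpos s
      have h3 : (Z' s / Z s * s - Real.log (Z s)) * Z s = s * Z' s - Z s * Real.log (Z s) := by
        field_simp
      refine le_of_mul_le_mul_right ?_ h2
      rw [h3]
      refine h1.trans (le_of_eq ?_)
      ring
  have hslope : Tendsto (fun s => Real.log (Z s) / s) (𝓝[>] 0) (𝓝 (C.mean g)) := by
    have h1 := (hasDerivAt_iff_tendsto_slope_zero.1 (hdH 0)).mono_left
      (nhdsWithin_mono 0 fun s (hs : 0 < s) => hs.ne')
    have h2 : Z 0 = 1 := by simp only [hZ, zero_mul, Real.exp_zero, mean_const]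
    have h3 : Z' 0 = C.mean g := by simp only [hZ', zero_mul, Real.exp_zero, one_mul]
    rw [h2, h3, div_one] at h1
    refine h1.congr fun s => ?_
    rw [zero_add, Real.log_one, sub_zero, smul_eq_mul, inv_mul_eq_div]
  have hle : Real.log (Z l) / l - Real.exp l / α * l ≤ C.mean g := by
    refine ge_of_tendsto hslope ?_
    filter_upwards [Ioc_mem_nhdsGT hl] with s hs
    have h1 := hanti hs (Set.right_mem_Ioc.2 hl) hs.2
    have h2 : 0 ≤ Real.exp l / α * s := mul_nonneg (by positivity) hs.1.le
    simp only at h1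
    linarith
  rw [sub_le_iff_le_add, div_le_iff₀ hl] at hle
  refine hle.trans (le_of_eq ?_)
  ring

lemma pow_add_pos {j k : ℕ} {x y z : X} (h1 : 0 < (C.T ^ j) x y) (h2 : 0 < (C.T ^ k) y z) :
    0 < (C.T ^ (j + k)) x z := by
  rw [pow_add, Matrix.mul_apply]
  exact Finset.sum_pos' (fun w _ => mul_nonneg (C.pow_nonneg j x w) (C.pow_nonneg k w z))
    ⟨y, Finset.mem_univ y, mul_pos h1 h2⟩

lemma hopDist_triangle (x y z : X) : C.hopDist x z ≤ C.hopDist x y + C.hopDist y z :=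
  C.hopDist_le_of_pos (C.pow_add_pos (C.pow_hopDist_pos x y) (C.pow_hopDist_pos y z))

lemma hopDist_comm (hW : C.WeaklyReversible) (x y : X) : C.hopDist x y = C.hopDist y x := by
  have key : ∀ (k : ℕ) (x y : X), 0 < (C.T ^ k) x y → 0 < (C.T ^ k) y x := by
    intro k
    induction k with
    | zero =>
      intro x y h
      have hxy : x = y := by
        by_contra hne
        simp [Matrix.one_apply_ne hne] at h
      rwa [hxy] at h ⊢
    | succ k ih =>
      intro x y h
      obtain ⟨z, h1, h2⟩ := (C.pow_succ_pos_iff k x y).1 h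
      rw [add_comm]
      exact C.pow_add_pos (by simpa using hW z y h2) (ih x z h1)
  exact le_antisymm (C.hopDist_le_of_pos (key _ y x (C.pow_hopDist_pos y x)))
    (C.hopDist_le_of_pos (key _ x y (C.pow_hopDist_pos x y)))

lemma abs_hopDist_sub_le_one (hW : C.WeaklyReversible) (o : X) {x y : X} (h : 0 < C.T x y) :
    |(C.hopDist o y : ℝ) - C.hopDist o x| ≤ 1 := by
  have h1 : (C.hopDist o y : ℝ) ≤ C.hopDist o x + 1 := by exact_mod_cast C.hopDist_le_succ h
  have h2 : (C.hopDist o x : ℝ) ≤ C.hopDist o y + 1 := by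
    exact_mod_cast C.hopDist_le_succ (hW x y h)
  rw [abs_le]
  constructor <;> linarith

lemma neg_log_pi_le (hd : 1 ≤ C.sparsity) (x : X) :
    -Real.log (C.π x) ≤ C.diam * (1 + Real.log C.sparsity) := by
  have hd0 : 0 < C.sparsity := by linarith
  have h1 : ∀ z, Real.exp (-(C.diam : ℝ)) / C.sparsity ^ C.diam ≤ C.P C.diam z x := by
    intro z
    refine le_trans ?_ (C.exp_mul_pow_div_factorial_le C.diam (by positivity) hd0 z x)
    have hm := C.hopDist_le_diam z x
    set m := C.hopDist z x
    rw [div_eq_mul_inv]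
    refine mul_le_mul_of_nonneg_left ?_ (Real.exp_nonneg _)
    rw [inv_eq_one_div]
    have h2 : (1 : ℝ) ≤ (C.diam : ℝ) ^ m / m.factorial := by
      rw [one_le_div (by positivity)]
      calc (m.factorial : ℝ) ≤ (m : ℝ) ^ m := by exact_mod_cast Nat.factorial_le_pow m
        _ ≤ (C.diam : ℝ) ^ m := by
          refine pow_le_pow_left₀ (by positivity) ?_ m
          exact_mod_cast hm
    have h3 : C.sparsity ^ m ≤ C.sparsity ^ C.diam := pow_le_pow_right₀ hd hm
    exact div_le_div₀ (by positivity) h2 (by positivity) h3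
  have h2 : Real.exp (-(C.diam : ℝ)) / C.sparsity ^ C.diam ≤ C.π x := by
    rw [← C.pi_P C.diam x]
    calc Real.exp (-(C.diam : ℝ)) / C.sparsity ^ C.diam
        = ∑ z, C.π z * (Real.exp (-(C.diam : ℝ)) / C.sparsity ^ C.diam) := by
          rw [← Finset.sum_mul, C.π_sum, one_mul]
      _ ≤ _ := Finset.sum_le_sum fun z _ => mul_le_mul_of_nonneg_left (h1 z) (C.π_nonneg z)
  have h3 := Real.log_le_log (by positivity) h2
  rw [Real.log_div (Real.exp_pos _).ne' (by positivity), Real.log_exp, Real.log_pow] at h3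
  linarith

/-- Concentration at scale `1 / α` and the lower bound on the stationary law force the diameter to
be at most `1 / α` times a power of the sparsity parameter. -/
lemma log_mlsConst_mul_diam_le (hW : C.WeaklyReversible) (hd : 2 ≤ C.sparsity) :
    Real.log (C.mlsConst * C.diam) ≤ 22 * Real.log C.sparsity := by
  have := C.nontrivial_of_two_le_sparsity hd
  have hα := C.mlsConst_pos
  have hD : (1 : ℝ) ≤ C.diam := by exact_mod_cast C.one_le_diam
  have hln2 := Real.log_two_gt_d9
  have hlog : Real.log 2 ≤ Real.log C.sparsity := Real.log_le_log two_pos hd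
  set δ := Real.log C.sparsity with hδ
  obtain ⟨x, y, hxy⟩ := C.exists_hopDist_eq_diam
  -- tilting by this much beats the lower bound on the stationary law
  set l : ℝ := 4 * (1 + δ) with hl
  have hl0 : 0 < l := by linarith
  have hA := C.log_mean_exp_le (g := fun z => (C.hopDist x z : ℝ))
    (fun z w h => C.abs_hopDist_sub_le_one hW x h) hl0
  have hB := C.log_mean_exp_le (g := fun z => -(C.hopDist x z : ℝ))
    (fun z w h => by
      rw [neg_sub_neg, abs_sub_comm]
      exact C.abs_hopDist_sub_le_one hW x h) hl0
  have hA1 : Real.log (C.π y) + l * C.diam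
      ≤ Real.log (C.mean fun z => Real.exp (l * (C.hopDist x z : ℝ))) := by
    have h1 := C.pi_mul_le_mean (f := fun z => Real.exp (l * (C.hopDist x z : ℝ)))
      (fun z => Real.exp_nonneg _) y
    rw [← hxy, ← Real.log_exp (l * (C.hopDist x y : ℝ)),
      ← Real.log_mul (C.pi_pos y).ne' (Real.exp_pos _).ne']
    exact Real.log_le_log (mul_pos (C.pi_pos y) (Real.exp_pos _)) h1
  have hB1 : Real.log (C.π x)
      ≤ Real.log (C.mean fun z => Real.exp (l * -(C.hopDist x z : ℝ))) := by
    have h1 := C.pi_mul_le_mean (f := fun z => Real.exp (l * -(C.hopDist x z : ℝ)))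
      (fun z => Real.exp_nonneg _) x
    simp only [hopDist_self, Nat.cast_zero, neg_zero, mul_zero, Real.exp_zero, mul_one] at h1
    exact Real.log_le_log (C.pi_pos x) h1
  have hneg : C.mean (fun z => -(C.hopDist x z : ℝ)) = -C.mean (fun z => (C.hopDist x z : ℝ)) := by
    simp only [mean, mul_neg, Finset.sum_neg_distrib]
  rw [hneg] at hB
  have hx := C.neg_log_pi_le (by linarith) x
  have hy := C.neg_log_pi_le (by linarith) y
  rw [← hδ] at hx hy
  have h1 : l / 2 * C.diam ≤ 2 * (l ^ 2 * Real.exp l / C.mlsConst) := by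
    have : (C.diam : ℝ) * (1 + δ) = l / 4 * C.diam := by rw [hl]; ring
    linarith
  have h2 : C.mlsConst * C.diam ≤ 4 * (l * Real.exp l) := by
    have h3 : l / 2 * (C.mlsConst * C.diam) ≤ l / 2 * (4 * (l * Real.exp l)) := by
      have h4 := mul_le_mul_of_nonneg_left h1 hα.le
      have h5 : C.mlsConst * (2 * (l ^ 2 * Real.exp l / C.mlsConst)) = 2 * (l ^ 2 * Real.exp l) := by
        field_simp
      linarith
    exact le_of_mul_le_mul_left h3 (by positivity)
  have h3 : l ≤ Real.exp l := by linarith [Real.add_one_le_exp l]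
  have h4 : C.mlsConst * C.diam ≤ 2 ^ 2 * Real.exp (2 * l) := by
    have h5 : Real.exp (2 * l) = Real.exp l * Real.exp l := by rw [two_mul, Real.exp_add]
    rw [h5]
    nlinarith [Real.exp_pos l]
  have h5 := Real.log_le_log (by positivity) h4
  rw [Real.log_mul (by norm_num) (Real.exp_pos _).ne', Real.log_exp, Real.log_pow] at h5
  push_cast at h5
  refine h5.trans ?_
  rw [hl]
  linarith

/-! ### Mixing times from below -/

/-- The chain moves at unit speed. -/
lemma P_mulVec_hopDist_le (x : X) {t : ℝ} (ht : 0 ≤ t) :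
    (C.P t).mulVec (fun z => (C.hopDist x z : ℝ)) x ≤ t := by
  set g : X → ℝ := fun z => (C.hopDist x z : ℝ) with hg
  have hL : ∀ z, C.L.mulVec g z ≤ 1 := by
    intro z
    rw [L_mulVec, ← C.T_row_sum z]
    refine Finset.sum_le_sum fun w _ => ?_
    rcases (C.T_nonneg z w).eq_or_lt with h | h
    · rw [← h]; simp
    · refine mul_le_of_le_one_right h.le ?_
      have : (C.hopDist x w : ℝ) ≤ C.hopDist x z + 1 := by exact_mod_cast C.hopDist_le_succ h
      simp only [hg]
      linarith
  have hd : ∀ s, HasDerivAt (fun s => (C.P s).mulVec g x)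
      ((C.P s).mulVec (fun y => C.L.mulVec g y + 0) x) s := fun s =>
    C.hasDerivAt_P_mulVec_path (q := fun _ => g) (q' := fun _ => 0)
      (fun y => hasDerivAt_const s (g y)) x
  have h := Convex.image_sub_le_mul_sub_of_deriv_le (convex_Icc 0 t)
    (fun s _ => (hd s).continuousAt.continuousWithinAt)
    (fun s _ => (hd s).differentiableAt.differentiableWithinAt) (C := 1) (fun s hs => by
      rw [interior_Icc] at hs
      rw [(hd s).deriv]
      refine (C.mulVec_P_mono hs.1.le (g := fun _ => 1)
        (fun y => by rw [add_zero]; exact hL y) x).trans (le_of_eq ?_)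
      simp [Matrix.mulVec, dotProduct, C.P_row_sum])
    0 (Set.left_mem_Icc.2 ht) t (Set.right_mem_Icc.2 ht) ht
  have h0 : g x = 0 := by simp only [hg, hopDist_self, Nat.cast_zero]
  rw [P_zero, Matrix.one_mulVec, h0] at h
  linarith

lemma tv_density_dirac (x : X) (t : ℝ) :
    C.tv (C.density (C.dirac x) t) = (1 / 2) * ∑ z, |C.P t x z - C.π z| := by
  rw [tv, mean]
  congr 1
  refine Finset.sum_congr rfl fun z _ => ?_
  have := C.pi_pos z
  rw [density_dirac, ← abs_of_pos this, ← abs_mul, abs_of_pos this]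
  congr 1
  field_simp

/-- If the laws of the chains started from two antipodal points overlap, then the chains have had
the time to cover half of the diameter. -/
lemma diam_mul_le (hW : C.WeaklyReversible) {t ε : ℝ} (ht : 0 ≤ t)
    (h : ∀ x, C.tv (C.density (C.dirac x) t) ≤ ε) : C.diam * (1 - 2 * ε) ≤ 2 * t := by
  obtain ⟨x, y, hxy⟩ := C.exists_hopDist_eq_diam
  have hx := h x
  have hy := h y
  rw [tv_density_dirac] at hx hy
  have h1 : ∑ z, |C.P t x z - C.P t y z| ≤ 4 * ε := by
    calc ∑ z, |C.P t x z - C.P t y z|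
        ≤ ∑ z, (|C.P t x z - C.π z| + |C.P t y z - C.π z|) := by
          refine Finset.sum_le_sum fun z _ => ?_
          rw [abs_sub_comm (C.P t y z)]
          exact abs_sub_le _ _ _
      _ ≤ 4 * ε := by rw [Finset.sum_add_distrib]; linarith
  have h2 : ∀ z, C.diam * (C.P t x z + C.P t y z - |C.P t x z - C.P t y z|)
      ≤ 2 * (C.P t x z * C.hopDist x z + C.P t y z * C.hopDist y z) := by
    intro z
    have h3 : (C.diam : ℝ) ≤ C.hopDist x z + C.hopDist y z := by
      rw [← hxy, C.hopDist_comm hW y z]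
      exact_mod_cast C.hopDist_triangle x z y
    have h4 : (0 : ℝ) ≤ C.hopDist x z := by positivity
    have h5 : (0 : ℝ) ≤ C.hopDist y z := by positivity
    have h6 := C.P_nonneg ht x z
    have h7 := C.P_nonneg ht y z
    rcases le_total (C.P t x z) (C.P t y z) with h8 | h8
    · rw [abs_of_nonpos (by linarith)]
      nlinarith
    · rw [abs_of_nonneg (by linarith)]
      nlinarith
  have h3 := Finset.sum_le_sum fun z (_ : z ∈ Finset.univ) => h2 z
  rw [← Finset.mul_sum, ← Finset.mul_sum, Finset.sum_sub_distrib, Finset.sum_add_distrib,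
    Finset.sum_add_distrib, C.P_row_sum, C.P_row_sum] at h3
  have h4 := C.P_mulVec_hopDist_le x ht
  have h5 := C.P_mulVec_hopDist_le y ht
  simp only [Matrix.mulVec, dotProduct] at h4 h5
  have h6 : (C.diam : ℝ) * (2 - 4 * ε)
      ≤ C.diam * (1 + 1 - ∑ z, |C.P t x z - C.P t y z|) :=
    mul_le_mul_of_nonneg_left (by linarith) (by positivity)
  linarith

/-! ### Mixing times -/

lemma ent_nonneg {f : X → ℝ} (hf : ∀ x, 0 ≤ f x) (hm : C.mean f = 1) : 0 ≤ C.ent f :=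
  (sq_nonneg _).trans (C.tv_sq_le_ent hf hm)

lemma exists_tv_density_le {f : X → ℝ} (hf : ∀ x, 0 ≤ f x) (hm : C.mean f = 1) {ε : ℝ}
    (hε : 0 < ε) : ∃ t, 0 ≤ t ∧ C.tv (C.density f t) ≤ ε := by
  obtain ⟨γ, hγ, h⟩ := C.exists_pos_poincare
  have hE := C.ent_nonneg hf hm
  refine ⟨max 0 (((C.ent f + 1) / ε + Real.log (1 / ε)) / γ), le_max_left _ _,
    C.tv_density_le_of_ent h hf hm hE hε (le_max_left _ _) ?_⟩
  have h1 := mul_le_mul_of_nonneg_left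
    (le_max_right 0 (((C.ent f + 1) / ε + Real.log (1 / ε)) / γ)) hγ.le
  rwa [mul_div_cancel₀ _ hγ.ne'] at h1

lemma tmixFrom_nonneg (f : X → ℝ) (ε : ℝ) : 0 ≤ C.tmixFrom f ε :=
  Real.sInf_nonneg fun _ ht => ht.1

lemma tmixFrom_le {f : X → ℝ} {ε t : ℝ} (ht : 0 ≤ t) (h : C.tv (C.density f t) ≤ ε) :
    C.tmixFrom f ε ≤ t :=
  csInf_le ⟨0, fun _ hs => hs.1⟩ ⟨ht, h⟩

lemma tv_density_tmixFrom_le {f : X → ℝ} (hf : ∀ x, 0 ≤ f x) (hm : C.mean f = 1) {ε : ℝ}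
    (hε : 0 < ε) : C.tv (C.density f (C.tmixFrom f ε)) ≤ ε := by
  have hclosed : IsClosed {t : ℝ | 0 ≤ t ∧ C.tv (C.density f t) ≤ ε} :=
    (isClosed_le continuous_const continuous_id).inter
      (isClosed_le (C.continuous_tv f) continuous_const)
  exact (hclosed.csInf_mem (C.exists_tv_density_le hf hm hε) ⟨0, fun _ hs => hs.1⟩).2

lemma tv_density_le_of_tmixFrom_le {f : X → ℝ} (hf : ∀ x, 0 ≤ f x) (hm : C.mean f = 1) {ε t : ℝ}
    (hε : 0 < ε) (ht : C.tmixFrom f ε ≤ t) : C.tv (C.density f t) ≤ ε :=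
  (C.tv_density_antitone f ht).trans (C.tv_density_tmixFrom_le hf hm hε)

lemma tmixFrom_antitone {f : X → ℝ} (hf : ∀ x, 0 ≤ f x) (hm : C.mean f = 1) {ε δ : ℝ}
    (hε : 0 < ε) (h : ε ≤ δ) : C.tmixFrom f δ ≤ C.tmixFrom f ε :=
  C.tmixFrom_le (C.tmixFrom_nonneg f ε) ((C.tv_density_tmixFrom_le hf hm hε).trans h)

lemma worstTV_le_iff {t ε : ℝ} :
    C.worstTV t ≤ ε ↔ ∀ x, C.tv (C.density (C.dirac x) t) ≤ ε := by
  have := C.nonempty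
  exact ciSup_le_iff (Set.finite_range _).bddAbove

lemma tmix_nonneg (ε : ℝ) : 0 ≤ C.tmix ε := Real.sInf_nonneg fun _ ht => ht.1

/-- The worst-case mixing time is attained from some starting point. -/
lemma exists_tmix_eq {ε : ℝ} (hε : 0 < ε) :
    ∃ x, C.tmix ε = C.tmixFrom (C.dirac x) ε ∧
      ∀ y, C.tmixFrom (C.dirac y) ε ≤ C.tmixFrom (C.dirac x) ε := by
  have := C.nonempty
  obtain ⟨x, hx⟩ := Finite.exists_max fun y => C.tmixFrom (C.dirac y) ε
  have hmem : C.tmixFrom (C.dirac x) ε ∈ {t : ℝ | 0 ≤ t ∧ C.worstTV t ≤ ε} :=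
    ⟨C.tmixFrom_nonneg _ _, C.worstTV_le_iff.2 fun y =>
      C.tv_density_le_of_tmixFrom_le (C.dirac_nonneg y) (C.mean_dirac y) hε (hx y)⟩
  refine ⟨x, le_antisymm (csInf_le ⟨0, fun _ hs => hs.1⟩ hmem) ?_, hx⟩
  exact le_csInf ⟨_, hmem⟩ fun t ht => C.tmixFrom_le ht.1 (C.worstTV_le_iff.1 ht.2 x)

lemma tmixFrom_le_tmix {ε : ℝ} (hε : 0 < ε) (x : X) : C.tmixFrom (C.dirac x) ε ≤ C.tmix ε := by
  obtain ⟨z, hz, h⟩ := C.exists_tmix_eq hε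
  rw [hz]
  exact h x

lemma tmix_antitone {ε δ : ℝ} (hε : 0 < ε) (h : ε ≤ δ) : C.tmix δ ≤ C.tmix ε := by
  obtain ⟨x, hx, -⟩ := C.exists_tmix_eq (hε.trans_le h)
  rw [hx]
  exact (C.tmixFrom_antitone (C.dirac_nonneg x) (C.mean_dirac x) hε h).trans
    (C.tmixFrom_le_tmix hε x)

lemma tmix_le {ε t : ℝ} (ht : 0 ≤ t) (h : ∀ x, C.tv (C.density (C.dirac x) t) ≤ ε) :
    C.tmix ε ≤ t :=
  csInf_le ⟨0, fun _ hs => hs.1⟩ ⟨ht, C.worstTV_le_iff.2 h⟩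

lemma tv_density_tmix_le {ε : ℝ} (hε : 0 < ε) (x : X) :
    C.tv (C.density (C.dirac x) (C.tmix ε)) ≤ ε :=
  C.tv_density_le_of_tmixFrom_le (C.dirac_nonneg x) (C.mean_dirac x) hε (C.tmixFrom_le_tmix hε x)

lemma wmix_le_wmixFrom {ε : ℝ} (hε : 0 < ε) (hε1 : ε < 1) :
    ∃ x, C.tmix ε = C.tmixFrom (C.dirac x) ε ∧ C.wmix ε ≤ C.wmixFrom (C.dirac x) ε := by
  obtain ⟨x, hx, -⟩ := C.exists_tmix_eq hε
  refine ⟨x, hx, ?_⟩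
  have := C.tmixFrom_le_tmix (sub_pos.2 hε1) x
  rw [wmix, wmixFrom, hx]
  linarith

/-! ### Submultiplicativity of the worst-case distance -/

lemma tv_density_le_mul {W t : ℝ} (hW : ∀ x, C.tv (C.density (C.dirac x) t) ≤ W) {f : X → ℝ}
    (hm : C.mean f = 1) : C.tv (C.density f t) ≤ 2 * W * C.tv f := by
  have h1 : ∀ y, C.π y * |C.density f t y - 1|
      ≤ ∑ x, C.π x * |f x - 1| * |C.P t x y - C.π y| := by
    intro y
    have h2 : C.π y * (C.density f t y - 1) = ∑ x, C.π x * (f x - 1) * (C.P t x y - C.π y) := by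
      have h3 : ∑ x, C.π x * (f x - 1) * C.π y = 0 := by
        rw [← Finset.sum_mul]
        have : C.mean (fun x => f x - 1) = 0 := by rw [mean_sub, hm, mean_const, sub_self]
        rw [mean] at this
        rw [this, zero_mul]
      simp only [mul_sub _ (C.P t _ _), Finset.sum_sub_distrib]
      rw [h3, sub_zero, mul_sub, mul_one, density_apply, Finset.mul_sum]
      simp only [mul_sub, sub_mul, mul_one, Finset.sum_sub_distrib, C.pi_P]
      congr 1
      refine Finset.sum_congr rfl fun x _ => ?_
      have := (C.pi_pos y).ne'
      field_simp
    rw [← abs_of_pos (C.pi_pos y), ← abs_mul, abs_of_pos (C.pi_pos y), h2]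
    refine (Finset.abs_sum_le_sum_abs _ _).trans (le_of_eq ?_)
    refine Finset.sum_congr rfl fun x _ => ?_
    rw [abs_mul, abs_mul, abs_of_pos (C.pi_pos x)]
  have h2 : C.mean (fun y => |C.density f t y - 1|)
      ≤ ∑ x, C.π x * |f x - 1| * ∑ y, |C.P t x y - C.π y| := by
    refine (Finset.sum_le_sum fun y _ => h1 y).trans (le_of_eq ?_)
    rw [Finset.sum_comm]
    simp only [Finset.mul_sum]
  have h3 : ∑ x, C.π x * |f x - 1| * ∑ y, |C.P t x y - C.π y|
      ≤ ∑ x, C.π x * |f x - 1| * (2 * W) := by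
    refine Finset.sum_le_sum fun x _ => mul_le_mul_of_nonneg_left ?_
      (mul_nonneg (C.π_nonneg x) (abs_nonneg _))
    have := hW x
    rw [tv_density_dirac] at this
    linarith
  rw [← Finset.sum_mul] at h3
  have h4 : ∑ x, C.π x * |f x - 1| = C.mean (fun x => |f x - 1|) := rfl
  rw [h4] at h3
  rw [tv, tv]
  linarith

lemma tv_le_one {f : X → ℝ} (hf : ∀ x, 0 ≤ f x) (hm : C.mean f = 1) : C.tv f ≤ 1 := by
  have h1 : ∀ x, |f x - 1| ≤ f x + 1 := fun x => by
    have := hf x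
    rw [abs_le]; constructor <;> linarith
  have h2 := C.mean_mono h1
  rw [mean_add, mean_const, hm] at h2
  rw [tv]
  linarith

lemma tv_density_nsmul_le {W t : ℝ} (hW : ∀ x, C.tv (C.density (C.dirac x) t) ≤ W)
    {f : X → ℝ} (hf : ∀ x, 0 ≤ f x) (hm : C.mean f = 1) (k : ℕ) :
    C.tv (C.density f (k * t)) ≤ (2 * W) ^ k := by
  obtain ⟨z⟩ := C.nonempty
  have hW0 : 0 ≤ W := (C.tv_nonneg _).trans (hW z)
  induction k with
  | zero =>
    rw [Nat.cast_zero, zero_mul, density_zero, pow_zero]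
    exact C.tv_le_one hf hm
  | succ k ih =>
    have h1 := C.tv_density_le_mul hW (f := C.density f (k * t)) (by rw [mean_density, hm])
    rw [← density_add] at h1
    rw [Nat.cast_succ, add_mul, one_mul, pow_succ']
    exact h1.trans (mul_le_mul_of_nonneg_left ih (by positivity))

/-- All worst-case mixing times are at most a multiple of the default one. -/
lemma tmix_le_mul_tmixDefault {ε : ℝ} {N : ℕ} (hN : Real.exp (-N) ≤ ε) :
    C.tmix ε ≤ N * C.tmixDefault := by
  have h0 := C.tmix_nonneg (1 / (2 * Real.exp 1))
  refine C.tmix_le (mul_nonneg (by positivity) h0) fun x => ?_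
  have h1 := C.tv_density_nsmul_le 
    (fun y => C.tv_density_tmix_le (ε := 1 / (2 * Real.exp 1)) (by positivity) y)
    (C.dirac_nonneg x) (C.mean_dirac x) N
  refine h1.trans (le_trans (le_of_eq ?_) hN)
  have h2 : 2 * (1 / (2 * Real.exp 1)) = Real.exp (-1) := by
    rw [Real.exp_neg]; field_simp
  rw [h2, ← Real.exp_nat_mul]
  congr 1
  ring

/-! ### Collapse of the entropy inside the mixing window -/

/-- Beyond the time at which the distance to equilibrium leaves the vicinity of one, the
differential inequality brings the entropy down at a speed which does not depend on its initial
value. -/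
lemma ent_density_le_of_tmixFrom_lt {f : X → ℝ} (hf : ∀ x, 0 ≤ f x) (hm : C.mean f = 1)
    {ψ : ℝ → ℝ} (hψ : C.SatisfiesIDI f ψ) {ε : ℝ} (hε : 0 < ε) (hε1 : ε < 1) {s Ψ : ℝ}
    (hs : C.tmixFrom f (1 - ε) < s) (hΨ0 : 0 < Ψ) (hΨ : ∀ r, 0 < r → r < s → ψ r ≤ Ψ) :
    C.ent (C.density f s) ≤ max (max 1 (2 * Real.log (2 / ε)))
      (8 * Ψ / (ε * (s - C.tmixFrom f (1 - ε)))) := by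
  set a := C.tmixFrom f (1 - ε) with ha
  have ha0 : 0 ≤ a := C.tmixFrom_nonneg _ _
  have hc : 0 < ε / (8 * Ψ) := by positivity
  have hdr : ∀ r, 0 < r → deriv (fun r => C.ent (C.density f r)) r ≤ 0 := by
    intro r hr
    have hpos := C.density_pos hf hm hr
    rw [(C.hasDerivAt_ent hf hm hr).deriv]
    have h1 := C.two_mul_dirichletForm_sqrt_le hpos
    have h2 := C.dirichletForm_self_nonneg (fun y => √(C.density f r y))
    linarith
  have h := le_of_deriv_le_neg_sq (E := fun r => C.ent (C.density f r)) (a := a) (s := s)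
    (c := ε / (8 * Ψ)) (e₀ := max 1 (2 * Real.log (2 / ε))) hs hc
    (lt_of_lt_of_le one_pos (le_max_left _ _)) (C.continuous_ent f)
    (fun r hr => (hψ r (ha0.trans_lt hr.1)).2.1) (fun r hr => hdr r (ha0.trans_lt hr.1)) ?_
  · refine h.trans (le_of_eq ?_)
    congr 1
    field_simp
  · intro r hr hE
    have hr0 : 0 < r := ha0.trans_lt hr.1
    obtain ⟨-, -, h1⟩ := hψ r hr0
    have h2 := C.ent_sq_le_varent (C.density_nonneg hf hr0.le) (by rw [mean_density, hm]) hε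
      (C.tv_density_le_of_tmixFrom_le hf hm (sub_pos.2 hε1) hr.1.le)
      (one_pos.trans_le ((le_max_left _ _).trans hE)) ((le_max_right _ _).trans hE)
    have h3 := mul_le_mul_of_nonneg_right (hΨ r hr0 hr.2) (neg_nonneg.2 (hdr r hr0))
    rw [div_mul_eq_mul_div, div_le_iff₀ (by positivity)]
    linarith

/-- The rate of the differential inequality is essentially increasing in time. -/
lemma rate_le {δ D s t : ℝ} (hδ : Real.log 2 ≤ δ) (hs : 0 < s) (hst : s ≤ t) :
    16 * s * δ + 4 * s * Real.posLog (D / s) ≤ t * (22 * δ + 4 * Real.posLog (D / t)) := by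
  have ht : 0 < t := hs.trans_le hst
  have hln2 := Real.log_two_gt_d9
  have h1 : D / s = D / t * (t / s) := by field_simp
  have h2 : Real.posLog (D / s) ≤ Real.posLog (D / t) + Real.posLog (t / s) := by
    rw [h1]; exact Real.posLog_mul
  have h3 : Real.posLog (t / s) ≤ t / s - 1 := by
    have h4 : 1 ≤ t / s := (one_le_div hs).2 hst
    rw [Real.posLog_eq_log (h4.trans (le_abs_self _))]
    exact Real.log_le_sub_one_of_pos (by positivity)
  have h4 : s * (t / s - 1) = t - s := by field_simp
  have h5 := Real.posLog_nonneg (x := D / t)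
  have h6 : s * Real.posLog (D / s) ≤ s * Real.posLog (D / t) + (t - s) := by
    rw [← h4, ← mul_add]
    exact mul_le_mul_of_nonneg_left (by linarith) hs.le
  have h7 : s * Real.posLog (D / t) ≤ t * Real.posLog (D / t) :=
    mul_le_mul_of_nonneg_right hst h5
  have h8 : s * δ ≤ t * δ := mul_le_mul_of_nonneg_right hst (by linarith)
  nlinarith

lemma ent_density_dirac_le (hW : C.WeaklyReversible) (hρ : 0 ≤ C.curvature) (hd : 2 ≤ C.sparsity)
    (x : X) {ε : ℝ} (hε : 0 < ε) (hε1 : ε < 1) {s : ℝ}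
    (hs : C.tmixFrom (C.dirac x) (1 - ε) < s) (hs1 : s ≤ C.tmixFrom (C.dirac x) ε) :
    C.ent (C.density (C.dirac x) s) ≤ max (max 1 (2 * Real.log (2 / ε)))
      (8 * (C.tmixFrom (C.dirac x) ε * (22 * Real.log C.sparsity
          + 4 * Real.posLog (C.diam / C.tmixFrom (C.dirac x) ε)))
        / (ε * (s - C.tmixFrom (C.dirac x) (1 - ε)))) := by
  have hlog : Real.log 2 ≤ Real.log C.sparsity := Real.log_le_log two_pos hd
  have hln2 := Real.log_two_gt_d9
  have hpl := Real.posLog_nonneg (x := C.diam / C.tmixFrom (C.dirac x) ε)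
  refine C.ent_density_le_of_tmixFrom_lt (C.dirac_nonneg x) (C.mean_dirac x)
    (C.satisfiesIDI_dirac hW hρ hd x) hε hε1 hs ?_ fun r hr hrs =>
      rate_le hlog hr (hrs.le.trans hs1)
  exact mul_pos (((C.tmixFrom_nonneg _ _).trans_lt hs).trans_le hs1) (by linarith)

end

/-! ### Width of the mixing window -/

/-- Resolution of the implicit inequality for the width, which balances the time `w` left for the
entropy to collapse against the relaxation time needed afterwards. -/
lemma width_le_of_implicit {A B γ w t δ L : ℝ} (hA : 0 ≤ A) (hB : 0 ≤ B) (hγ : 0 < γ) (hw : 0 < w)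
    (h : γ * w ≤ 2 * A + 2 * (B * (t * (22 * δ + 4 * L)) / w)) :
    w ≤ (4 * A + √(104 * B)) * max (1 / γ) (max √(t * δ / γ) √(t / γ * L)) := by
  set m := max (1 / γ) (max √(t * δ / γ) √(t / γ * L)) with hm
  have hm1 : 1 / γ ≤ m := le_max_left _ _
  have hm0 : 0 < m := (one_div_pos.2 hγ).trans_le hm1
  have hm2 : t * δ / γ ≤ m ^ 2 := by
    rw [← Real.sqrt_le_left hm0.le]
    exact (le_max_left _ _).trans (le_max_right _ _)
  have hm3 : t / γ * L ≤ m ^ 2 := by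
    rw [← Real.sqrt_le_left hm0.le]
    exact (le_max_right _ _).trans (le_max_right _ _)
  rw [div_le_iff₀ hγ] at hm1 hm2
  rw [div_mul_eq_mul_div, div_le_iff₀ hγ] at hm3
  by_contra! hlt
  have hsq := Real.sqrt_nonneg (104 * B)
  have h1 : 4 * A * m ≤ w := by linarith [mul_nonneg hsq hm0.le]
  have h2 : √(104 * B) * m < w := by linarith [mul_nonneg hA hm0.le]
  have h3 : 104 * B * m ^ 2 < w ^ 2 := by
    have h4 : (√(104 * B) * m) ^ 2 < w ^ 2 := by
      have : 0 ≤ √(104 * B) * m := by positivity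
      exact pow_lt_pow_left₀ h2 this two_ne_zero
    rwa [mul_pow, Real.sq_sqrt (by positivity)] at h4
  have h5 : 2 * A ≤ γ * w / 2 := by
    linarith [mul_le_mul_of_nonneg_left hm1 hA, mul_le_mul_of_nonneg_left h1 hγ.le]
  have h6 : 2 * (B * (t * (22 * δ + 4 * L)) / w) < γ * w / 2 := by
    have h7 : t * (22 * δ + 4 * L) ≤ 26 * (m ^ 2 * γ) := by linarith
    have h8 : B * (t * (22 * δ + 4 * L)) ≤ B * (26 * (m ^ 2 * γ)) :=
      mul_le_mul_of_nonneg_left h7 hB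
    have h9 := mul_lt_mul_of_pos_left h3 hγ
    rw [mul_div_assoc', div_lt_iff₀ hw]
    linarith
  linarith

/-- The window is split in two halves. The differential inequality makes the entropy collapse in
the first one, to a level of order `Ψ / w`; the spectral gap takes over in the second one, whose
length is therefore at most of order `(1 + Ψ / w) / γ`. -/
lemma exists_wmixFrom_le_poincare {ε : ℝ} (hε : 0 < ε) (hε1 : ε < 1) :
    ∃ c : ℝ, 0 < c ∧ ∀ (X : Type u) [Fintype X] [DecidableEq X] (C : FiniteMarkovChain X),
      C.WeaklyReversible → 0 ≤ C.curvature → 2 ≤ C.sparsity → ∀ x : X,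
        C.wmixFrom (C.dirac x) ε ≤ c * max (1 / C.poincareConst)
          (max
            √(C.tmixFrom (C.dirac x) ε * Real.log C.sparsity / C.poincareConst)
            √(C.tmixFrom (C.dirac x) ε / C.poincareConst *
              Real.posLog (C.diam / C.tmixFrom (C.dirac x) ε))) := by
  set e₀ : ℝ := max 1 (2 * Real.log (2 / ε)) with he₀
  have he₀1 : 1 ≤ e₀ := le_max_left _ _
  have hlogε : 0 ≤ Real.log (1 / ε) := Real.log_nonneg ((one_le_div hε).2 hε1.le)
  set A : ℝ := (e₀ + 1) / ε + Real.log (1 / ε) with hA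
  have hA0 : 0 < A := by positivity
  refine ⟨4 * A + √(104 * (16 / ε ^ 2)), by positivity, ?_⟩
  intro X _ _ C hW hρ hd x
  have := C.nontrivial_of_two_le_sparsity hd
  have hγ := C.poincareConst_pos
  have hδ : 0 ≤ Real.log C.sparsity := Real.log_nonneg (by linarith)
  set L := Real.posLog (C.diam / C.tmixFrom (C.dirac x) ε) with hL
  have hL0 : 0 ≤ L := Real.posLog_nonneg
  rcases le_or_gt (C.wmixFrom (C.dirac x) ε) 0 with hw | hw
  · exact hw.trans (by positivity)
  set t₁ := C.tmixFrom (C.dirac x) ε with ht₁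
  set t₀ := C.tmixFrom (C.dirac x) (1 - ε) with ht₀
  set w := C.wmixFrom (C.dirac x) ε with hwdef
  have hw' : w = t₁ - t₀ := rfl
  have ht₁0 : 0 ≤ t₁ := C.tmixFrom_nonneg _ _
  have ht₀0 : 0 ≤ t₀ := C.tmixFrom_nonneg _ _
  refine width_le_of_implicit hA0.le (by positivity) hγ hw ?_
  -- the entropy collapses during the first half of the window
  set s := t₀ + w / 2 with hs
  have hent := C.ent_density_dirac_le hW hρ hd x hε hε1 (s := s) (by linarith) (by linarith)
  rw [← he₀, ← ht₁, ← ht₀, ← hL, show s - t₀ = w / 2 by rw [hs]; ring] at hent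
  set E := C.ent (C.density (C.dirac x) s) with hE
  have hs0 : 0 ≤ s := by linarith
  have hf := C.density_nonneg (C.dirac_nonneg x) hs0
  have hm : C.mean (C.density (C.dirac x) s) = 1 := by rw [mean_density, mean_dirac]
  have hE0 : 0 ≤ E := C.ent_nonneg hf hm
  set τ : ℝ := ((E + 1) / ε + Real.log (1 / ε)) / C.poincareConst with hτ
  have hτ0 : 0 ≤ τ := by positivity
  have htv := C.tv_density_le_of_ent C.poincare hf hm hE0 hε hτ0
    (by rw [hτ, mul_div_cancel₀ _ hγ.ne'])
  rw [← density_add] at htv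
  have h1 : t₁ ≤ s + τ := C.tmixFrom_le (by positivity) htv
  have h2 : w / 2 ≤ τ := by linarith
  rw [hτ, le_div_iff₀ hγ] at h2
  set Ψ := t₁ * (22 * Real.log C.sparsity + 4 * L) with hΨ
  have hΨ0 : 0 ≤ Ψ := by positivity
  have h3 : E ≤ e₀ + 16 * Ψ / (ε * w) := by
    have h4 : 8 * Ψ / (ε * (w / 2)) = 16 * Ψ / (ε * w) := by field_simp; ring
    rw [h4] at hent
    exact hent.trans (max_le_add_of_nonneg (by linarith) (by positivity))
  have h5 : (E + 1) / ε ≤ (e₀ + 16 * Ψ / (ε * w) + 1) / ε := by gcongr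
  have h6 : (e₀ + 16 * Ψ / (ε * w) + 1) / ε = (e₀ + 1) / ε + 16 / ε ^ 2 * Ψ / w := by
    field_simp
    ring
  rw [h6] at h5
  rw [hA]
  linarith

/-- After a lapse of time `1 / α` in the window, the differential inequality has brought the entropy
down to order `α Ψ`, and the modified log-Sobolev inequality makes it negligible after a
further time of order `log (α Ψ) / α`. The logarithm of the ratio between the diameter and the
mixing time is absorbed by the bound on the diameter. -/
lemma exists_wmixFrom_le_mls {ε : ℝ} (hε : 0 < ε) (hε1 : ε < 1) :
    ∃ c : ℝ, 0 < c ∧ ∀ (X : Type u) [Fintype X] [DecidableEq X] (C : FiniteMarkovChain X),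
      C.WeaklyReversible → 0 ≤ C.curvature → 2 ≤ C.sparsity → ∀ x : X,
        C.wmixFrom (C.dirac x) ε ≤ c / C.mlsConst *
          max 1 (max (Real.log (Real.log C.sparsity))
            (Real.log (C.mlsConst * C.tmixFrom (C.dirac x) ε))) := by
  set e₀ : ℝ := max 1 (2 * Real.log (2 / ε)) with he₀
  have he₀1 : 1 ≤ e₀ := le_max_left _ _
  set K : ℝ := (2 * e₀ + 880 / ε) / ε ^ 2 with hK
  have hK0 : 0 < K := by positivity
  refine ⟨3 + |Real.log K|, by positivity, ?_⟩
  intro X _ _ C hW hρ hd x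
  have := C.nontrivial_of_two_le_sparsity hd
  have hα := C.mlsConst_pos
  have hln2 := Real.log_two_gt_d9
  have hlog2 : Real.log 2 ≤ Real.log C.sparsity := Real.log_le_log two_pos hd
  have hαD := C.log_mlsConst_mul_diam_le hW hd
  set α := C.mlsConst with hαdef
  set δ := Real.log C.sparsity with hδdef
  have hδ : 0 < δ := by linarith
  set t₁ := C.tmixFrom (C.dirac x) ε with ht₁
  set t₀ := C.tmixFrom (C.dirac x) (1 - ε) with ht₀
  set w := C.wmixFrom (C.dirac x) ε with hwdef
  have hw' : w = t₁ - t₀ := rfl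
  have ht₁0 : 0 ≤ t₁ := C.tmixFrom_nonneg _ _
  have ht₀0 : 0 ≤ t₀ := C.tmixFrom_nonneg _ _
  set m := max 1 (max (Real.log δ) (Real.log (α * t₁))) with hm
  have hm1 : 1 ≤ m := le_max_left _ _
  have hm2 : Real.log δ ≤ m := (le_max_left _ _).trans (le_max_right _ _)
  have hm3 : Real.log (α * t₁) ≤ m := (le_max_right _ _).trans (le_max_right _ _)
  rw [div_mul_eq_mul_div, le_div_iff₀ hα, mul_comm w]
  have hK' := abs_nonneg (Real.log K)
  rcases le_or_gt (α * w) 1 with hw | hw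
  · exact hw.trans (one_le_mul_of_one_le_of_one_le (by linarith) hm1)
  have ha1 : 1 < α * t₁ := by
    rw [hw', mul_sub] at hw
    linarith [mul_nonneg hα.le ht₀0]
  have ht₁pos : 0 < t₁ := pos_of_mul_pos_right (one_pos.trans ha1) hα.le
  -- the entropy collapses during a first lapse of time `1 / α`
  set s := t₀ + 1 / α with hs
  have hαinv : 0 < 1 / α := by positivity
  have hsw : 1 / α < w := by rwa [div_lt_iff₀ hα, mul_comm]
  have hent := C.ent_density_dirac_le hW hρ hd x hε hε1 (s := s) (by linarith) (by linarith)
  rw [← he₀, ← ht₁, ← ht₀, ← hδdef, show s - t₀ = 1 / α by rw [hs]; ring] at hent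
  set L := Real.posLog (C.diam / t₁) with hL
  have hD1 : (1 : ℝ) ≤ C.diam := by exact_mod_cast C.one_le_diam
  have hLle : L ≤ 22 * δ := by
    have h1 : (C.diam : ℝ) / t₁ ≤ α * C.diam := by
      rw [div_le_iff₀ ht₁pos]
      linarith [mul_le_mul_of_nonneg_right ha1.le (zero_le_one.trans hD1)]
    refine (Real.posLog_le_posLog (by positivity) h1).trans ?_
    rw [Real.posLog_apply]
    exact max_le (by positivity) hαD
  set E := C.ent (C.density (C.dirac x) s) with hE
  have hEle : E ≤ K * (α * t₁ * δ) * ε ^ 2 := by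
    have h1 : 8 * (t₁ * (22 * δ + 4 * L)) / (ε * (1 / α))
        = 8 * (α * t₁) * (22 * δ + 4 * L) / ε := by field_simp
    have h2 : 8 * (α * t₁) * (22 * δ + 4 * L) / ε ≤ 880 * (α * t₁ * δ) / ε := by
      have h4 : α * t₁ * L ≤ α * t₁ * (22 * δ) := mul_le_mul_of_nonneg_left hLle (by linarith)
      rw [div_le_div_iff_of_pos_right hε]
      linarith
    have h3 : e₀ ≤ 2 * e₀ * (α * t₁ * δ) := by
      have h4 : δ ≤ α * t₁ * δ := le_mul_of_one_le_left hδ.le ha1.le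
      have h5 : e₀ * 1 ≤ e₀ * (2 * (α * t₁ * δ)) :=
        mul_le_mul_of_nonneg_left (by linarith) (by linarith)
      linarith
    rw [h1] at hent
    calc E ≤ e₀ + 8 * (α * t₁) * (22 * δ + 4 * L) / ε := by
          refine hent.trans (max_le_add_of_nonneg (by linarith) ?_)
          have : 0 ≤ L := Real.posLog_nonneg
          positivity
      _ ≤ 2 * e₀ * (α * t₁ * δ) + 880 * (α * t₁ * δ) / ε := add_le_add h3 h2
      _ = _ := by rw [hK]; field_simp
  have hs0 : 0 ≤ s := by positivity
  have hf := C.density_nonneg (C.dirac_nonneg x) hs0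
  set l : ℝ := max 0 (Real.log (K * (α * t₁ * δ))) with hl
  have hl0 : 0 ≤ l := le_max_left _ _
  have hKaδ : 0 < K * (α * t₁ * δ) := by positivity
  have h1 : t₁ ≤ s + l / α := by
    refine C.tmixFrom_le (by positivity) ?_
    have hst : s ≤ s + l / α := le_add_of_nonneg_right (by positivity)
    have h2 := C.ent_density_le (C.dirac_nonneg x) (C.mean_dirac x) hs0 hst
    have h3 := C.tv_sq_le_ent (f := C.density (C.dirac x) (s + l / α))
      (C.density_nonneg (C.dirac_nonneg x) (hs0.trans hst)) (by rw [mean_density, mean_dirac])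
    have h4 : Real.exp (-α * (s + l / α - s)) * E ≤ ε ^ 2 := by
      have h5 : -α * (s + l / α - s) = -l := by field_simp; ring
      have h6 : K * (α * t₁ * δ) ≤ Real.exp l :=
        (Real.log_le_iff_le_exp hKaδ).1 (le_max_right _ _)
      have h7 : K * (α * t₁ * δ) * ε ^ 2 ≤ Real.exp l * ε ^ 2 :=
        mul_le_mul_of_nonneg_right h6 (sq_nonneg ε)
      rw [h5, Real.exp_neg, inv_mul_eq_div, div_le_iff₀ (Real.exp_pos l), mul_comm (ε ^ 2)]
      exact hEle.trans h7
    exact le_of_sq_le_sq (h3.trans (h2.trans h4)) hε.le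
  have h2 : w ≤ (1 + l) / α := by
    rw [add_div]
    linarith
  rw [le_div_iff₀ hα, mul_comm] at h2
  have h3 : l ≤ |Real.log K| + 2 * m := by
    refine max_le (by linarith) ?_
    rw [Real.log_mul hK0.ne' (by positivity), Real.log_mul (by positivity) hδ.ne']
    linarith [le_abs_self (Real.log K)]
  linarith [le_mul_of_one_le_right hK' hm1]

/-- When mixing from every starting point, the diameter has had to be covered. -/
lemma posLog_diam_div_tmix_le {X : Type u} [Fintype X] [DecidableEq X] (C : FiniteMarkovChain X)
    (hW : C.WeaklyReversible) {ε : ℝ} (hε : 0 < ε) (hε2 : ε < 1 / 2) (ht : 0 < C.tmix ε) :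
    Real.posLog (C.diam / C.tmix ε) ≤ Real.log (2 / (1 - 2 * ε)) := by
  have h0 : 0 < 1 - 2 * ε := by linarith
  have h1 := C.diam_mul_le hW ht.le fun x => C.tv_density_tmix_le hε x
  have h2 : (C.diam : ℝ) / C.tmix ε ≤ 2 / (1 - 2 * ε) := by
    rwa [div_le_div_iff₀ ht h0]
  have h3 : 1 ≤ 2 / (1 - 2 * ε) := by
    rw [one_le_div h0]; linarith
  refine (Real.posLog_le_posLog (by positivity) h2).trans (le_of_eq ?_)
  exact Real.posLog_eq_log (h3.trans (le_abs_self _))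

/-- In the worst case the mixing time is at least of the order of the diameter, so the term
involving their ratio is of order one. -/
lemma exists_wmix_le {ε : ℝ} (hε : 0 < ε) (hε2 : ε < 1 / 2) :
    ∃ c : ℝ, 0 < c ∧ ∀ (X : Type u) [Fintype X] [DecidableEq X] (C : FiniteMarkovChain X),
      C.WeaklyReversible → 0 ≤ C.curvature → 2 ≤ C.sparsity →
      C.wmix ε ≤ c * max (1 / C.poincareConst)
        √(C.tmixDefault * Real.log C.sparsity / C.poincareConst) ∧
      C.wmix ε ≤ c / C.mlsConst *
        max 1 (max (Real.log (Real.log C.sparsity))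
          (Real.log (C.mlsConst * C.tmixDefault))) := by
  have hε1 : ε < 1 := by linarith
  obtain ⟨c₁, hc₁, h₁⟩ := exists_wmixFrom_le_poincare.{u} hε hε1
  obtain ⟨c₂, hc₂, h₂⟩ := exists_wmixFrom_le_mls.{u} hε hε1
  obtain ⟨N, hN⟩ : ∃ N : ℕ, Real.exp (-N) ≤ ε := by
    obtain ⟨N, hN⟩ := exists_nat_ge (-Real.log ε)
    refine ⟨N, ?_⟩
    rw [← Real.le_log_iff_exp_le hε]
    linarith
  have hN1 : 1 ≤ N := by
    rw [Nat.one_le_iff_ne_zero]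
    rintro rfl
    rw [Nat.cast_zero, neg_zero, Real.exp_zero] at hN
    linarith
  have hN1' : (1 : ℝ) ≤ N := by exact_mod_cast hN1
  have hlogN : 0 ≤ Real.log N := Real.log_nonneg hN1'
  have hln2 := Real.log_two_gt_d9
  have hln2' : 0 < Real.log 2 := by linarith
  have h0 : 0 < 1 - 2 * ε := by linarith
  set k : ℝ := 1 + 2 * Real.log (2 / (1 - 2 * ε)) with hk
  have hlogk : 0 ≤ Real.log (2 / (1 - 2 * ε)) :=
    Real.log_nonneg (by rw [one_le_div h0]; linarith)
  have hk1 : 1 ≤ k := by linarith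
  have hkN : 1 ≤ √(k * N) := Real.one_le_sqrt.2 (one_le_mul_of_one_le_of_one_le hk1 hN1')
  refine ⟨max (c₁ * √(k * N)) (c₂ * (1 + Real.log N)), lt_max_of_lt_left (by positivity), ?_⟩
  intro X _ _ C hW hρ hd
  have := C.nontrivial_of_two_le_sparsity hd
  have hγ := C.poincareConst_pos
  have hα := C.mlsConst_pos
  have hlog2 : Real.log 2 ≤ Real.log C.sparsity := Real.log_le_log two_pos hd
  obtain ⟨x, hx, hwx⟩ := C.wmix_le_wmixFrom hε hε1
  set δ := Real.log C.sparsity with hδ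
  have hδ0 : 0 < δ := by linarith
  rcases le_or_gt (C.wmix ε) 0 with hw | hw
  · exact ⟨hw.trans (by positivity), hw.trans (by positivity)⟩
  have ht : 0 < C.tmix ε := by
    have := C.tmix_nonneg (1 - ε)
    rw [wmix] at hw
    linarith
  have hL := C.posLog_diam_div_tmix_le hW hε hε2 ht
  have htN := C.tmix_le_mul_tmixDefault hN
  have hdef : 0 < C.tmixDefault := pos_of_mul_pos_right (ht.trans_le htN) (by positivity)
  have hb₁ := hwx.trans (h₁ X C hW hρ hd x)
  have hb₂ := hwx.trans (h₂ X C hW hρ hd x)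
  rw [← hx, ← hδ] at hb₁ hb₂
  set t₁ := C.tmix ε with ht₁
  set tD := C.tmixDefault with htD
  constructor
  · refine hb₁.trans ?_
    set m := max (1 / C.poincareConst) √(tD * δ / C.poincareConst) with hm
    have hm0 : 0 < m := (one_div_pos.2 hγ).trans_le (le_max_left _ _)
    have hkey : ∀ q : ℝ, q ≤ k * N * (tD * δ / C.poincareConst) → √q ≤ √(k * N) * m := by
      intro q hq
      calc √q ≤ √(k * N * (tD * δ / C.poincareConst)) := Real.sqrt_le_sqrt hq
        _ = √(k * N) * √(tD * δ / C.poincareConst) := Real.sqrt_mul (by positivity) _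
        _ ≤ √(k * N) * m := mul_le_mul_of_nonneg_left (le_max_right _ _) (Real.sqrt_nonneg _)
    have h1 : max (1 / C.poincareConst) (max √(t₁ * δ / C.poincareConst)
        √(t₁ / C.poincareConst * Real.posLog (C.diam / t₁))) ≤ √(k * N) * m := by
      refine max_le ?_ (max_le (hkey _ ?_) (hkey _ ?_))
      · exact (le_max_left _ _).trans (le_mul_of_one_le_left hm0.le hkN)
      · rw [mul_div_assoc', div_le_div_iff_of_pos_right hγ]
        have h2 : t₁ * δ ≤ N * tD * δ := mul_le_mul_of_nonneg_right htN hδ0.le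
        have h3 : N * tD * δ ≤ k * (N * tD * δ) := le_mul_of_one_le_left (by positivity) hk1
        linarith
      · rw [mul_div_assoc', div_mul_eq_mul_div, div_le_div_iff_of_pos_right hγ]
        have h2 : Real.posLog (C.diam / t₁) ≤ k * δ := by
          refine hL.trans ?_
          rw [hk]
          nlinarith
        have h3 : t₁ * Real.posLog (C.diam / t₁) ≤ N * tD * (k * δ) :=
          mul_le_mul htN h2 Real.posLog_nonneg (by positivity)
        linarith
    calc _ ≤ c₁ * (√(k * N) * m) := mul_le_mul_of_nonneg_left h1 hc₁.le
      _ = c₁ * √(k * N) * m := by ring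
      _ ≤ _ := mul_le_mul_of_nonneg_right (le_max_left _ _) hm0.le
  · refine hb₂.trans ?_
    set m := max 1 (max (Real.log δ) (Real.log (C.mlsConst * tD))) with hm
    have hm1 : 1 ≤ m := le_max_left _ _
    have h1 : max 1 (max (Real.log δ) (Real.log (C.mlsConst * t₁))) ≤ (1 + Real.log N) * m := by
      have h2 : m ≤ (1 + Real.log N) * m := le_mul_of_one_le_left (by linarith) (by linarith)
      refine max_le (hm1.trans h2) (max_le ?_ ?_)
      · exact ((le_max_left _ _).trans (le_max_right _ _)).trans h2
      · have h3 : Real.log (C.mlsConst * t₁) ≤ Real.log (N * (C.mlsConst * tD)) := by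
          refine Real.log_le_log (by positivity) ?_
          nlinarith
        rw [Real.log_mul (x := N) (by positivity) (by positivity)] at h3
        have h4 : Real.log (C.mlsConst * tD) ≤ m := (le_max_right _ _).trans (le_max_right _ _)
        nlinarith
    calc _ ≤ c₂ / C.mlsConst * ((1 + Real.log N) * m) :=
          mul_le_mul_of_nonneg_left h1 (by positivity)
      _ = c₂ * (1 + Real.log N) / C.mlsConst * m := by ring
      _ ≤ _ := by
          gcongr
          exact le_max_right _ _

/-! ### Cutoff -/

/-- With at least three states, some row of the transition matrix has two positive entries:
otherwise every row is a Dirac mass, and weak reversibility confines the chain to two states. -/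
lemma two_le_sparsity {X : Type u} [Fintype X] [DecidableEq X] (C : FiniteMarkovChain X)
    (hW : C.WeaklyReversible) (hcard : 3 ≤ Fintype.card X) : 2 ≤ C.sparsity := by
  by_contra! hlt
  have hhalf : ∀ x y, 0 < C.T x y → 1 / 2 < C.T x y := fun x y h => by
    have h1 := (C.one_div_le_sparsity h).trans_lt hlt
    rw [div_lt_iff₀ h] at h1
    linarith
  have huniq : ∀ x y z, 0 < C.T x y → 0 < C.T x z → y = z := by
    intro x y z hy hz
    by_contra hne
    have h1 := hhalf x y hy
    have h2 := hhalf x z hz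
    have h3 : ∑ w ∈ ({y, z} : Finset X), C.T x w ≤ ∑ w, C.T x w :=
      Finset.sum_le_sum_of_subset_of_nonneg (Finset.subset_univ _) fun w _ _ => C.T_nonneg x w
    rw [Finset.sum_pair hne, C.T_row_sum] at h3
    linarith
  obtain ⟨x⟩ := C.nonempty
  obtain ⟨y, hy⟩ : ∃ y, 0 < C.T x y := by
    by_contra! h
    have := Finset.sum_nonpos fun y (_ : y ∈ Finset.univ) => h y
    rw [C.T_row_sum] at this
    linarith
  have key : ∀ (k : ℕ) (z : X), 0 < (C.T ^ k) x z → z = x ∨ z = y := by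
    intro k
    induction k with
    | zero =>
      intro z h
      left
      by_contra hne
      simp [Matrix.one_apply_ne (Ne.symm hne)] at h
    | succ k ih =>
      intro z h
      obtain ⟨w, h1, h2⟩ := (C.pow_succ_pos_iff k x z).1 h
      rcases ih w h1 with rfl | rfl
      · exact Or.inr (huniq _ _ _ h2 hy)
      · exact Or.inl (huniq _ _ _ h2 (hW _ _ hy))
  have h1 : (Finset.univ : Finset X) ⊆ {x, y} := fun z _ => by
    obtain ⟨k, hk⟩ := C.irreducible x z
    simpa using key k z hk
  have h2 := Finset.card_le_card h1
  rw [Finset.card_univ] at h2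
  have h3 := Finset.card_le_two (a := x) (b := y)
  omega

/-- A window which is negligible for all small enough precisions entails cutoff, by monotonicity
of mixing times in the precision. -/
lemma hasCutoff_of_window {t : ℕ → ℝ → ℝ}
    (hanti : ∀ n ε δ, 0 < ε → ε ≤ δ → t n δ ≤ t n ε) {ε₁ : ℝ} (hε₁ : 0 < ε₁)
    (h : ∀ ε, 0 < ε → ε < ε₁ → ∃ q : ℕ → ℝ, Tendsto q atTop (𝓝 0) ∧
      ∀ᶠ n in atTop, 0 < t n ε ∧ t n ε - t n (1 - ε) ≤ q n * t n ε) :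
    HasCutoff t := by
  intro ε hε hε1
  set η := min ε₁ (min ε (1 - ε)) / 2 with hη
  have hmin : 0 < min ε₁ (min ε (1 - ε)) := lt_min hε₁ (lt_min hε (sub_pos.2 hε1))
  have hη0 : 0 < η := half_pos hmin
  have hη' : η < min ε₁ (min ε (1 - ε)) := half_lt_self hmin
  have hη1 : η < ε₁ := hη'.trans_le (min_le_left _ _)
  have hη2 : η < ε := hη'.trans_le ((min_le_right _ _).trans (min_le_left _ _))
  have hη3 : η < 1 - ε := hη'.trans_le ((min_le_right _ _).trans (min_le_right _ _))
  obtain ⟨q, hq, hev⟩ := h η hη0 hη1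
  have hlow : Tendsto (fun n => 1 - q n) atTop (𝓝 1) := by
    simpa using tendsto_const_nhds.sub hq
  have hup : Tendsto (fun n => (1 - q n)⁻¹) atTop (𝓝 1) := by
    simpa using hlow.inv₀ one_ne_zero
  have hq1 : ∀ᶠ n in atTop, q n < 1 := hq.eventually (gt_mem_nhds one_pos)
  refine tendsto_of_tendsto_of_tendsto_of_le_of_le' hlow hup ?_ ?_
  · filter_upwards [hev, hq1] with n hn hqn
    have h1 : (1 - q n) * t n η ≤ t n (1 - η) := by linarith [hn.2]
    have h2 : t n (1 - η) ≤ t n (1 - ε) := hanti n _ _ (by linarith) (by linarith)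
    have h3 : t n (1 - η) ≤ t n ε := hanti n _ _ hε (by linarith)
    have h4 : t n ε ≤ t n η := hanti n _ _ hη0 hη2.le
    have h5 : 0 < t n ε := (mul_pos (sub_pos.2 hqn) hn.1).trans_le (h1.trans h3)
    rw [le_div_iff₀ h5]
    exact (mul_le_mul_of_nonneg_left h4 (sub_pos.2 hqn).le).trans (h1.trans h2)
  · filter_upwards [hev, hq1] with n hn hqn
    have h1 : (1 - q n) * t n η ≤ t n (1 - η) := by linarith [hn.2]
    have h2 : t n (1 - ε) ≤ t n η := hanti n _ _ hη0 hη3.le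
    have h3 : t n (1 - η) ≤ t n ε := hanti n _ _ hε (by linarith)
    have h5 : 0 < t n ε := (mul_pos (sub_pos.2 hqn) hn.1).trans_le (h1.trans h3)
    rw [div_le_iff₀ h5, inv_mul_eq_div, le_div_iff₀ (sub_pos.2 hqn), mul_comm]
    exact (mul_le_mul_of_nonneg_left h2 (sub_pos.2 hqn).le).trans (h1.trans h3)

/-- The spectral window is negligible under the product condition. -/
lemma max_window_le {γ τ δ L b R : ℝ} (hγ : 0 < γ) (hτ : 0 < τ) (hR : 1 ≤ R) (hb : 1 / 2 ≤ b)
    (h : R * b ≤ γ * τ) (hδ : δ ≤ b) (hL : L ≤ b) :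
    max (1 / γ) (max √(τ * δ / γ) √(τ / γ * L)) ≤ τ * (2 / √R) := by
  have hR0 : 0 < R := by linarith
  have hsR : 1 ≤ √R := Real.one_le_sqrt.2 hR
  have hsq : √R ^ 2 = R := Real.sq_sqrt hR0.le
  have hkey : ∀ q, q ≤ b → √(τ * q / γ) ≤ τ * (2 / √R) := by
    intro q hq
    refine Real.sqrt_le_iff.2 ⟨by positivity, ?_⟩
    have e : (τ * (2 / √R)) ^ 2 = 4 * τ ^ 2 / R := by
      rw [mul_pow, div_pow, hsq]; ring
    rw [e, div_le_div_iff₀ hγ hR0]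
    have h1 : τ * (q * R) ≤ τ * (γ * τ) :=
      mul_le_mul_of_nonneg_left
        ((mul_le_mul_of_nonneg_right hq hR0.le).trans (by linarith)) hτ.le
    have h2 : 0 ≤ τ * (γ * τ) := by positivity
    linarith
  refine max_le ?_ (max_le (hkey δ hδ) ?_)
  · rw [mul_div_assoc', div_le_div_iff₀ hγ (by positivity)]
    have h1 : √R ≤ R := (le_self_pow₀ hsR two_ne_zero).trans hsq.le
    have h2 : R * (1 / 2) ≤ R * b := mul_le_mul_of_nonneg_left hb hR0.le
    linarith
  · rw [div_mul_eq_mul_div]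
    exact hkey L hL

/-- The entropic window is negligible under the entropic product condition. -/
lemma max_log_window_le {α τ u b R : ℝ} (hα : 0 < α) (hR : 1 ≤ R) (hb : 1 ≤ b)
    (h : R * b ≤ α * τ) (hu : u ≤ b) :
    max 1 (max u (Real.log (α * τ))) / α ≤ τ * (2 / √R) := by
  have hR0 : 0 < R := by linarith
  have hsR : 1 ≤ √R := Real.one_le_sqrt.2 hR
  have hsq : √R ^ 2 = R := Real.sq_sqrt hR0.le
  have ha : R ≤ α * τ := le_trans (le_mul_of_one_le_right hR0.le hb) h
  have ha0 : 0 < α * τ := hR0.trans_le ha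
  rw [div_le_iff₀ hα]
  have e : τ * (2 / √R) * α = α * τ * (2 / √R) := by ring
  rw [e]
  have h1 : b ≤ α * τ * (2 / √R) := by
    rw [mul_div_assoc', le_div_iff₀ (by positivity)]
    have h1 : √R ≤ R := (le_self_pow₀ hsR two_ne_zero).trans hsq.le
    have h2 := mul_le_mul_of_nonneg_left h1 (zero_le_one.trans hb)
    linarith
  have h2 : Real.log (α * τ) ≤ α * τ * (2 / √R) := by
    have h3 : Real.log (α * τ) ≤ 2 * √(α * τ) := by
      have h4 := Real.log_le_sub_one_of_pos (Real.sqrt_pos.2 ha0)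
      rw [Real.log_sqrt ha0.le] at h4
      linarith
    refine h3.trans ?_
    rw [mul_div_assoc', le_div_iff₀ (by positivity)]
    have h4 : √R ≤ √(α * τ) := Real.sqrt_le_sqrt ha
    have h5 := mul_le_mul_of_nonneg_left h4 (Real.sqrt_nonneg (α * τ))
    rw [Real.mul_self_sqrt ha0.le] at h5
    linarith
  exact max_le (hb.trans h1) (max_le (hu.trans h1) h2)

lemma tendsto_const_mul_two_div_sqrt {R : ℕ → ℝ} (hR : Tendsto R atTop atTop) (c : ℝ) :
    Tendsto (fun n => c * (2 / √(R n))) atTop (𝓝 0) := by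
  have h := (tendsto_const_nhds (x := (2 : ℝ))).div_atTop (Real.tendsto_sqrt_atTop.comp hR)
  simpa using h.const_mul c

section Sequences

variable {X : ℕ → Type u} [∀ n, Fintype (X n)] [∀ n, DecidableEq (X n)]
  (C : ∀ n, FiniteMarkovChain (X n))

lemma eventually_two_le_sparsity (hcard : Tendsto (fun n => Fintype.card (X n)) atTop atTop)
    (hW : ∀ n, (C n).WeaklyReversible) : ∀ᶠ n in atTop, 2 ≤ (C n).sparsity := by
  filter_upwards [hcard.eventually_ge_atTop 3] with n hn
  exact (C n).two_le_sparsity (hW n) hn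

lemma hasCutoff_tmixFrom_of_poincare
    (hcard : Tendsto (fun n => Fintype.card (X n)) atTop atTop)
    (hW : ∀ n, (C n).WeaklyReversible) (hρ : ∀ n, 0 ≤ (C n).curvature) (x : ∀ n, X n) {ε : ℝ}
    (hε : 0 < ε)
    (h : MuchGreater
      (fun n => (C n).poincareConst * (C n).tmixFrom ((C n).dirac (x n)) ε)
      (fun n => max (Real.log (C n).sparsity)
        (Real.log ((C n).poincareConst * (C n).diam)))) :
    HasCutoff (fun n ε => (C n).tmixFrom ((C n).dirac (x n)) ε) := by
  refine hasCutoff_of_window (fun n ε δ hε h => (C n).tmixFrom_antitone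
    ((C n).dirac_nonneg _) ((C n).mean_dirac _) hε h) (ε₁ := min ε 1) (lt_min hε one_pos)
    fun η hη hη' => ?_
  have hηε : η ≤ ε := (hη'.trans_le (min_le_left _ _)).le
  obtain ⟨c, hc, hwidth⟩ := exists_wmixFrom_le_poincare.{u} hη (hη'.trans_le (min_le_right _ _))
  refine ⟨_, tendsto_const_mul_two_div_sqrt h c, ?_⟩
  filter_upwards [eventually_two_le_sparsity C hcard hW, h.eventually_ge_atTop 2] with n hd hR
  have := (C n).nontrivial_of_two_le_sparsity hd
  have hγ := (C n).poincareConst_pos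
  have hln2 := Real.log_two_gt_d9
  have hlog2 : Real.log 2 ≤ Real.log (C n).sparsity := Real.log_le_log two_pos hd
  have hD1 : (1 : ℝ) ≤ (C n).diam := by exact_mod_cast (C n).one_le_diam
  have hw := hwidth (X n) (C n) (hW n) (hρ n) hd (x n)
  have hmono : (C n).tmixFrom ((C n).dirac (x n)) ε ≤ (C n).tmixFrom ((C n).dirac (x n)) η :=
    (C n).tmixFrom_antitone ((C n).dirac_nonneg _) ((C n).mean_dirac _) hη hηε
  set γ := (C n).poincareConst
  set τ := (C n).tmixFrom ((C n).dirac (x n)) η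
  set b := max (Real.log (C n).sparsity) (Real.log (γ * (C n).diam)) with hb
  have hb1 : 1 / 2 ≤ b := le_trans (by linarith) (le_max_left _ _)
  set R := γ * (C n).tmixFrom ((C n).dirac (x n)) ε / b with hRdef
  have hRb : R * b ≤ γ * τ := by
    rw [hRdef, div_mul_cancel₀ _ (by linarith)]
    exact mul_le_mul_of_nonneg_left hmono hγ.le
  have ha1 : 1 ≤ γ * τ := by
    have := mul_le_mul hR hb1 (by norm_num) (by linarith)
    linarith
  have hτ : 0 < τ := pos_of_mul_pos_right (one_pos.trans_le ha1) hγ.le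
  have hL : Real.posLog ((C n).diam / τ) ≤ b := by
    have h1 : ((C n).diam : ℝ) / τ ≤ γ * (C n).diam := by
      rw [div_le_iff₀ hτ]
      linarith [mul_le_mul_of_nonneg_right ha1 (zero_le_one.trans hD1)]
    refine (Real.posLog_le_posLog (by positivity) h1).trans ?_
    rw [Real.posLog_apply]
    exact max_le (by linarith) (le_max_right _ _)
  have hwin := max_window_le hγ hτ (by linarith) hb1 hRb (le_max_left _ _) hL
  refine ⟨hτ, hw.trans ?_⟩
  calc _ ≤ c * (τ * (2 / √R)) := mul_le_mul_of_nonneg_left hwin hc.le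
    _ = _ := by ring

lemma hasCutoff_tmixFrom_of_mls
    (hcard : Tendsto (fun n => Fintype.card (X n)) atTop atTop)
    (hW : ∀ n, (C n).WeaklyReversible) (hρ : ∀ n, 0 ≤ (C n).curvature) (x : ∀ n, X n) {ε : ℝ}
    (hε : 0 < ε)
    (h : MuchGreater
      (fun n => (C n).mlsConst * (C n).tmixFrom ((C n).dirac (x n)) ε)
      (fun n => max 1 (Real.log (Real.log (C n).sparsity)))) :
    HasCutoff (fun n ε => (C n).tmixFrom ((C n).dirac (x n)) ε) := by
  refine hasCutoff_of_window (fun n ε δ hε h => (C n).tmixFrom_antitone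
    ((C n).dirac_nonneg _) ((C n).mean_dirac _) hε h) (ε₁ := min ε 1) (lt_min hε one_pos)
    fun η hη hη' => ?_
  have hηε : η ≤ ε := (hη'.trans_le (min_le_left _ _)).le
  obtain ⟨c, hc, hwidth⟩ := exists_wmixFrom_le_mls.{u} hη (hη'.trans_le (min_le_right _ _))
  refine ⟨_, tendsto_const_mul_two_div_sqrt h c, ?_⟩
  filter_upwards [eventually_two_le_sparsity C hcard hW, h.eventually_ge_atTop 1] with n hd hR
  have := (C n).nontrivial_of_two_le_sparsity hd
  have hα := (C n).mlsConst_pos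
  have hw := hwidth (X n) (C n) (hW n) (hρ n) hd (x n)
  have hmono : (C n).tmixFrom ((C n).dirac (x n)) ε ≤ (C n).tmixFrom ((C n).dirac (x n)) η :=
    (C n).tmixFrom_antitone ((C n).dirac_nonneg _) ((C n).mean_dirac _) hη hηε
  set α := (C n).mlsConst
  set τ := (C n).tmixFrom ((C n).dirac (x n)) η
  set b := max 1 (Real.log (Real.log (C n).sparsity)) with hb
  have hb1 : 1 ≤ b := le_max_left _ _
  set R := α * (C n).tmixFrom ((C n).dirac (x n)) ε / b with hRdef
  have hRb : R * b ≤ α * τ := by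
    rw [hRdef, div_mul_cancel₀ _ (by linarith)]
    exact mul_le_mul_of_nonneg_left hmono hα.le
  have hτ : 0 < τ := by
    have h1 : 1 ≤ R * b := one_le_mul_of_one_le_of_one_le hR hb1
    exact pos_of_mul_pos_right (one_pos.trans_le (h1.trans hRb)) hα.le
  have hwin := max_log_window_le hα hR hb1 hRb (le_max_right _ _)
  refine ⟨hτ, hw.trans ?_⟩
  rw [div_mul_eq_mul_div, mul_div_assoc]
  calc _ ≤ c * (τ * (2 / √R)) := mul_le_mul_of_nonneg_left hwin hc.le
    _ = _ := by ring

lemma hasCutoff_tmix_of_poincare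
    (hcard : Tendsto (fun n => Fintype.card (X n)) atTop atTop)
    (hW : ∀ n, (C n).WeaklyReversible) (hρ : ∀ n, 0 ≤ (C n).curvature)
    (h : MuchGreater (fun n => (C n).poincareConst * (C n).tmixDefault)
      (fun n => Real.log (C n).sparsity)) :
    HasCutoff (fun n ε => (C n).tmix ε) := by
  have he : (0 : ℝ) < 1 / (2 * Real.exp 1) := by positivity
  refine hasCutoff_of_window (fun n ε δ hε h => (C n).tmix_antitone hε h)
    (ε₁ := min (1 / (2 * Real.exp 1)) (1 / 2)) (lt_min he (by norm_num)) fun η hη hη' => ?_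
  have hηε : η ≤ 1 / (2 * Real.exp 1) := (hη'.trans_le (min_le_left _ _)).le
  obtain ⟨c, hc, hwidth⟩ := exists_wmix_le.{u} hη (hη'.trans_le (min_le_right _ _))
  refine ⟨_, tendsto_const_mul_two_div_sqrt h c, ?_⟩
  filter_upwards [eventually_two_le_sparsity C hcard hW, h.eventually_ge_atTop 1] with n hd hR
  have := (C n).nontrivial_of_two_le_sparsity hd
  have hγ := (C n).poincareConst_pos
  have hln2 := Real.log_two_gt_d9
  have hlog2 : Real.log 2 ≤ Real.log (C n).sparsity := Real.log_le_log two_pos hd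
  have hw := (hwidth (X n) (C n) (hW n) (hρ n) hd).1
  have hmono : (C n).tmixDefault ≤ (C n).tmix η := (C n).tmix_antitone hη hηε
  set γ := (C n).poincareConst
  set τ := (C n).tmixDefault
  set b := Real.log (C n).sparsity with hb
  have hb1 : 1 / 2 ≤ b := by linarith
  set R := γ * τ / b with hRdef
  have hRb : R * b ≤ γ * τ := (div_mul_cancel₀ _ (by linarith)).le
  have hτ : 0 < τ := by
    have h1 := mul_le_mul hR hb1 (by norm_num) (by linarith)
    exact pos_of_mul_pos_right ((by norm_num : (0 : ℝ) < 1 * (1 / 2)).trans_le (h1.trans hRb)) hγ.le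
  have hwin := (max_le_max le_rfl (le_max_left _ _)).trans
    (max_window_le (L := b) hγ hτ hR hb1 hRb le_rfl le_rfl)
  refine ⟨hτ.trans_le hmono, hw.trans ?_⟩
  calc _ ≤ c * (τ * (2 / √R)) := mul_le_mul_of_nonneg_left hwin hc.le
    _ ≤ c * ((C n).tmix η * (2 / √R)) := by gcongr
    _ = _ := by ring

lemma hasCutoff_tmix_of_mls
    (hcard : Tendsto (fun n => Fintype.card (X n)) atTop atTop)
    (hW : ∀ n, (C n).WeaklyReversible) (hρ : ∀ n, 0 ≤ (C n).curvature)
    (h : MuchGreater (fun n => (C n).mlsConst * (C n).tmixDefault)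
      (fun n => max 1 (Real.log (Real.log (C n).sparsity)))) :
    HasCutoff (fun n ε => (C n).tmix ε) := by
  have he : (0 : ℝ) < 1 / (2 * Real.exp 1) := by positivity
  refine hasCutoff_of_window (fun n ε δ hε h => (C n).tmix_antitone hε h)
    (ε₁ := min (1 / (2 * Real.exp 1)) (1 / 2)) (lt_min he (by norm_num)) fun η hη hη' => ?_
  have hηε : η ≤ 1 / (2 * Real.exp 1) := (hη'.trans_le (min_le_left _ _)).le
  obtain ⟨c, hc, hwidth⟩ := exists_wmix_le.{u} hη (hη'.trans_le (min_le_right _ _))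
  refine ⟨_, tendsto_const_mul_two_div_sqrt h c, ?_⟩
  filter_upwards [eventually_two_le_sparsity C hcard hW, h.eventually_ge_atTop 1] with n hd hR
  have := (C n).nontrivial_of_two_le_sparsity hd
  have hα := (C n).mlsConst_pos
  have hw := (hwidth (X n) (C n) (hW n) (hρ n) hd).2
  have hmono : (C n).tmixDefault ≤ (C n).tmix η := (C n).tmix_antitone hη hηε
  set α := (C n).mlsConst
  set τ := (C n).tmixDefault
  set b := max 1 (Real.log (Real.log (C n).sparsity)) with hb
  have hb1 : 1 ≤ b := le_max_left _ _
  set R := α * τ / b with hRdef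
  have hRb : R * b ≤ α * τ := (div_mul_cancel₀ _ (by linarith)).le
  have hτ : 0 < τ := by
    have h1 : 1 ≤ R * b := one_le_mul_of_one_le_of_one_le hR hb1
    exact pos_of_mul_pos_right (one_pos.trans_le (h1.trans hRb)) hα.le
  have hwin := max_log_window_le hα hR hb1 hRb (le_max_right _ _)
  refine ⟨hτ.trans_le hmono, hw.trans ?_⟩
  rw [div_mul_eq_mul_div, mul_div_assoc]
  calc _ ≤ c * (τ * (2 / √R)) := mul_le_mul_of_nonneg_left hwin hc.le
    _ ≤ c * ((C n).tmix η * (2 / √R)) := by gcongr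
    _ = _ := by ring

end Sequences

end FiniteMarkovChain

theorem mainTheorem1 :
    -- information-theoretic differential inequality
    (∀ (X : Type u) [Fintype X] [DecidableEq X] (C : FiniteMarkovChain X),
      C.WeaklyReversible → 0 ≤ C.curvature → 2 ≤ C.sparsity →
      ∀ x : X, C.SatisfiesIDI (C.dirac x) (fun t =>
        16 * t * Real.log C.sparsity + 4 * t * Real.posLog (C.diam / t))) ∧
    -- width estimates, with a constant that depends only on `ε`
    (∀ ε : ℝ, 0 < ε → ε < 1 / 2 → ∃ c : ℝ, 0 < c ∧
      ∀ (X : Type u) [Fintype X] [DecidableEq X] (C : FiniteMarkovChain X),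
      C.WeaklyReversible → 0 ≤ C.curvature → 2 ≤ C.sparsity →
      (∀ x : X,
        C.wmixFrom (C.dirac x) ε ≤ c * max (1 / C.poincareConst)
          (max
            √(C.tmixFrom (C.dirac x) ε * Real.log C.sparsity / C.poincareConst)
            √(C.tmixFrom (C.dirac x) ε / C.poincareConst *
              Real.posLog (C.diam / C.tmixFrom (C.dirac x) ε))) ∧
        C.wmixFrom (C.dirac x) ε ≤ c / C.mlsConst *
          max 1 (max (Real.log (Real.log C.sparsity))
            (Real.log (C.mlsConst * C.tmixFrom (C.dirac x) ε)))) ∧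
      C.wmix ε ≤ c * max (1 / C.poincareConst)
        √(C.tmixDefault * Real.log C.sparsity / C.poincareConst) ∧
      C.wmix ε ≤ c / C.mlsConst *
        max 1 (max (Real.log (Real.log C.sparsity))
          (Real.log (C.mlsConst * C.tmixDefault)))) ∧
    -- cutoff, for a model with diverging state spaces
    (∀ (X : ℕ → Type u) [∀ n, Fintype (X n)] [∀ n, DecidableEq (X n)]
      (C : ∀ n, FiniteMarkovChain (X n)),
      Tendsto (fun n => Fintype.card (X n)) atTop atTop →
      (∀ n, (C n).WeaklyReversible) → (∀ n, 0 ≤ (C n).curvature) →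
      (∀ x : ∀ n, X n,
        (∃ ε : ℝ, 0 < ε ∧ ε < 1 ∧
          (MuchGreater
            (fun n => (C n).poincareConst * (C n).tmixFrom ((C n).dirac (x n)) ε)
            (fun n => max (Real.log (C n).sparsity)
              (Real.log ((C n).poincareConst * (C n).diam))) ∨
          MuchGreater
            (fun n => (C n).mlsConst * (C n).tmixFrom ((C n).dirac (x n)) ε)
            (fun n => max 1 (Real.log (Real.log (C n).sparsity))))) →
        HasCutoff (fun n ε => (C n).tmixFrom ((C n).dirac (x n)) ε)) ∧
      ((MuchGreater
          (fun n => (C n).poincareConst * (C n).tmixDefault)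
          (fun n => Real.log (C n).sparsity) ∨
        MuchGreater
          (fun n => (C n).mlsConst * (C n).tmixDefault)
          (fun n => max 1 (Real.log (Real.log (C n).sparsity)))) →
        HasCutoff (fun n ε => (C n).tmix ε))) := by
  refine ⟨fun X _ _ C hW hρ hd x => C.satisfiesIDI_dirac hW hρ hd x, fun ε hε hε2 => ?_,
    fun X _ _ C hcard hW hρ => ⟨?_, ?_⟩⟩
  · have hε1 : ε < 1 := by linarith
    obtain ⟨c₁, hc₁, h₁⟩ := FiniteMarkovChain.exists_wmixFrom_le_poincare.{u} hε hε1
    obtain ⟨c₂, -, h₂⟩ := FiniteMarkovChain.exists_wmixFrom_le_mls.{u} hε hε1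
    obtain ⟨c₃, -, h₃⟩ := FiniteMarkovChain.exists_wmix_le.{u} hε hε2
    refine ⟨max c₁ (max c₂ c₃), hc₁.trans_le (le_max_left _ _), fun X _ _ C hW hρ hd => ?_⟩
    have := C.nontrivial_of_two_le_sparsity hd
    have hγ := C.poincareConst_pos
    have hα := C.mlsConst_pos
    have hm₁ : c₁ ≤ max c₁ (max c₂ c₃) := le_max_left _ _
    have hm₂ : c₂ ≤ max c₁ (max c₂ c₃) := (le_max_left _ _).trans (le_max_right _ _)
    have hm₃ : c₃ ≤ max c₁ (max c₂ c₃) := (le_max_right _ _).trans (le_max_right _ _)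
    refine ⟨fun x => ⟨(h₁ X C hW hρ hd x).trans ?_, (h₂ X C hW hρ hd x).trans ?_⟩,
      (h₃ X C hW hρ hd).1.trans ?_, (h₃ X C hW hρ hd).2.trans ?_⟩
    · exact mul_le_mul_of_nonneg_right hm₁ (le_max_of_le_left (one_div_pos.2 hγ).le)
    · exact mul_le_mul_of_nonneg_right (div_le_div_of_nonneg_right hm₂ hα.le)
        (le_max_of_le_left zero_le_one)
    · exact mul_le_mul_of_nonneg_right hm₃ (le_max_of_le_left (one_div_pos.2 hγ).le)
    · exact mul_le_mul_of_nonneg_right (div_le_div_of_nonneg_right hm₃ hα.le)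
        (le_max_of_le_left zero_le_one)
  · rintro x ⟨ε, hε, -, h | h⟩
    · exact FiniteMarkovChain.hasCutoff_tmixFrom_of_poincare C hcard hW hρ x hε h
    · exact FiniteMarkovChain.hasCutoff_tmixFrom_of_mls C hcard hW hρ x hε h
  · rintro (h | h)
    · exact FiniteMarkovChain.hasCutoff_tmix_of_poincare C hcard hW hρ h
    · exact FiniteMarkovChain.hasCutoff_tmix_of_mls C hcard hW hρ h
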